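/- Let $k$ be a field of characteristic $2$, let $E$ be an elementary abelian $2$-group of rank $r\ge 0$ with generators $g_1,\dots,g_r$, and let $kE$ be its group algebra. Put $z_i=g_i-1\in kE$, so that $z_i^2=0$ (and $kE=k[z_1,\dots,z_r]/(z_1^2,\dots,z_r^2)$). Let $S=k[x_1,\dots,x_r]$ be the polynomial algebra graded by $|x_i|=1$, regarded as a differential graded (DG) algebra with zero differential. Let $J=kE\otimes_k S$ be the complex of $kE$-modules with $J^n=kE\otimes_k S^n$ (so $J^n=0$ for $n<0$) and with differential $d(e)=\delta e$, where $\delta=\sum_{i=1}^r z_i\otimes x_i$; note that $\delta^2=0$. For a complex $M$ of $kE$-modules let $\operatorname{Hom}_{kE}(J,M)$ be the Hom complex, with degree $n$ component $\prod_{p}\operatorname{Hom}_{kE}(J^p,M^{p+n})$ and differential $d(f)=d\circ f-(-1)^{|f|}f\circ d$. It is a DG $S$-module via $(sf)(e)=f((1\otimes s)e)$. Let $$\zeta\colon S\longrightarrow \operatorname{Hom}_{kE}(J,J)=\operatorname{End}_{kE}(J)$$ be the morphism of DG algebras that sends $s\in S$ to multiplication by $1\otimes s$. Let $\mathsf K(\operatorname{Inj}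 kE)$ be the homotopy category of complexes of injective $kE$-modules, and let $\mathsf D(S)$ be the derived category of DG $S$-modules, that is, the homotopy category of DG $S$-modules with the quasi-isomorphisms inverted. Then $\zeta$ is a quasi-isomorphism, and the functor $$\operatorname{Hom}_{kE}(J,-)\colon \mathsf K(\operatorname{Inj} kE)\longrightarrow \mathsf D(S)$$ is an equivalence of triangulated categories (that is, it is an exact functor of triangulated categories and an equivalence of categories). -/

import Mathlib

universe u

noncomputable section

open CategoryTheory CategoryTheory.Limits CategoryTheory.Pretriangulated
open CochainComplex.HomComplex
open scoped TensorProduct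

/-- A differential graded algebra over `k` (cohomological grading by `ℤ`, differential of
degree `1`): a cochain complex of `k`-modules with a unital associative product satisfying
`d(ab) = d(a) b + (-1)^|a| a d(b)`. -/
structure DGAlgebra (k : Type u) [Field k] where
  X : CochainComplex (ModuleCat.{u} k) ℤ
  one : X.X 0
  mul {p q n : ℤ} (h : p + q = n) : X.X p →ₗ[k] X.X q →ₗ[k] X.X n
  one_mul {n : ℤ} (a : X.X n) : mul (zero_add n) one a = a
  mul_one {n : ℤ} (a : X.X n) : mul (add_zero n) a one = a
  mul_assoc {p q r pq qr n : ℤ} (hpq : p + q = pq) (hqr : q + r = qr) (h : pq + r = n)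
    (h' : p + qr = n) (a : X.X p) (b : X.X q) (c : X.X r) :
    mul h (mul hpq a b) c = mul h' a (mul hqr b c)
  leibniz {p q n : ℤ} (h : p + q = n) (a : X.X p) (b : X.X q) :
    X.d n (n + 1) (mul h a b) =
      mul (by omega : (p + 1) + q = n + 1) (X.d p (p + 1) a) b +
        p.negOnePow • mul (by omega : p + (q + 1) = n + 1) a (X.d q (q + 1) b)

namespace DGAlgebra

variable {k : Type u} [Field k]

/-- A morphism of differential graded algebras. -/
@[ext]
structure Hom (A B : DGAlgebra k) where
  hom : A.X ⟶ B.X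
  map_one : hom.f 0 A.one = B.one
  map_mul {p q n : ℤ} (h : p + q = n) (a : A.X.X p) (b : A.X.X q) :
    hom.f n (A.mul h a b) = B.mul h (hom.f p a) (hom.f q b)

end DGAlgebra

section HomComplex

variable (k : Type u) [Field k] {C : Type*} [Category.{u} C] [Preadditive C] [Linear k C]

/-- The complex of `k`-modules `Hom(F, G)`: in degree `n` it is `∏ₚ Hom(F^p, G^(p+n))` and
the differential is `d(f) = d ∘ f - (-1)^|f| f ∘ d`. -/
def homComplex (F G : CochainComplex C ℤ) : CochainComplex (ModuleCat.{u} k) ℤ where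
  X n := ModuleCat.of k (Cochain F G n)
  d n m := ModuleCat.ofHom (δ_hom k F G n m)
  shape n m h := by
    exact ModuleCat.hom_ext (LinearMap.ext fun z => δ_shape n m h z)
  d_comp_d' a b c _ _ := by
    exact ModuleCat.hom_ext (LinearMap.ext fun z => δ_δ a b c z)

/-- The differential graded algebra `End(F)`, with product `f g = f ∘ g`. -/
def endDGAlgebra (F : CochainComplex C ℤ) : DGAlgebra k where
  X := homComplex k F F
  one := (Cochain.ofHom (𝟙 F) : Cochain F F 0)
  mul {p q n} h := LinearMap.mk₂ k
    (fun (f : Cochain F F p) (g : Cochain F F q) =>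
      (g.comp f ((add_comm q p).trans h) : Cochain F F n))
    (fun _ _ _ => Cochain.comp_add _ _ _ _) (fun _ _ _ => Cochain.comp_smul _ _ _ _)
    (fun _ _ _ => Cochain.add_comp _ _ _ _) (fun _ _ _ => Cochain.smul_comp _ _ _ _)
  one_mul a := Cochain.comp_id (show Cochain F F _ from a)
  mul_one a := Cochain.id_comp (show Cochain F F _ from a)
  mul_assoc {p q r pq qr n} hpq hqr h h' a b c :=
    (Cochain.comp_assoc (show Cochain F F r from c) (show Cochain F F q from b)
      (show Cochain F F p from a) (by omega) (by omega) (by omega)).symm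
  leibniz {p q n} h a b :=
    (δ_comp (show Cochain F F q from b) (show Cochain F F p from a) (by omega)
      (q + 1) (p + 1) (n + 1) rfl rfl rfl)

end HomComplex

/-- A (left) differential graded module over a differential graded algebra `A`: a complex of
`k`-modules `X` together with an action of `A`. An element `a` of degree `p` acts by the
`k`-linear map `act p a` of degree `p`, whose component `X^q ⟶ X^n`, for `q + p = n`, is
`m ↦ a m`. The axiom `leibniz` says that `d(a m) - (-1)^|a| a d(m) = d(a) m`. -/
structure DGModule {k : Type u} [Field k] (A : DGAlgebra k) where
  X : CochainComplex (ModuleCat.{u} k) ℤ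
  act (p : ℤ) : A.X.X p →ₗ[k] Cochain X X p
  act_one : act 0 A.one = Cochain.ofHom (𝟙 X)
  act_mul {p q n : ℤ} (h : p + q = n) (a : A.X.X p) (b : A.X.X q) :
    act n (A.mul h a b) = (act q b).comp (act p a) ((add_comm q p).trans h)
  leibniz {p : ℤ} (a : A.X.X p) : δ p (p + 1) (act p a) = act (p + 1) (A.X.d p (p + 1) a)

namespace DGModule

variable {k : Type u} [Field k] {A : DGAlgebra k}

/-- A homogeneous map `z` of degree `n` between differential graded `A`-modules is `A`-linear
if `z(a m) = (-1)^(n |a|) a z(m)`. -/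
def IsLinear (M N : DGModule A) {n : ℤ} (z : Cochain M.X N.X n) : Prop :=
  ∀ (p m : ℤ) (h : p + n = m) (a : A.X.X p),
    (M.act p a).comp z h = (n * p).negOnePow • z.comp (N.act p a) ((add_comm n p).trans h)

/-- A morphism of differential graded modules: an `A`-linear morphism of complexes. -/
@[ext]
structure Hom (M N : DGModule A) where
  hom : M.X ⟶ N.X
  linear : IsLinear M N (Cochain.ofHom hom)

namespace IsLinear

variable {M N P : DGModule A}

lemma zero (n : ℤ) : IsLinear M N (0 : Cochain M.X N.X n) := by
  intro p m h a
  simp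

lemma add {n : ℤ} {z z' : Cochain M.X N.X n} (hz : IsLinear M N z) (hz' : IsLinear M N z') :
    IsLinear M N (z + z') := by
  intro p m h a
  simp [hz p m h a, hz' p m h a]

lemma neg {n : ℤ} {z : Cochain M.X N.X n} (hz : IsLinear M N z) : IsLinear M N (-z) := by
  intro p m h a
  simp [hz p m h a]

lemma units_smul {n : ℤ} (c : ℤˣ) {z : Cochain M.X N.X n} (hz : IsLinear M N z) :
    IsLinear M N (c • z) := by
  intro p m h a
  simp [hz p m h a, Cochain.comp_units_smul, Cochain.units_smul_comp, smul_smul, mul_comm]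

lemma comp {n₁ n₂ n₁₂ : ℤ} {z₁ : Cochain M.X N.X n₁} {z₂ : Cochain N.X P.X n₂}
    (h₁ : IsLinear M N z₁) (h₂ : IsLinear N P z₂) (h : n₁ + n₂ = n₁₂) :
    IsLinear M P (z₁.comp z₂ h) := by
  intro p m hm a
  rw [← Cochain.comp_assoc (M.act p a) z₁ z₂ rfl h (by omega), h₁ p _ rfl a,
    Cochain.units_smul_comp, Cochain.comp_assoc z₁ (N.act p a) z₂ (by omega) rfl (by omega),
    h₂ p _ rfl a, Cochain.comp_units_smul,
    Cochain.comp_assoc z₁ z₂ (P.act p a) h (by omega : _ = p + n₂) (by omega), smul_smul,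
    ← Int.negOnePow_add]
  congr 2
  rw [← h]; ring

lemma id (M : DGModule A) : IsLinear M M (Cochain.ofHom (𝟙 M.X)) := by
  intro p m h a
  obtain rfl : m = p := by omega
  simp

end IsLinear

instance : Category (DGModule A) where
  Hom M N := Hom M N
  id M := ⟨𝟙 M.X, IsLinear.id M⟩
  comp {M N P} f g := ⟨f.hom ≫ g.hom, by
    rw [Cochain.ofHom_comp]
    exact f.linear.comp g.linear _⟩
  id_comp f := Hom.ext (Category.id_comp f.hom)
  comp_id f := Hom.ext (Category.comp_id f.hom)
  assoc f g h := Hom.ext (Category.assoc f.hom g.hom h.hom)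

@[ext]
lemma hom_ext {M N : DGModule A} {f g : M ⟶ N} (h : f.hom = g.hom) : f = g := Hom.ext h

@[simp]
lemma id_hom (M : DGModule A) : Hom.hom (𝟙 M) = 𝟙 M.X := rfl

@[simp]
lemma comp_hom {M N P : DGModule A} (f : M ⟶ N) (g : N ⟶ P) :
    (f ≫ g).hom = f.hom ≫ g.hom := rfl

section Preadditive

variable {M N : DGModule A}

instance : Zero (M ⟶ N) := ⟨⟨0, by rw [Cochain.ofHom_zero]; exact .zero 0⟩⟩
instance : Add (M ⟶ N) :=
  ⟨fun f g => ⟨f.hom + g.hom, by rw [Cochain.ofHom_add]; exact f.linear.add g.linear⟩⟩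
instance : Neg (M ⟶ N) := ⟨fun f => ⟨-f.hom, by rw [Cochain.ofHom_neg]; exact f.linear.neg⟩⟩
instance : AddCommGroup (M ⟶ N) where
  add_assoc f g h := hom_ext (add_assoc f.hom g.hom h.hom)
  zero_add f := hom_ext (zero_add f.hom)
  add_zero f := hom_ext (add_zero f.hom)
  neg_add_cancel f := hom_ext (neg_add_cancel f.hom)
  add_comm f g := hom_ext (add_comm f.hom g.hom)
  nsmul := nsmulRec
  zsmul := zsmulRec

instance : Preadditive (DGModule A) where
  add_comp _ _ _ f g h := hom_ext (Preadditive.add_comp _ _ _ f.hom g.hom h.hom)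
  comp_add _ _ _ f g h := hom_ext (Preadditive.comp_add _ _ _ f.hom g.hom h.hom)

@[simp] lemma zero_hom : Hom.hom (0 : M ⟶ N) = 0 := rfl
@[simp] lemma add_hom (f g : M ⟶ N) : (f + g).hom = f.hom + g.hom := rfl
@[simp] lemma neg_hom (f : M ⟶ N) : (-f).hom = -f.hom := rfl

end Preadditive

variable (A) in
/-- The functor which sends a differential graded module to the underlying complex. -/
@[simps]
def forget : DGModule A ⥤ CochainComplex (ModuleCat.{u} k) ℤ where
  obj M := M.X
  map f := f.hom

instance : (forget A).Additive where

instance : (forget A).Faithful where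
  map_injective h := hom_ext h

/-- An isomorphism of differential graded modules, constructed from an isomorphism of
complexes which is `A`-linear. -/
@[simps]
def isoMk {M N : DGModule A} (e : M.X ≅ N.X) (h : IsLinear M N (Cochain.ofHom e.hom)) :
    M ≅ N where
  hom := ⟨e.hom, h⟩
  inv := ⟨e.inv, by
    intro p m hm a
    obtain rfl : m = p := by omega
    have h1 := h m m (add_zero m) a
    simp only [zero_mul, Int.negOnePow_zero, one_smul] at h1 ⊢
    have e1 : (Cochain.ofHom e.inv).comp (Cochain.ofHom e.hom) (zero_add 0) =
      Cochain.ofHom (𝟙 _) := by rw [← Cochain.ofHom_comp, e.inv_hom_id]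
    have e2 : (Cochain.ofHom e.hom).comp (Cochain.ofHom e.inv) (zero_add 0) =
      Cochain.ofHom (𝟙 _) := by rw [← Cochain.ofHom_comp, e.hom_inv_id]
    calc (N.act m a).comp (Cochain.ofHom e.inv) hm
        = ((Cochain.ofHom e.inv).comp ((Cochain.ofHom e.hom).comp (N.act m a)
            (zero_add m)) (zero_add m)).comp (Cochain.ofHom e.inv) hm := by
          rw [← Cochain.comp_assoc_of_first_is_zero_cochain, e1, Cochain.id_comp]
      _ = (Cochain.ofHom e.inv).comp (M.act m a) (zero_add m) := by
          rw [← h1, Cochain.comp_assoc_of_first_is_zero_cochain,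
            Cochain.comp_assoc_of_third_is_zero_cochain, e2, Cochain.comp_id]⟩
  hom_inv_id := hom_ext e.hom_inv_id
  inv_hom_id := hom_ext e.inv_hom_id

end DGModule

namespace DGModule

variable {k : Type u} [Field k] {A : DGAlgebra k}

section Shift

lemma cochain_shift_comp {C : Type*} [Category C] [Preadditive C] {F G K : CochainComplex C ℤ}
    {n₁ n₂ n₁₂ : ℤ} (z₁ : Cochain F G n₁) (z₂ : Cochain G K n₂) (h : n₁ + n₂ = n₁₂) (a : ℤ) :
    (z₁.comp z₂ h).shift a = (z₁.shift a).comp (z₂.shift a) h := by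
  ext i j hij
  rw [Cochain.shift_v', Cochain.comp_v z₁ z₂ h (i + a) (i + n₁ + a) (j + a) (by omega) (by omega),
    Cochain.comp_v _ _ h i (i + n₁) j rfl (by omega), Cochain.shift_v', Cochain.shift_v']
  rfl

/-- The shift `M⟦n⟧`: the complex `X⟦n⟧`, on which `a` acts by `(-1)^(n |a|) a`. -/
@[simps]
abbrev shiftObj (M : DGModule A) (n : ℤ) : DGModule A where
  X := M.X⟦n⟧
  act p :=
    { toFun := fun a => (n * p).negOnePow • (M.act p a).shift n
      map_add' := fun a b => by simp [Cochain.shift_add]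
      map_smul' := fun c a => by
        rw [map_smul, Cochain.shift_smul, RingHom.id_apply]
        exact (smul_comm c _ _).symm }
  act_one := by
    ext p
    simp [M.act_one, Cochain.shift_v']
  act_mul {p q r} h a b := by
    simp only [LinearMap.coe_mk, AddHom.coe_mk, M.act_mul h]
    rw [Cochain.comp_units_smul, Cochain.units_smul_comp, smul_smul, ← Int.negOnePow_add]
    congr 1
    · rw [← h]; ring_nf
    · exact cochain_shift_comp _ _ _ n
  leibniz {p} a := by
    simp only [LinearMap.coe_mk, AddHom.coe_mk, δ_units_smul, Cochain.δ_shift, M.leibniz,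
      smul_smul, ← Int.negOnePow_add]
    congr 2
    ring

lemma shiftObj_act (M : DGModule A) (n p : ℤ) (a : A.X.X p) :
    (M.shiftObj n).act p a = (n * p).negOnePow • (M.act p a).shift n := rfl

lemma IsLinear.shift {M N : DGModule A} {n : ℤ} {z : Cochain M.X N.X n} (hz : IsLinear M N z)
    (a : ℤ) : IsLinear (M.shiftObj a) (N.shiftObj a) (z.shift a) := by
  intro p m h x
  have e := congr_arg (fun y => Cochain.shift y a) (hz p m h x)
  rw [cochain_shift_comp, Cochain.shift_units_smul, cochain_shift_comp] at e
  rw [shiftObj_act, shiftObj_act, Cochain.units_smul_comp, Cochain.comp_units_smul, e,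
    smul_smul, smul_smul, mul_comm]

@[simp]
lemma cochain_shift_ofHom {C : Type*} [Category C] [Preadditive C] {F G : CochainComplex C ℤ}
    (f : F ⟶ G) (a : ℤ) : (Cochain.ofHom f).shift a = Cochain.ofHom (f⟦a⟧') := by
  ext p
  rw [Cochain.shift_v', Cochain.ofHom_v, Cochain.ofHom_v]
  rfl

variable (A) in
/-- The shift functor `M ↦ M⟦n⟧` on differential graded modules. -/
abbrev shiftFun (n : ℤ) : DGModule A ⥤ DGModule A where
  obj M := M.shiftObj n
  map f := ⟨f.hom⟦n⟧', by
    rw [← cochain_shift_ofHom]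
    exact f.linear.shift n⟩
  map_id M := hom_ext ((shiftFunctor (CochainComplex (ModuleCat.{u} k) ℤ) n).map_id M.X)
  map_comp f g :=
    hom_ext ((shiftFunctor (CochainComplex (ModuleCat.{u} k) ℤ) n).map_comp f.hom g.hom)

lemma cochain_v_comp_XIsoOfEq {C : Type*} [Category C] [Preadditive C]
    {F G : CochainComplex C ℤ} {n : ℤ} (z : Cochain F G n) (i i' j j' : ℤ) (h : i + n = j)
    (h' : i' + n = j') (hi : i = i') (hj : j = j') :
    z.v i j h ≫ (G.XIsoOfEq hj).hom = (F.XIsoOfEq hi).hom ≫ z.v i' j' h' := by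
  subst hi hj
  simp

variable (A) in
/-- The shift by `0` is the identity. -/
abbrev shiftFunZero : shiftFun A 0 ≅ 𝟭 (DGModule A) :=
  NatIso.ofComponents (fun M => isoMk
    ((shiftFunctorZero (CochainComplex (ModuleCat.{u} k) ℤ) ℤ).app M.X) (by
      intro p m h a
      obtain rfl : m = p := by omega
      refine Cochain.ext _ _ fun i j hij => ?_
      simp only [Cochain.comp_zero_cochain_v, Cochain.zero_cochain_comp_v, Cochain.ofHom_v,
        zero_mul, Int.negOnePow_zero, one_smul, CochainComplex.shiftFunctorZero_hom_app_f,
        Iso.app_hom]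
      exact cochain_v_comp_XIsoOfEq (M.act m a) (i + 0) i (j + 0) j (by omega) hij
        (by omega) (by omega)))
    (fun f => hom_ext ((shiftFunctorZero _ ℤ).hom.naturality f.hom))

variable (A) in
/-- The shift by `a + b` is the composition of the shifts by `a` and `b`. -/
abbrev shiftFunAdd (a b : ℤ) : shiftFun A (a + b) ≅ shiftFun A a ⋙ shiftFun A b :=
  NatIso.ofComponents (fun M => isoMk
    ((shiftFunctorAdd (CochainComplex (ModuleCat.{u} k) ℤ) a b).app M.X) (by
      intro p m h x
      obtain rfl : m = p := by omega
      refine Cochain.ext _ _ fun i j hij => ?_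
      simp only [Cochain.comp_zero_cochain_v, Cochain.zero_cochain_comp_v, Cochain.ofHom_v,
        zero_mul, Int.negOnePow_zero, one_smul, CochainComplex.shiftFunctorAdd_hom_app_f,
        Iso.app_hom]
      change (((a + b) * m).negOnePow • ((M.act m x).shift (a + b))).v i j hij ≫ _ =
        _ ≫ ((b * m).negOnePow • ((a * m).negOnePow • (M.act m x).shift a).shift b).v i j hij
      rw [Cochain.shift_units_smul, smul_smul, ← Int.negOnePow_add, ← add_mul, add_comm b a,
        Cochain.units_smul_v, Cochain.units_smul_v]
      have key := cochain_v_comp_XIsoOfEq (M.act m x) (i + (a + b)) (i + b + a) (j + (a + b))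
        (j + b + a) (by omega) (by omega) (by omega) (by omega)
      exact (Linear.units_smul_comp _ _ _).trans ((congrArg _ key).trans
        (Linear.comp_units_smul _ _ _).symm)))
    (fun f => hom_ext ((shiftFunctorAdd _ a b).hom.naturality f.hom))

instance : HasShift (DGModule A) ℤ := hasShiftMk _ _
  { F := shiftFun A
    zero := shiftFunZero A
    add := shiftFunAdd A
    assoc_hom_app := fun a b c M => by
      apply (forget A).map_injective
      simp only [Functor.map_comp, eqToHom_map]
      have := shiftFunctorAdd_assoc_hom_app a b c M.X
      simp [shiftFunctorAdd'] at this
      exact this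
    zero_add_hom_app := fun n M => by
      apply (forget A).map_injective
      simp only [Functor.map_comp, eqToHom_map]
      exact shiftFunctorAdd_zero_add_hom_app n M.X
    add_zero_hom_app := fun n M => by
      apply (forget A).map_injective
      simp only [Functor.map_comp, eqToHom_map]
      exact shiftFunctorAdd_add_zero_hom_app n M.X }

end Shift

end DGModule

namespace DGModule

variable {k : Type u} [Field k] {A : DGAlgebra k}

instance : (forget A).CommShift ℤ where
  commShiftIso n := NatIso.ofComponents (fun M => Iso.refl (M.X⟦n⟧))
    (fun f => (Category.comp_id _).trans (Category.id_comp (f.hom⟦n⟧')).symm)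
  commShiftIso_zero := by
    ext1
    ext1
    ext1 M
    rw [Functor.CommShift.isoZero_hom_app]
    exact ((shiftFunctorZero (CochainComplex (ModuleCat.{u} k) ℤ) ℤ).hom_inv_id_app M.X).symm
  commShiftIso_add a b := by
    ext1
    ext1
    ext1 M
    rw [Functor.CommShift.isoAdd_hom_app]
    simp
    exact ((shiftFunctorAdd (CochainComplex (ModuleCat.{u} k) ℤ) a b).hom_inv_id_app M.X).symm

instance (n : ℤ) : (shiftFunctor (DGModule A) n).Additive where
  map_add {_ _ f g} := hom_ext
    ((shiftFunctor (CochainComplex (ModuleCat.{u} k) ℤ) n).map_add (f := f.hom) (g := g.hom))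

section Cone

open CochainComplex.mappingCone

variable {M N : DGModule A} (f : M ⟶ N)

/-- The action on the mapping cone `N ⊕ M⟦1⟧` of a morphism `f : M ⟶ N`. -/
def coneAct (p : ℤ) (a : A.X.X p) :
    Cochain (CochainComplex.mappingCone f.hom) (CochainComplex.mappingCone f.hom) p :=
  descCochain f.hom (p.negOnePow • (M.act p a).comp (inl f.hom) (sub_eq_add_neg p 1).symm)
    ((N.act p a).comp (Cochain.ofHom (inr f.hom)) (add_zero p)) (sub_add_cancel p 1)

lemma inl_coneAct (p : ℤ) (a : A.X.X p) (q : ℤ) (hq : -1 + p = q) :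
    (inl f.hom).comp (coneAct f p a) hq =
      p.negOnePow • (M.act p a).comp (inl f.hom) ((add_comm p (-1)).trans hq) := by
  obtain rfl : q = p - 1 := by omega
  exact inl_descCochain _ _ _ _

lemma inr_coneAct (p : ℤ) (a : A.X.X p) :
    (Cochain.ofHom (inr f.hom)).comp (coneAct f p a) (zero_add p) =
      (N.act p a).comp (Cochain.ofHom (inr f.hom)) (add_zero p) :=
  inr_descCochain _ _ _ _

/-- The mapping cone of a morphism of differential graded modules. -/
@[simps]
abbrev cone : DGModule A where
  X := CochainComplex.mappingCone f.hom
  act p :=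
    { toFun := coneAct f p
      map_add' := fun a b => by
        rw [ext_cochain_from_iff f.hom (p - 1) p (by omega)]
        simp [inl_coneAct, inr_coneAct, Cochain.comp_add, Cochain.add_comp]
      map_smul' := fun c a => by
        rw [ext_cochain_from_iff f.hom (p - 1) p (by omega)]
        simp only [inl_coneAct, inr_coneAct, Cochain.comp_smul, Cochain.smul_comp, map_smul,
          RingHom.id_apply, and_true]
        exact (smul_comm c _ _).symm }
  act_one := by
    rw [ext_cochain_from_iff f.hom (-1) 0 (by omega)]
    simp [inl_coneAct, inr_coneAct, act_one]
  act_mul {p q n} h a b := by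
    rw [ext_cochain_from_iff f.hom (n - 1) n (by omega)]
    simp only [LinearMap.coe_mk, AddHom.coe_mk]
    constructor
    · rw [inl_coneAct, M.act_mul h,
        ← Cochain.comp_assoc (inl f.hom) (coneAct f q b) (coneAct f p a) rfl (by omega) (by omega),
        inl_coneAct, Cochain.units_smul_comp,
        Cochain.comp_assoc (M.act q b) (inl f.hom) (coneAct f p a) (by omega) rfl (by omega),
        inl_coneAct, Cochain.comp_units_smul, smul_smul, ← Int.negOnePow_add,
        Cochain.comp_assoc (M.act q b) (M.act p a) (inl f.hom) (by omega)
          (add_comm p (-1)) (by omega)]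
      congr 2
      omega
    · rw [inr_coneAct, N.act_mul h, ← Cochain.comp_assoc_of_first_is_zero_cochain, inr_coneAct,
        Cochain.comp_assoc_of_second_is_zero_cochain, inr_coneAct,
        Cochain.comp_assoc_of_third_is_zero_cochain]
  leibniz {p} a := by
    have hf := f.linear p p (add_zero p) a
    rw [zero_mul, Int.negOnePow_zero, one_smul] at hf
    change δ p (p + 1) (coneAct f p a) = coneAct f (p + 1) (A.X.d p (p + 1) a)
    rw [show δ p (p + 1) (coneAct f p a) = _ from δ_descCochain _ _ _ _ (p + 1) rfl,
      ext_cochain_from_iff f.hom p (p + 1) rfl]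
    constructor
    · rw [inl_coneAct, Cochain.comp_add, inl_fst_assoc, inl_snd_assoc, add_zero, δ_units_smul]
      rw [δ_comp (M.act p a) (inl f.hom) (sub_eq_add_neg p 1).symm (p + 1) 0 p (by omega) rfl
        (by omega), δ_inl, M.leibniz, Cochain.ofHom_comp,
        ← Cochain.comp_assoc_of_first_is_zero_cochain, ← hf,
        Cochain.comp_assoc_of_second_is_zero_cochain]
      simp [Int.negOnePow_succ, Int.negOnePow_neg]
    · rw [inr_coneAct, Cochain.comp_add, inr_fst_assoc, inr_snd_assoc, zero_add,
        δ_comp_zero_cochain _ _ _ rfl, N.leibniz, δ_ofHom]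
      simp

lemma inl_linear : IsLinear M (cone f) (inl f.hom) := by
  intro p m h a
  change _ = _ • (inl f.hom).comp (coneAct f p a) _
  rw [inl_coneAct, smul_smul, ← Int.negOnePow_add]
  simp

/-- The inclusion `N ⟶ cone f`. -/
abbrev coneInr : N ⟶ cone f where
  hom := inr f.hom
  linear := by
    intro p m h a
    obtain rfl : m = p := by omega
    change _ = _ • (Cochain.ofHom (inr f.hom)).comp (coneAct f m a) _
    rw [inr_coneAct]
    simp

lemma fst_linear : IsLinear (cone f) M (fst f.hom).1 := by
  intro p m h a
  obtain rfl := h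
  change (coneAct f p a).comp _ _ = _
  rw [ext_cochain_from_iff f.hom p (p + 1) rfl]
  constructor
  · rw [← Cochain.comp_assoc (inl f.hom) (coneAct f p a) (fst f.hom).1 rfl (by omega) (by omega),
      inl_coneAct, Cochain.units_smul_comp, Cochain.comp_units_smul, inl_fst_assoc,
      Cochain.comp_assoc (M.act p a) (inl f.hom) (fst f.hom).1 (n₁₂ := -1 + p) (by omega)
        (neg_add_cancel 1) (by omega), inl_fst]
    simp
  · rw [← Cochain.comp_assoc_of_first_is_zero_cochain, inr_coneAct,
      Cochain.comp_units_smul, inr_fst_assoc, Cochain.comp_assoc_of_second_is_zero_cochain]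
    simp

lemma snd_linear : IsLinear (cone f) N (snd f.hom) := by
  intro p m h a
  obtain rfl : m = p := by omega
  change (coneAct f m a).comp _ _ = _
  rw [ext_cochain_from_iff f.hom (m - 1) m (by omega)]
  constructor
  · rw [← Cochain.comp_assoc_of_third_is_zero_cochain, inl_coneAct, Cochain.units_smul_comp,
      Cochain.comp_units_smul, inl_snd_assoc, Cochain.comp_assoc_of_third_is_zero_cochain]
    simp
  · rw [← Cochain.comp_assoc_of_first_is_zero_cochain, inr_coneAct,
      Cochain.comp_units_smul, inr_snd_assoc, Cochain.comp_assoc_of_second_is_zero_cochain]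
    simp

variable {f} in
lemma IsLinear.descCochain {P : DGModule A} {m n : ℤ} {α : Cochain M.X P.X m}
    {β : Cochain N.X P.X n} (hα : IsLinear M P α) (hβ : IsLinear N P β) (h : m + 1 = n) :
    IsLinear (cone f) P (CochainComplex.mappingCone.descCochain f.hom α β h) :=
  ((fst_linear f).comp hα _).add ((snd_linear f).comp hβ _)

variable {f} in
lemma IsLinear.liftCochain {P : DGModule A} {m n : ℤ} {α : Cochain P.X M.X m}
    {β : Cochain P.X N.X n} (hα : IsLinear P M α) (hβ : IsLinear P N β) (h : n + 1 = m) :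
    IsLinear P (cone f) (CochainComplex.mappingCone.liftCochain f.hom α β h) :=
  (hα.comp (inl_linear f) _).add (hβ.comp (coneInr f).linear _)

end Cone

end DGModule

namespace DGModule

variable {k : Type u} [Field k] {A : DGAlgebra k}

section ShiftLinear

lemma smul_aux₁ {C : Type*} [Category C] [Preadditive C] {X Y Z V W : C} (α : X ⟶ Y) (ζ : Y ⟶ Z)
    (ζ' : X ⟶ W) (β : W ⟶ Z) (e : V ≅ W) (s t r : ℤˣ) (h : α ≫ ζ = s • ζ' ≫ β) (hs : s = r * t) :
    α ≫ ζ ≫ 𝟙 Z = r • (ζ' ≫ e.inv) ≫ (t • e.hom ≫ β ≫ 𝟙 Z) := by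
  simp [h, hs, smul_smul]

lemma smul_aux₂ {C : Type*} [Category C] [Preadditive C] {X Y Z W : C} (α : X ⟶ Y) (ζ : Y ⟶ Z)
    (ζ' : X ⟶ W) (β : W ⟶ Z) (s t r c : ℤˣ) (h : α ≫ ζ = s • ζ' ≫ β) (hs : t * s = r) :
    (t • α) ≫ (c • 𝟙 Y ≫ ζ) = r • (c • 𝟙 X ≫ ζ') ≫ β := by
  simp only [Linear.units_smul_comp, Linear.comp_units_smul, Category.id_comp, h, ← hs, smul_smul]
  congr 1
  rw [mul_comm, mul_assoc]

variable {M N : DGModule A}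

lemma IsLinear.rightShift {n : ℤ} {z : Cochain M.X N.X n} (hz : IsLinear M N z) (a n' : ℤ)
    (hn' : n' + a = n) : IsLinear M (N.shiftObj a) (z.rightShift a n' hn') := by
  intro p m h x
  rw [shiftObj_act]
  refine Cochain.ext _ _ fun i j hij => ?_
  have e := Cochain.congr_v (hz p (p + n) rfl x) i (j + a) (by omega)
  rw [Cochain.comp_v _ _ rfl i (i + p) (j + a) rfl (by omega), Cochain.units_smul_v,
    Cochain.comp_v _ _ (add_comm n p) i (i + n) (j + a) rfl (by omega)] at e
  rw [Cochain.comp_v _ _ h i (i + p) j rfl (by omega),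
    Cochain.rightShift_v z a n' hn' (i + p) j (by omega) (j + a) (by omega)]
  rw [Cochain.units_smul_v, Cochain.comp_v _ _ ((add_comm n' p).trans h) i (i + n') j rfl
    (by omega), Cochain.rightShift_v z a n' hn' i (i + n') rfl (i + n) (by omega),
    Cochain.units_smul_v,
    Cochain.shift_v _ a (i + n') j (by omega) (i + n) (j + a) (by omega) rfl]
  refine smul_aux₁ _ _ _ _ _ _ _ _ e ?_
  rw [← Int.negOnePow_add, ← hn']
  ring_nf

lemma IsLinear.leftShift {n : ℤ} {z : Cochain M.X N.X n} (hz : IsLinear M N z) (a n' : ℤ)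
    (hn' : n + a = n') : IsLinear (M.shiftObj a) N (z.leftShift a n' hn') := by
  intro p m h x
  rw [shiftObj_act]
  refine Cochain.ext _ _ fun i j hij => ?_
  have e := Cochain.congr_v (hz p (p + n) rfl x) (i + a) j (by omega)
  rw [Cochain.comp_v _ _ rfl (i + a) (i + p + a) j (by omega) (by omega), Cochain.units_smul_v,
    Cochain.comp_v _ _ (add_comm n p) (i + a) (i + n') j (by omega) (by omega)] at e
  rw [Cochain.comp_v _ _ h i (i + p) j rfl (by omega), Cochain.units_smul_v, Cochain.units_smul_v,
    Cochain.comp_v _ _ ((add_comm n' p).trans h) i (i + n') j rfl (by omega),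
    Cochain.shift_v', Cochain.leftShift_v z a n' hn' (i + p) j (by omega) (i + p + a) (by omega),
    Cochain.leftShift_v z a n' hn' i (i + n') rfl (i + a) (by omega)]
  refine smul_aux₂ _ _ _ _ _ _ _ _ e ?_
  rw [← Int.negOnePow_add, ← hn']
  ring_nf

end ShiftLinear

section Homotopy

variable (A) in
/-- Two morphisms of differential graded modules are homotopic if their difference is
`d ∘ z + z ∘ d` for some `A`-linear map `z` of degree `-1`. -/
def homotopic : HomRel (DGModule A) := fun M N f g =>
  ∃ z : Cochain M.X N.X (-1), IsLinear M N z ∧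
    Cochain.ofHom f.hom = δ (-1) 0 z + Cochain.ofHom g.hom

instance : Congruence (homotopic A) where
  equivalence :=
    { refl := fun f => ⟨0, .zero _, by simp⟩
      symm := by
        rintro f g ⟨z, hz, h⟩
        exact ⟨-z, hz.neg, by rw [h, δ_neg]; abel⟩
      trans := by
        rintro f g h ⟨z, hz, e⟩ ⟨z', hz', e'⟩
        exact ⟨z + z', hz.add hz', by rw [e, e', δ_add]; abel⟩ }
  comp_left := by
    rintro M N P f g g' ⟨z, hz, h⟩
    refine ⟨(Cochain.ofHom f.hom).comp z (zero_add _), f.linear.comp hz _, ?_⟩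
    rw [comp_hom, comp_hom, Cochain.ofHom_comp, Cochain.ofHom_comp, h, Cochain.comp_add,
      δ_ofHom_comp]
  comp_right := by
    rintro M N P f f' g ⟨z, hz, h⟩
    refine ⟨z.comp (Cochain.ofHom g.hom) (add_zero _), hz.comp g.linear _, ?_⟩
    rw [comp_hom, comp_hom, Cochain.ofHom_comp, Cochain.ofHom_comp, h, Cochain.add_comp,
      δ_comp_ofHom]

lemma homotopic_add {M N : DGModule A} {f g f' g' : M ⟶ N} (h : homotopic A f g)
    (h' : homotopic A f' g') : homotopic A (f + f') (g + g') := by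
  obtain ⟨z, hz, h⟩ := h
  obtain ⟨z', hz', h'⟩ := h'
  exact ⟨z + z', hz.add hz', by
    rw [add_hom, add_hom, Cochain.ofHom_add, Cochain.ofHom_add, h, h', δ_add]; abel⟩

instance : (homotopic A).IsCompatibleWithShift ℤ where
  condition := by
    rintro n M N f g ⟨z, hz, h⟩
    refine ⟨n.negOnePow • z.shift n, (hz.shift n).units_smul _, ?_⟩
    rw [δ_units_smul, Cochain.δ_shift, smul_smul, Int.units_mul_self, one_smul]
    have e := congr_arg (fun y => Cochain.shift y n) h
    simp only [Cochain.shift_add, cochain_shift_ofHom] at e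
    exact e

variable (A) in
/-- The homotopy category of differential graded `A`-modules. -/
abbrev HtpyCat := Quotient (homotopic A)

variable (A) in
/-- The quotient functor from differential graded modules to their homotopy category. -/
abbrev htpyQuotient : DGModule A ⥤ HtpyCat A := Quotient.functor (homotopic A)

instance : Preadditive (HtpyCat A) :=
  Quotient.preadditive _ (fun _ _ _ _ _ _ h h' => homotopic_add h h')

instance : (htpyQuotient A).Additive where

instance (n : ℤ) : (shiftFunctor (HtpyCat A) n).Additive := by
  have : (htpyQuotient A ⋙ shiftFunctor (HtpyCat A) n).Additive :=
    Functor.additive_of_iso ((htpyQuotient A).commShiftIso n)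
  exact Functor.additive_of_full_essSurj_comp (htpyQuotient A) _

lemma htpy_map_eq {M N : DGModule A} {f g : M ⟶ N} (h : homotopic A f g) :
    (htpyQuotient A).map f = (htpyQuotient A).map g :=
  CategoryTheory.Quotient.sound _ h

lemma homotopic_of_map_eq {M N : DGModule A} {f g : M ⟶ N}
    (h : (htpyQuotient A).map f = (htpyQuotient A).map g) : homotopic A f g :=
  (Quotient.functor_map_eq_iff _ _ _).1 h

/-- The isomorphism in the homotopy category given by a homotopy equivalence. -/
@[simps]
def htpyIso {M N : DGModule A} (f : M ⟶ N) (g : N ⟶ M) (h : homotopic A (f ≫ g) (𝟙 M))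
    (h' : homotopic A (g ≫ f) (𝟙 N)) : (htpyQuotient A).obj M ≅ (htpyQuotient A).obj N where
  hom := (htpyQuotient A).map f
  inv := (htpyQuotient A).map g
  hom_inv_id := by rw [← Functor.map_comp, htpy_map_eq h, CategoryTheory.Functor.map_id]
  inv_hom_id := by rw [← Functor.map_comp, htpy_map_eq h', CategoryTheory.Functor.map_id]

lemma homotopic_of_homotopy {M N : DGModule A} {f g : M ⟶ N} (H : Homotopy f.hom g.hom)
    (hH : IsLinear M N (Cochain.equivHomotopy _ _ H).1) : homotopic A f g :=
  ⟨_, hH, (Cochain.equivHomotopy _ _ H).2⟩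

variable (A) in
/-- The zero differential graded module. -/
abbrev zeroObj : DGModule A where
  X := (HasZeroObject.zero' (CochainComplex (ModuleCat.{u} k) ℤ)).zero
  act p := 0
  act_one := (Cochain.ofHom_zero _ _).symm.trans (congrArg Cochain.ofHom
    ((isZero_zero (CochainComplex (ModuleCat.{u} k) ℤ)).eq_of_src 0 _))
  act_mul h a b := by simp
  leibniz a := by simp

lemma isZero_zeroObj : IsZero (zeroObj A) := by
  rw [IsZero.iff_id_eq_zero]
  exact hom_ext ((isZero_zero (CochainComplex (ModuleCat.{u} k) ℤ)).eq_of_src _ _)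

instance : HasZeroObject (DGModule A) := ⟨⟨_, isZero_zeroObj⟩⟩

instance : HasZeroObject (HtpyCat A) :=
  ⟨⟨_, (htpyQuotient A).map_isZero (isZero_zeroObj (A := A))⟩⟩

end Homotopy

end DGModule

namespace DGModule

variable {k : Type u} [Field k] {A : DGAlgebra k}

section Triangles

open CochainComplex.mappingCone

variable {M N : DGModule A} (f : M ⟶ N)

lemma triangle_mor₃_linear : IsLinear (cone f) (M.shiftObj 1)
    (Cochain.ofHom (CochainComplex.mappingCone.triangle f.hom).mor₃) := by
  have h := (fst_linear f).neg.rightShift 1 0 (zero_add 1)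
  have e := Cocycle.cochain_ofHom_homOf_eq_coe ((-fst f.hom).rightShift 1 0 (zero_add 1))
  exact (congrArg (IsLinear (cone f) (M.shiftObj 1)) e).mpr h

/-- The standard triangle `M ⟶ N ⟶ cone f ⟶ M⟦1⟧` attached to a morphism `f : M ⟶ N` of
differential graded modules. -/
abbrev coneTriangle : Triangle (DGModule A) :=
  Triangle.mk f (coneInr f) (⟨(CochainComplex.mappingCone.triangle f.hom).mor₃,
    triangle_mor₃_linear f⟩ : cone f ⟶ M⟦(1 : ℤ)⟧)

/-- The image of the standard triangle in the homotopy category. -/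
abbrev coneTriangleh : Triangle (HtpyCat A) :=
  (htpyQuotient A).mapTriangle.obj (coneTriangle f)

variable (A) in
/-- The triangles which are isomorphic to the image of a standard triangle. -/
def distinguishedTriangles : Set (Triangle (HtpyCat A)) :=
  {T | ∃ (M N : DGModule A) (f : M ⟶ N), Nonempty (T ≅ coneTriangleh f)}

lemma isomorphic_distinguished (T₁ : Triangle (HtpyCat A))
    (hT₁ : T₁ ∈ distinguishedTriangles A) (T₂ : Triangle (HtpyCat A))
    (e : T₂ ≅ T₁) : T₂ ∈ distinguishedTriangles A := by
  obtain ⟨X, Y, f, ⟨e'⟩⟩ := hT₁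
  exact ⟨X, Y, f, ⟨e ≪≫ e'⟩⟩

lemma isZero_cone_id (M : DGModule A) : IsZero ((htpyQuotient A).obj (cone (𝟙 M))) := by
  rw [IsZero.iff_id_eq_zero, ← CategoryTheory.Functor.map_id,
    ← (htpyQuotient A).map_zero (cone (𝟙 M)) (cone (𝟙 M))]
  apply htpy_map_eq
  refine homotopic_of_homotopy (homotopyToZeroOfId M.X) ?_
  have e : (Cochain.equivHomotopy _ _ (homotopyToZeroOfId M.X)).1 =
      descCochain (𝟙 M.X) (0 : Cochain _ _ (-2)) (inl (𝟙 M.X)) (by rfl) :=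
    congrArg Subtype.val (Equiv.apply_symm_apply _ _)
  exact (congrArg (IsLinear (cone (𝟙 M)) (cone (𝟙 M))) e).mpr
    ((IsLinear.zero (M := M) _).descCochain (f := 𝟙 M) (inl_linear (𝟙 M)) _)

lemma contractible_distinguished (X : HtpyCat A) :
    Pretriangulated.contractibleTriangle X ∈ distinguishedTriangles A := by
  obtain ⟨X⟩ := X
  refine ⟨_, _, 𝟙 X, ⟨?_⟩⟩
  have h := isZero_cone_id X
  exact Triangle.isoMk _ _ (Iso.refl _) (Iso.refl _) h.isoZero.symm
    (by
      change 𝟙 _ ≫ 𝟙 _ = 𝟙 _ ≫ (htpyQuotient A).map (𝟙 X)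
      rw [CategoryTheory.Functor.map_id]) (h.eq_of_tgt _ _)
    ((isZero_zero _).eq_of_src _ _)

lemma distinguished_cocone_triangle {X Y : HtpyCat A} (f : X ⟶ Y) :
    ∃ (Z : HtpyCat A) (g : Y ⟶ Z) (h : Z ⟶ X⟦(1 : ℤ)⟧),
      Triangle.mk f g h ∈ distinguishedTriangles A := by
  obtain ⟨f, rfl⟩ := (htpyQuotient A).map_surjective f
  exact ⟨_, _, _, ⟨_, _, f, ⟨Iso.refl _⟩⟩⟩

lemma shift_hom (f : M ⟶ N) (n : ℤ) : Hom.hom (f⟦n⟧') = f.hom⟦n⟧' := rfl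

lemma desc_linear {P : DGModule A} (α : Cochain M.X P.X (-1)) (β : N.X ⟶ P.X)
    (eq : δ (-1) 0 α = Cochain.ofHom (f.hom ≫ β)) (hα : IsLinear M P α)
    (hβ : IsLinear N P (Cochain.ofHom β)) :
    IsLinear (cone f) P (Cochain.ofHom (desc f.hom α β eq)) := by
  rw [ofHom_desc]
  exact hα.descCochain hβ _

lemma lift_linear {P : DGModule A} (α : Cocycle P.X M.X 1) (β : Cochain P.X N.X 0)
    (eq : δ 0 1 β + α.1.comp (Cochain.ofHom f.hom) (add_zero 1) = 0) (hα : IsLinear P M α.1)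
    (hβ : IsLinear P N β) :
    IsLinear P (cone f) (Cochain.ofHom (lift f.hom α β eq)) := by
  rw [ofHom_lift]
  exact hα.liftCochain hβ _

section MapOfHomotopy

variable {M₁ N₁ M₂ N₂ : DGModule A} {φ₁ : M₁ ⟶ N₁} {φ₂ : M₂ ⟶ N₂} {a : M₁ ⟶ M₂} {b : N₁ ⟶ N₂}

lemma mapOfHomotopy_linear (H : Homotopy (φ₁.hom ≫ b.hom) (a.hom ≫ φ₂.hom))
    (hH : IsLinear M₁ N₂ (Cochain.equivHomotopy _ _ H).1) :
    IsLinear (cone φ₁) (cone φ₂) (Cochain.ofHom (mapOfHomotopy H)) := by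
  refine desc_linear φ₁ _ _ _ ?_ ?_
  · exact (a.linear.comp (inl_linear φ₂) _).add (hH.comp (coneInr φ₂).linear _)
  · exact (b ≫ coneInr φ₂).linear

lemma complete_aux (h : homotopic A (φ₁ ≫ b) (a ≫ φ₂)) :
    ∃ c : cone φ₁ ⟶ cone φ₂, coneInr φ₁ ≫ c = b ≫ coneInr φ₂ ∧
      c ≫ (coneTriangle φ₂).mor₃ = (coneTriangle φ₁).mor₃ ≫ a⟦(1 : ℤ)⟧' := by
  obtain ⟨z, hz, e⟩ := h
  let H : Homotopy (φ₁.hom ≫ b.hom) (a.hom ≫ φ₂.hom) :=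
    (Cochain.equivHomotopy _ _).symm ⟨z, e⟩
  have hH : (Cochain.equivHomotopy _ _ H).1 = z :=
    congrArg Subtype.val (Equiv.apply_symm_apply _ _)
  refine ⟨⟨mapOfHomotopy H, mapOfHomotopy_linear H (by rw [hH]; exact hz)⟩,
    hom_ext (triangleMapOfHomotopy_comm₂ H), hom_ext (triangleMapOfHomotopy_comm₃ H)⟩

lemma triangleh_mor₃ (f : M ⟶ N) : (coneTriangleh f).mor₃ =
    (htpyQuotient A).map (coneTriangle f).mor₃ ≫
      ((htpyQuotient A).commShiftIso (1 : ℤ)).hom.app M := rfl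

lemma comp_aux {C : Type*} [Category C] {X Y Z X' Y' Z' : C} {u : X ⟶ Y} {s : Y ⟶ Z}
    {u' : X' ⟶ Y'} {s' : Y' ⟶ Z'} {c : X ⟶ X'} {a : Y ⟶ Y'} {a' : Z ⟶ Z'}
    (h : c ≫ u' = u ≫ a) (h' : a ≫ s' = s ≫ a') : (u ≫ s) ≫ a' = c ≫ u' ≫ s' := by
  rw [Category.assoc, ← h', ← Category.assoc, ← h, Category.assoc]

lemma complete_aux' (φ₁ : M₁ ⟶ N₁) (φ₂ : M₂ ⟶ N₂)
    (x : (coneTriangleh φ₁).obj₁ ⟶ (coneTriangleh φ₂).obj₁)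
    (y : (coneTriangleh φ₁).obj₂ ⟶ (coneTriangleh φ₂).obj₂)
    (h : (coneTriangleh φ₁).mor₁ ≫ y = x ≫ (coneTriangleh φ₂).mor₁) :
    ∃ c : (coneTriangleh φ₁).obj₃ ⟶ (coneTriangleh φ₂).obj₃,
      (coneTriangleh φ₁).mor₂ ≫ c = y ≫ (coneTriangleh φ₂).mor₂ ∧
      (coneTriangleh φ₁).mor₃ ≫ x⟦(1 : ℤ)⟧' = c ≫ (coneTriangleh φ₂).mor₃ := by
  obtain ⟨a, rfl⟩ := (htpyQuotient A).map_surjective (X := M₁) (Y := M₂) x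
  obtain ⟨b, rfl⟩ := (htpyQuotient A).map_surjective (X := N₁) (Y := N₂) y
  have h' : (htpyQuotient A).map (φ₁ ≫ b) = (htpyQuotient A).map (a ≫ φ₂) :=
    ((htpyQuotient A).map_comp _ _).trans (h.trans ((htpyQuotient A).map_comp _ _).symm)
  obtain ⟨c, h₂, h₃⟩ := complete_aux (homotopic_of_map_eq h')
  refine ⟨(htpyQuotient A).map c, ?_, ?_⟩
  · exact ((htpyQuotient A).map_comp _ _).symm.trans ((congrArg _ h₂).trans
      ((htpyQuotient A).map_comp _ _))
  · exact comp_aux (((htpyQuotient A).map_comp _ _).symm.trans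
      ((congrArg (htpyQuotient A).map h₃).trans ((htpyQuotient A).map_comp _ _)))
      (((htpyQuotient A).commShiftIso (1 : ℤ)).hom.naturality a)

lemma complete_of_iso {C : Type*} [Category C] [HasShift C ℤ] {T₁ T₂ T₁' T₂' : Triangle C}
    (e₁ : T₁ ≅ T₁') (e₂ : T₂ ≅ T₂')
    (H : ∀ (a : T₁'.obj₁ ⟶ T₂'.obj₁) (b : T₁'.obj₂ ⟶ T₂'.obj₂) (_ : T₁'.mor₁ ≫ b = a ≫ T₂'.mor₁),
      ∃ (c : T₁'.obj₃ ⟶ T₂'.obj₃), T₁'.mor₂ ≫ c = b ≫ T₂'.mor₂ ∧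
        T₁'.mor₃ ≫ a⟦(1 : ℤ)⟧' = c ≫ T₂'.mor₃)
    (a : T₁.obj₁ ⟶ T₂.obj₁) (b : T₁.obj₂ ⟶ T₂.obj₂) (fac : T₁.mor₁ ≫ b = a ≫ T₂.mor₁) :
    ∃ (c : T₁.obj₃ ⟶ T₂.obj₃), T₁.mor₂ ≫ c = b ≫ T₂.mor₂ ∧
      T₁.mor₃ ≫ a⟦(1 : ℤ)⟧' = c ≫ T₂.mor₃ := by
  obtain ⟨c, h₂, h₃⟩ := H (e₁.inv.hom₁ ≫ a ≫ e₂.hom.hom₁) (e₁.inv.hom₂ ≫ b ≫ e₂.hom.hom₂) (by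
      have comm₁₁ := e₁.inv.comm₁
      have comm₁₂ := e₂.hom.comm₁
      rw [reassoc_of% comm₁₁, reassoc_of% fac, comm₁₂]
      simp only [Category.assoc])
  refine ⟨e₁.hom.hom₃ ≫ c ≫ e₂.inv.hom₃, ?_, ?_⟩
  · rw [e₁.hom.comm₂_assoc, reassoc_of% h₂, e₂.inv.comm₂]
    simp
  · have h4 := e₁.hom.comm₃
    have h5 := e₂.inv.comm₃
    rw [Category.assoc, Category.assoc, ← h5, ← reassoc_of% h₃, ← reassoc_of% h4,
      ← Functor.map_comp, ← Functor.map_comp]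
    simp

lemma complete_distinguished_triangle_morphism (T₁ T₂ : Triangle (HtpyCat A))
    (hT₁ : T₁ ∈ distinguishedTriangles A) (hT₂ : T₂ ∈ distinguishedTriangles A)
    (a : T₁.obj₁ ⟶ T₂.obj₁) (b : T₁.obj₂ ⟶ T₂.obj₂) (fac : T₁.mor₁ ≫ b = a ≫ T₂.mor₁) :
    ∃ (c : T₁.obj₃ ⟶ T₂.obj₃), T₁.mor₂ ≫ c = b ≫ T₂.mor₂ ∧
      T₁.mor₃ ≫ a⟦(1 : ℤ)⟧' = c ≫ T₂.mor₃ := by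
  obtain ⟨M₁, N₁, φ₁, ⟨e₁⟩⟩ := hT₁
  obtain ⟨M₂, N₂, φ₂, ⟨e₂⟩⟩ := hT₂
  exact complete_of_iso e₁ e₂ (complete_aux' φ₁ φ₂) a b fac

end MapOfHomotopy

section Rotate

lemma rotate_hom_linear :
    IsLinear (M.shiftObj 1) (cone (coneInr f)) (Cochain.ofHom (rotateHomotopyEquiv f.hom).hom) := by
  refine lift_linear (coneInr f) _ _ _ ?_ ?_
  · exact (f.linear.leftShift 1 1 (zero_add 1)).neg
  · exact ((inl_linear f).leftShift 1 0 (neg_add_cancel 1)).neg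

lemma rotate_inv_linear :
    IsLinear (cone (coneInr f)) (M.shiftObj 1)
      (Cochain.ofHom (rotateHomotopyEquiv f.hom).inv) := by
  have h : δ (-1) 0 (0 : Cochain N.X (M.shiftObj 1).X (-1)) = Cochain.ofHom ((coneInr f).hom ≫
      (CochainComplex.mappingCone.triangle f.hom).mor₃) := by
    rw [δ_zero]
    exact (Cochain.ofHom_zero _ _).symm.trans (congrArg Cochain.ofHom (inr_triangleδ f.hom).symm)
  exact desc_linear (P := M.shiftObj 1) (coneInr f) 0 _ h (.zero _) (triangle_mor₃_linear f)

/-- The isomorphism between `M⟦1⟧` and the cone of `N ⟶ cone f` in the homotopy category. -/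
def rotateIso : (htpyQuotient A).obj (M⟦(1 : ℤ)⟧) ≅ (htpyQuotient A).obj (cone (coneInr f)) :=
  htpyIso (M := M⟦(1 : ℤ)⟧) ⟨(rotateHomotopyEquiv f.hom).hom, rotate_hom_linear f⟩
    ⟨(rotateHomotopyEquiv f.hom).inv, rotate_inv_linear f⟩
    (homotopic_of_homotopy (rotateHomotopyEquiv f.hom).homotopyHomInvId (by
      exact (IsLinear.zero (M := M.shiftObj 1) (N := M.shiftObj 1) (-1))))
    (homotopic_of_homotopy (rotateHomotopyEquiv f.hom).homotopyInvHomId (by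
      have e : (Cochain.equivHomotopy _ _ (rotateHomotopyEquiv f.hom).homotopyInvHomId).1 =
        _ := congrArg Subtype.val (Equiv.apply_symm_apply _ _)
      exact (congrArg (IsLinear (cone (coneInr f)) (cone (coneInr f))) e).mpr
        (((snd_linear (coneInr f)).comp ((snd_linear f).comp (inl_linear (coneInr f)) _) _).neg)))

lemma rotate_aux₂ {C : Type*} [Category C] {X Y Z W : C} {u : X ⟶ Y} (s : Y ≅ Z) {r : Y ⟶ W}
    {v : X ⟶ W} (h : u ≫ r = v) : (u ≫ s.hom) ≫ (s.inv ≫ r) = 𝟙 X ≫ v := by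
  simp [h]

lemma rotate_aux₃ {C : Type*} [Category C] [Preadditive C] {X X' Y Y' Z : C} {m : X' ⟶ Y'}
    {i : Y' ⟶ Y'} {s : X ≅ X'} {r : X ⟶ Z} {v : Z ⟶ Y} {s' : Y ⟶ Y'} {w : X ⟶ Y} (hi : i = 𝟙 _)
    (h : r ≫ v = -w) (h' : w ≫ s' = s.hom ≫ m) : (-m) ≫ i = (s.inv ≫ r) ≫ v ≫ s' := by
  rw [Category.assoc, reassoc_of% h, hi, Preadditive.neg_comp w s', h']
  simp

lemma rotateIso_comm₂ : (htpyQuotient A).map (coneTriangle f).mor₃ ≫ (rotateIso f).hom =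
    (htpyQuotient A).map (coneInr (coneInr f)) := by
  refine ((htpyQuotient A).map_comp _ _).symm.trans (htpy_map_eq (homotopic_of_homotopy
    (rotateHomotopyEquivComm₂Homotopy f.hom) ?_))
  have e : (Cochain.equivHomotopy _ _ (rotateHomotopyEquivComm₂Homotopy f.hom)).1 =
    _ := congrArg Subtype.val (Equiv.apply_symm_apply _ _)
  exact (congrArg (IsLinear (cone f) (cone (coneInr f))) e).mpr
    (((snd_linear f).comp (inl_linear (coneInr f)) _).neg)

lemma rotateIso_comm₃ : (rotateIso f).hom ≫ (htpyQuotient A).map (coneTriangle (coneInr f)).mor₃ =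
    -(htpyQuotient A).map (f⟦(1 : ℤ)⟧') := by
  refine ((htpyQuotient A).map_comp _ _).symm.trans (Eq.trans ?_ ((htpyQuotient A).map_neg))
  exact congrArg (htpyQuotient A).map (hom_ext (rotateHomotopyEquiv_comm₃ f.hom))

/-- The rotation of a standard triangle is isomorphic to a standard triangle. -/
def rotateTrianglehIso : (coneTriangleh f).rotate ≅ coneTriangleh (coneInr f) :=
  Triangle.isoMk _ _ (Iso.refl _) (Iso.refl _)
    (((htpyQuotient A).commShiftIso (1 : ℤ)).symm.app M ≪≫ rotateIso f)
    ((Category.comp_id _).trans (Category.id_comp _).symm)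
    (rotate_aux₂ (((htpyQuotient A).commShiftIso (1 : ℤ)).app M) (rotateIso_comm₂ f))
    (rotate_aux₃ (s := ((htpyQuotient A).commShiftIso (1 : ℤ)).app M)
      ((shiftFunctor (HtpyCat A) (1 : ℤ)).map_id _) (rotateIso_comm₃ f)
      (((htpyQuotient A).commShiftIso (1 : ℤ)).hom.naturality f))

end Rotate

section Shift

lemma shiftIso_linear (n : ℤ) : IsLinear ((cone f).shiftObj n) (cone (f⟦n⟧'))
    (Cochain.ofHom (CochainComplex.mappingCone.shiftIso f.hom n).hom) := by
  refine lift_linear (f⟦n⟧') _ _ _ ?_ ?_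
  · exact ((fst_linear f).shift n).units_smul _
  · exact (snd_linear f).shift n

/-- The shift of the mapping cone. -/
def coneShiftIso (n : ℤ) : (cone f)⟦n⟧ ≅ cone (f⟦n⟧') :=
  isoMk (CochainComplex.mappingCone.shiftIso f.hom n) (shiftIso_linear f n)

lemma units_smul_hom (u : ℤˣ) (g : M ⟶ N) : (u • g).hom = u • g.hom := by
  obtain rfl | rfl := Int.units_eq_one_or u
  · rw [one_smul, one_smul]
  · rw [Units.neg_smul, Units.neg_smul, one_smul, one_smul, neg_hom]

lemma shiftFunctorComm_hom (M : DGModule A) (a b : ℤ) :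
    Hom.hom ((shiftFunctorComm (DGModule A) a b).hom.app M) =
      (shiftFunctorComm (CochainComplex (ModuleCat.{u} k) ℤ) a b).hom.app M.X := by
  have h := (forget A).map_shiftFunctorComm M a b
  refine h.trans ?_
  refine (Category.id_comp _).trans ?_
  have e : ((shiftFunctor (CochainComplex (ModuleCat.{u} k) ℤ) b).map
    (((forget A).commShiftIso a).hom.app M)) = 𝟙 _ :=
      (shiftFunctor (CochainComplex (ModuleCat.{u} k) ℤ) b).map_id _
  have e' : ((shiftFunctor (CochainComplex (ModuleCat.{u} k) ℤ) a).map
    (((forget A).commShiftIso b).inv.app M)) = 𝟙 _ :=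
      (shiftFunctor (CochainComplex (ModuleCat.{u} k) ℤ) a).map_id _
  refine (congrArg (fun t => t ≫ _) e).trans ((Category.id_comp _).trans ?_)
  refine (congrArg (fun t => _ ≫ t ≫ _) e').trans ?_
  exact (congrArg (fun t => _ ≫ t) (Category.id_comp _)).trans (Category.comp_id _)

lemma units_smul_comp_units_smul {C : Type*} [Category C] [Preadditive C] {X Y : C} (c : ℤˣ)
    (h : X ⟶ Y) : (c • h) ≫ (c • 𝟙 Y) = 𝟙 X ≫ h := by
  simp [smul_smul]

lemma coneShift_comm₂ (n : ℤ) :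
    (n.negOnePow • (coneInr f)⟦n⟧') ≫ (coneShiftIso f n).hom =
      (n.negOnePow • 𝟙 (N⟦n⟧)) ≫ coneInr (f⟦n⟧') := by
  refine hom_ext ?_
  rw [comp_hom, comp_hom, units_smul_hom, units_smul_hom]
  exact (CochainComplex.mappingCone.shiftTriangleIso f.hom n).hom.comm₂

/-- The last morphism of the standard triangle. -/
abbrev coneδ : cone f ⟶ M⟦(1 : ℤ)⟧ := (coneTriangle f).mor₃

/-- The canonical isomorphism `M⟦1⟧⟦n⟧ ⟶ M⟦n⟧⟦1⟧`. -/
abbrev shiftComm (M : DGModule A) (n : ℤ) : M⟦(1 : ℤ)⟧⟦n⟧ ⟶ M⟦n⟧⟦(1 : ℤ)⟧ :=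
  (shiftFunctorComm (DGModule A) 1 n).hom.app M

lemma coneShift_comm₃ (n : ℤ) :
    (n.negOnePow • ((coneδ f)⟦n⟧' ≫ shiftComm M n)) ≫
      (𝟙 (M⟦n⟧))⟦(1 : ℤ)⟧' = (coneShiftIso f n).hom ≫ coneδ (f⟦n⟧') := by
  refine hom_ext ?_
  rw [comp_hom, comp_hom, units_smul_hom, comp_hom, shiftFunctorComm_hom]
  exact (CochainComplex.mappingCone.shiftTriangleIso f.hom n).hom.comm₃

/-- The shift of a standard triangle is isomorphic to a standard triangle. -/
def coneTriangleShiftIso (n : ℤ) :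
    (Triangle.shiftFunctor _ n).obj (coneTriangle f) ≅ coneTriangle (f⟦n⟧') :=
  Triangle.isoMk ((Triangle.shiftFunctor _ n).obj (coneTriangle f)) (coneTriangle (f⟦n⟧'))
    (Iso.refl (M⟦n⟧)) (n.negOnePow • Iso.refl (N⟦n⟧)) (coneShiftIso f n)
    (units_smul_comp_units_smul n.negOnePow (f⟦n⟧')) (coneShift_comm₂ f n) (coneShift_comm₃ f n)

/-- The shift of a standard triangle is isomorphic to a standard triangle. -/
def shiftTrianglehIso (n : ℤ) :
    (Triangle.shiftFunctor _ n).obj (coneTriangleh f) ≅ coneTriangleh (f⟦n⟧') :=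
  ((htpyQuotient A).mapTriangle.commShiftIso n).symm.app _ ≪≫
    (htpyQuotient A).mapTriangle.mapIso (coneTriangleShiftIso f n)

end Shift

lemma rotate_distinguished_triangle' (T : Triangle (HtpyCat A))
    (hT : T ∈ distinguishedTriangles A) : T.rotate ∈ distinguishedTriangles A := by
  obtain ⟨K, L, φ, ⟨e⟩⟩ := hT
  exact ⟨_, _, _, ⟨(rotate _).mapIso e ≪≫ rotateTrianglehIso φ⟩⟩

lemma shift_distinguished_triangle (T : Triangle (HtpyCat A))
    (hT : T ∈ distinguishedTriangles A) (n : ℤ) :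
      (Triangle.shiftFunctor _ n).obj T ∈ distinguishedTriangles A := by
  obtain ⟨K, L, φ, ⟨e⟩⟩ := hT
  exact ⟨_, _, _, ⟨Functor.mapIso _ e ≪≫ shiftTrianglehIso φ n⟩⟩

lemma invRotate_distinguished_triangle' (T : Triangle (HtpyCat A))
    (hT : T ∈ distinguishedTriangles A) : T.invRotate ∈ distinguishedTriangles A :=
  isomorphic_distinguished _
    (shift_distinguished_triangle _ (rotate_distinguished_triangle' _
      (rotate_distinguished_triangle' _ hT)) _) _
    ((invRotateIsoRotateRotateShiftFunctorNegOne _).app T)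

lemma rotate_distinguished_triangle (T : Triangle (HtpyCat A)) :
    T ∈ distinguishedTriangles A ↔ T.rotate ∈ distinguishedTriangles A := by
  constructor
  · exact rotate_distinguished_triangle' T
  · intro hT
    exact isomorphic_distinguished _ (invRotate_distinguished_triangle' T.rotate hT) _
      ((triangleRotation _).unitIso.app T)

instance : Pretriangulated (HtpyCat A) where
  distinguishedTriangles := distinguishedTriangles A
  isomorphic_distinguished := isomorphic_distinguished
  contractible_distinguished := contractible_distinguished
  distinguished_cocone_triangle := distinguished_cocone_triangle
  rotate_distinguished_triangle := rotate_distinguished_triangle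
  complete_distinguished_triangle_morphism := complete_distinguished_triangle_morphism

end Triangles

end DGModule

namespace DGModule

variable {k : Type u} [Field k] {A : DGAlgebra k}

section Octahedron

open CochainComplex.mappingCone
open CochainComplex (mappingConeCompTriangle mappingConeCompHomotopyEquiv)

variable {M₁ N₁ M₂ N₂ : DGModule A}

/-- The morphism between mapping cones induced by a commutative square. -/
abbrev coneMap (φ₁ : M₁ ⟶ N₁) (φ₂ : M₂ ⟶ N₂) (a : M₁ ⟶ M₂) (b : N₁ ⟶ N₂)
    (comm : φ₁ ≫ b = a ≫ φ₂) : cone φ₁ ⟶ cone φ₂ where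
  hom := CochainComplex.mappingCone.map φ₁.hom φ₂.hom a.hom b.hom (congrArg Hom.hom comm)
  linear := desc_linear φ₁ _ _ _ (a.linear.comp (inl_linear φ₂) _) (b ≫ coneInr φ₂).linear

variable {X₁ X₂ X₃ : DGModule A} (f : X₁ ⟶ X₂) (g : X₂ ⟶ X₃)

/-- The morphism `cone f ⟶ cone (f ≫ g)`. -/
abbrev coneCompα : cone f ⟶ cone (f ≫ g) := coneMap f (f ≫ g) (𝟙 X₁) g (by rw [Category.id_comp])

/-- The morphism `cone (f ≫ g) ⟶ cone g`. -/
abbrev coneCompβ : cone (f ≫ g) ⟶ cone g := coneMap (f ≫ g) g f (𝟙 X₃) (by rw [Category.comp_id])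

lemma coneComp_hom_linear : IsLinear (cone g) (cone (coneCompα f g))
    (Cochain.ofHom (mappingConeCompHomotopyEquiv f.hom g.hom).hom) := by
  refine lift_linear (coneCompα f g) _ _ _ ?_ ?_
  · exact (coneInr f).linear.descCochain (.zero _) (zero_add 1)
  · exact (IsLinear.zero (M := X₂) (N := cone (f ≫ g)) _).descCochain (coneInr (f ≫ g)).linear _

lemma coneComp_inv_linear : IsLinear (cone (coneCompα f g)) (cone g)
    (Cochain.ofHom (mappingConeCompHomotopyEquiv f.hom g.hom).inv) := by
  have e : Cochain.ofHom (mappingConeCompHomotopyEquiv f.hom g.hom).inv =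
      descCochain (mappingConeCompTriangle f.hom g.hom).mor₁
        ((snd f.hom).comp (inl g.hom) (zero_add (-1))) (Cochain.ofHom (desc (f.hom ≫ g.hom)
          ((Cochain.ofHom f.hom).comp (inl g.hom) (zero_add (-1))) (inr g.hom) (by simp)))
        (neg_add_cancel 1) := by
    change Cochain.ofHom (CochainComplex.MappingConeCompHomotopyEquiv.inv f.hom g.hom) = _
    unfold CochainComplex.MappingConeCompHomotopyEquiv.inv
    erw [ofHom_desc]
  refine (congrArg (IsLinear (cone (coneCompα f g)) (cone g)) e).mpr
    (IsLinear.descCochain (f := coneCompα f g) ?_ ?_ (neg_add_cancel 1))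
  · exact (snd_linear f).comp (inl_linear g) _
  · exact desc_linear (f ≫ g) _ _ _ (f.linear.comp (inl_linear g) _) (coneInr g).linear

/-- The morphism `cone g ⟶ cone (cone f ⟶ cone (f ≫ g))`. -/
abbrev coneCompHom : cone g ⟶ cone (coneCompα f g) :=
  ⟨(mappingConeCompHomotopyEquiv f.hom g.hom).hom, coneComp_hom_linear f g⟩

/-- The morphism `cone (cone f ⟶ cone (f ≫ g)) ⟶ cone g`. -/
abbrev coneCompInv : cone (coneCompα f g) ⟶ cone g :=
  ⟨(mappingConeCompHomotopyEquiv f.hom g.hom).inv, coneComp_inv_linear f g⟩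

/-- The isomorphism in the homotopy category between `cone g` and the cone of the
morphism `cone f ⟶ cone (f ≫ g)`. -/
def coneCompIso : (htpyQuotient A).obj (cone g) ≅ (htpyQuotient A).obj (cone (coneCompα f g)) :=
  htpyIso (coneCompHom f g) (coneCompInv f g)
    (homotopic_of_homotopy (mappingConeCompHomotopyEquiv f.hom g.hom).homotopyHomInvId
      (IsLinear.zero (M := cone g) (N := cone g) (-1)))
    (homotopic_of_homotopy (mappingConeCompHomotopyEquiv f.hom g.hom).homotopyInvHomId (by
      have e : (Cochain.equivHomotopy _ _
        (mappingConeCompHomotopyEquiv f.hom g.hom).homotopyInvHomId).1 =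
          _ := congrArg Subtype.val (Equiv.apply_symm_apply _ _)
      exact (congrArg (IsLinear (cone (coneCompα f g)) (cone (coneCompα f g))) e).mpr
        ((snd_linear (coneCompα f g)).comp ((fst_linear (f ≫ g)).comp ((inl_linear f).comp
          (inl_linear (coneCompα f g)) _) _) _).neg))

lemma coneComp_comm₁ : coneInr (coneCompα f g) ≫ coneCompInv f g = coneCompβ f g :=
  hom_ext (CochainComplex.mappingConeCompHomotopyEquiv_comm₁ f.hom g.hom)

lemma coneComp_comm₂ :
    coneCompHom f g ≫ coneδ (coneCompα f g) = coneδ g ≫ (coneInr f)⟦(1 : ℤ)⟧' :=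
  hom_ext (CochainComplex.mappingConeCompHomotopyEquiv_comm₂ f.hom g.hom)

/-- The triangle `cone f ⟶ cone (f ≫ g) ⟶ cone g ⟶ (cone f)⟦1⟧`. -/
abbrev coneCompTriangle : Triangle (DGModule A) :=
  Triangle.mk (coneCompα f g) (coneCompβ f g) (coneδ g ≫ (coneInr f)⟦(1 : ℤ)⟧')

lemma coneCompTriangleh_distinguished :
    (htpyQuotient A).mapTriangle.obj (coneCompTriangle f g) ∈ distTriang (HtpyCat A) := by
  refine ⟨_, _, coneCompα f g, ⟨?_⟩⟩
  refine Triangle.isoMk _ _ (Iso.refl _) (Iso.refl _) (coneCompIso f g) ?_ ?_ ?_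
  · exact (Category.comp_id _).trans (Category.id_comp _).symm
  · refine Eq.trans ?_ (Category.id_comp _).symm
    exact (Iso.eq_comp_inv (coneCompIso f g)).1 (((congrArg _ (coneComp_comm₁ f g)).symm).trans
      ((htpyQuotient A).map_comp _ _))
  · refine (congrArg (fun t => _ ≫ t) ((shiftFunctor (HtpyCat A) (1 : ℤ)).map_id _)).trans
      ((Category.comp_id _).trans ?_)
    exact (congrArg (fun t => t ≫ _) ((congrArg (htpyQuotient A).map (coneComp_comm₂ f g).symm).trans
      ((htpyQuotient A).map_comp _ _))).trans (Category.assoc _ _ _)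

lemma coneMap_comm₂ (φ₁ : M₁ ⟶ N₁) (φ₂ : M₂ ⟶ N₂) (a : M₁ ⟶ M₂) (b : N₁ ⟶ N₂)
    (comm : φ₁ ≫ b = a ≫ φ₂) : coneInr φ₁ ≫ coneMap φ₁ φ₂ a b comm = b ≫ coneInr φ₂ :=
  hom_ext (triangleMap φ₁.hom φ₂.hom a.hom b.hom (congrArg Hom.hom comm)).comm₂

lemma coneMap_comm₃ (φ₁ : M₁ ⟶ N₁) (φ₂ : M₂ ⟶ N₂) (a : M₁ ⟶ M₂) (b : N₁ ⟶ N₂)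
    (comm : φ₁ ≫ b = a ≫ φ₂) : coneδ φ₁ ≫ a⟦(1 : ℤ)⟧' = coneMap φ₁ φ₂ a b comm ≫ coneδ φ₂ :=
  hom_ext (triangleMap φ₁.hom φ₂.hom a.hom b.hom (congrArg Hom.hom comm)).comm₃

/-- The morphism between standard triangles induced by a commutative square. -/
abbrev coneTriangleMap (φ₁ : M₁ ⟶ N₁) (φ₂ : M₂ ⟶ N₂) (a : M₁ ⟶ M₂) (b : N₁ ⟶ N₂)
    (comm : φ₁ ≫ b = a ≫ φ₂) : coneTriangle φ₁ ⟶ coneTriangle φ₂ where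
  hom₁ := a
  hom₂ := b
  hom₃ := coneMap φ₁ φ₂ a b comm
  comm₁ := comm
  comm₂ := coneMap_comm₂ φ₁ φ₂ a b comm
  comm₃ := coneMap_comm₃ φ₁ φ₂ a b comm

lemma coneTriangleh_distinguished (φ : M₁ ⟶ N₁) : coneTriangleh φ ∈ distTriang (HtpyCat A) :=
  ⟨_, _, φ, ⟨Iso.refl _⟩⟩

lemma comp_id_aux {C : Type*} [Category C] {X Y : C} (u : X ⟶ Y) {i : Y ⟶ Y} (h : i = 𝟙 Y) :
    u ≫ i = u := by
  rw [h, Category.comp_id]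

lemma id_comp_aux {C : Type*} [Category C] {X Y : C} (u : X ⟶ Y) {i : X ⟶ X} (h : i = 𝟙 X) :
    i ≫ u = u := by
  rw [h, Category.id_comp]

lemma comp_aux' {C : Type*} [Category C] {X Y Z Y' Z' : C} {u : X ⟶ Y} {v : Y ⟶ Z}
    {w : X ⟶ Z} {s : Y ⟶ Y'} {s' : Z ⟶ Z'} {v' : Y' ⟶ Z'} (h : w = u ≫ v)
    (h' : v ≫ s' = s ≫ v') : (u ≫ s) ≫ v' = w ≫ s' := by
  rw [h, Category.assoc, Category.assoc, h']

instance : IsTriangulated (HtpyCat A) :=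
  IsTriangulated.mk' (by
    rintro ⟨X₁⟩ ⟨X₂⟩ ⟨X₃⟩ u₁₂' u₂₃'
    obtain ⟨f, rfl⟩ := (htpyQuotient A).map_surjective (X := X₁) (Y := X₂) u₁₂'
    obtain ⟨g, rfl⟩ := (htpyQuotient A).map_surjective (X := X₂) (Y := X₃) u₂₃'
    refine ⟨_, _, _, _, _, _, _, _, Iso.refl _, Iso.refl _, Iso.refl _,
        (Category.comp_id _).trans (Category.id_comp _).symm,
        (Category.comp_id _).trans (Category.id_comp _).symm,
        _, _, coneTriangleh_distinguished f, _, _, coneTriangleh_distinguished g,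
        _, _, coneTriangleh_distinguished (f ≫ g), ⟨?_⟩⟩
    let α := coneTriangleMap f (f ≫ g) (𝟙 X₁) g (by rw [Category.id_comp])
    let β := coneTriangleMap (f ≫ g) g f (𝟙 X₃) (by rw [Category.comp_id])
    refine Triangulated.Octahedron.mk ((htpyQuotient A).map α.hom₃)
      ((htpyQuotient A).map β.hom₃) ?_ ?_ ?_ ?_ ?_
    · exact ((htpyQuotient A).mapTriangle.map α).comm₂
    · refine ((htpyQuotient A).mapTriangle.map α).comm₃.symm.trans ?_
      exact comp_id_aux _ (((shiftFunctor (HtpyCat A) (1 : ℤ)).congr_map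
        ((htpyQuotient A).map_id X₁)).trans ((shiftFunctor (HtpyCat A) (1 : ℤ)).map_id _))
    · refine ((htpyQuotient A).mapTriangle.map β).comm₂.trans ?_
      exact id_comp_aux _ ((htpyQuotient A).map_id X₃)
    · exact ((htpyQuotient A).mapTriangle.map β).comm₃
    · refine isomorphic_distinguished _ (coneCompTriangleh_distinguished f g) _ ?_
      exact Triangle.isoMk _ _ (Iso.refl _) (Iso.refl _) (Iso.refl _)
        ((Category.comp_id _).trans (Category.id_comp _).symm)
        ((Category.comp_id _).trans (Category.id_comp _).symm)
        ((comp_id_aux _ ((shiftFunctor (HtpyCat A) (1 : ℤ)).map_id _)).trans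
          ((comp_aux' ((htpyQuotient A).map_comp _ _)
            (((htpyQuotient A).commShiftIso (1 : ℤ)).hom.naturality (coneInr f))).trans
              (Category.id_comp _).symm)))

end Octahedron

end DGModule

namespace DGModule

variable {k : Type u} [Field k] (A : DGAlgebra k)

/-- The functor which sends a differential graded module to the underlying complex,
considered as an object of the homotopy category of complexes. -/
abbrev forgetH : DGModule A ⥤ HomotopyCategory (ModuleCat.{u} k) (ComplexShape.up ℤ) :=
  forget A ⋙ HomotopyCategory.quotient _ _

variable {A} in
lemma forgetH_map_eq {M N : DGModule A} {f g : M ⟶ N} (h : homotopic A f g) :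
    (forgetH A).map f = (forgetH A).map g := by
  obtain ⟨z, _, e⟩ := h
  exact HomotopyCategory.eq_of_homotopy _ _ ((Cochain.equivHomotopy _ _).symm ⟨z, e⟩)

/-- The functor from the homotopy category of differential graded modules to the
homotopy category of complexes of vector spaces which forgets the action. -/
abbrev htpyForget : HtpyCat A ⥤ HomotopyCategory (ModuleCat.{u} k) (ComplexShape.up ℤ) :=
  CategoryTheory.Quotient.lift (homotopic A) (forgetH A) (fun _ _ _ _ h => forgetH_map_eq h)

instance : (htpyForget A).Additive := by
  have : (htpyQuotient A ⋙ htpyForget A).Additive := Functor.additive_of_iso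
    (CategoryTheory.Quotient.lift.isLift (homotopic A) (forgetH A)
      (fun _ _ _ _ h => forgetH_map_eq h)).symm
  exact Functor.additive_of_full_essSurj_comp (htpyQuotient A) (htpyForget A)

variable {A} in
/-- The image of a standard triangle is a standard triangle. -/
def htpyForgetTriangleIso {M N : DGModule A} (f : M ⟶ N) :
    (htpyForget A).mapTriangle.obj (coneTriangleh f) ≅
      CochainComplex.mappingCone.triangleh f.hom :=
  (Functor.mapTriangleCompIso (htpyQuotient A) (htpyForget A)).symm.app (coneTriangle f) ≪≫
    (Functor.mapTriangleIso (CategoryTheory.Quotient.lift.isLift (homotopic A) (forgetH A) _)).app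
      (coneTriangle f) ≪≫
    (Functor.mapTriangleCompIso (forget A) (HomotopyCategory.quotient _ _)).app (coneTriangle f) ≪≫
    (HomotopyCategory.quotient _ _).mapTriangle.mapIso
      (Triangle.isoMk ((forget A).mapTriangle.obj (coneTriangle f))
        (CochainComplex.mappingCone.triangle f.hom) (Iso.refl _) (Iso.refl _) (Iso.refl _)
        ((Category.comp_id _).trans (Category.id_comp _).symm)
        ((Category.comp_id _).trans (Category.id_comp _).symm)
        ((comp_id_aux _ ((shiftFunctor (CochainComplex (ModuleCat.{u} k) ℤ) (1 : ℤ)).map_id _)).trans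
          ((Category.comp_id _).trans (Category.id_comp _).symm)))

instance : (htpyForget A).IsTriangulated where
  map_distinguished := by
    rintro T ⟨M, N, f, ⟨e⟩⟩
    exact ⟨_, _, _, ⟨(htpyForget A).mapTriangle.mapIso e ≪≫ htpyForgetTriangleIso f⟩⟩

/-- The morphisms in the homotopy category of differential graded modules which induce
isomorphisms in cohomology. -/
def quasiIso : MorphismProperty (HtpyCat A) :=
  (HomotopyCategory.quasiIso (ModuleCat.{u} k) (ComplexShape.up ℤ)).inverseImage (htpyForget A)

lemma quasiIso_eq : quasiIso A =
    ((HomotopyCategory.subcategoryAcyclic (ModuleCat.{u} k)).inverseImage (htpyForget A)).trW := by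
  ext M N f
  rw [ObjectProperty.inverseImage_trW_iff, quasiIso,
    HomotopyCategory.quasiIso_eq_trW_subcategoryAcyclic]
  rfl

instance : (quasiIso A).HasLeftCalculusOfFractions := by
  rw [quasiIso_eq]; infer_instance

instance : (quasiIso A).HasRightCalculusOfFractions := by
  rw [quasiIso_eq]; infer_instance

instance : (quasiIso A).IsCompatibleWithTriangulation := by
  rw [quasiIso_eq]; infer_instance

instance : (quasiIso A).IsStableUnderFiniteProducts := by
  rw [quasiIso_eq]; infer_instance

/-- The derived category of a differential graded algebra: the localization of the homotopy
category of differential graded modules with respect to quasi-isomorphisms. -/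
abbrev DerCat := (quasiIso A).Localization

/-- The localization functor. -/
abbrev derQ : HtpyCat A ⥤ DerCat A := (quasiIso A).Q

end DGModule

section BGG

variable (k : Type u) [Field k] (r : ℕ)

/-- The graded components of the polynomial ring `S = k[x₁, …, x_r]`, with `|x_i| = 1`. -/
abbrev polyDeg (n : ℤ) : Submodule k (MvPolynomial (Fin r) k) :=
  MvPolynomial.weightedHomogeneousSubmodule k (fun _ => (1 : ℤ)) n

variable {k r} in
/-- Multiplication `S^p × S^q ⟶ S^n` for `p + q = n`. -/
def polyMul {p q n : ℤ} (h : p + q = n) : polyDeg k r p →ₗ[k] polyDeg k r q →ₗ[k] polyDeg k r n :=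
  LinearMap.mk₂ k (fun a b => ⟨a.1 * b.1, h ▸ MvPolynomial.IsWeightedHomogeneous.mul a.2 b.2⟩)
    (fun _ _ _ => Subtype.ext (add_mul _ _ _)) (fun _ _ _ => Subtype.ext (smul_mul_assoc _ _ _))
    (fun _ _ _ => Subtype.ext (mul_add _ _ _)) (fun _ _ _ => Subtype.ext (mul_smul_comm _ _ _))

variable {k r} in
@[simp]
lemma polyMul_coe {p q n : ℤ} (h : p + q = n) (a : polyDeg k r p) (b : polyDeg k r q) :
    (polyMul h a b).1 = a.1 * b.1 := rfl

/-- The element `1 ∈ S^0`. -/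
def polyOne : polyDeg k r 0 := ⟨1, MvPolynomial.isWeightedHomogeneous_one _ _⟩

/-- The variable `x_i ∈ S^1`. -/
def polyVar (i : Fin r) : polyDeg k r 1 :=
  ⟨MvPolynomial.X i, MvPolynomial.isWeightedHomogeneous_X _ _ i⟩

/-- The polynomial ring `S = k[x₁, …, x_r]`, with `|x_i| = 1`, as a differential graded algebra
with zero differential. -/
abbrev polyDG : DGAlgebra k where
  X :=
    { X := fun n => ModuleCat.of k (polyDeg k r n)
      d := fun _ _ => 0 }
  one := polyOne k r
  mul h := polyMul h
  one_mul a := Subtype.ext (one_mul a.1)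
  mul_one a := Subtype.ext (mul_one a.1)
  mul_assoc _ _ _ _ a b c := Subtype.ext (mul_assoc a.1 b.1 c.1)
  leibniz h a b := by simp

variable {k r} {Λ : Type u} [CommRing Λ] [Algebra k Λ] (z : Fin r → Λ)

/-- The map `Λ ⊗ S^n ⟶ Λ ⊗ S^m`, for `n + p = m`, given by multiplication by `1 ⊗ s`,
where `s ∈ S^p`. -/
def mulPoly {p n m : ℤ} (h : n + p = m) (s : polyDeg k r p) :
    Λ ⊗[k] polyDeg k r n →ₗ[Λ] Λ ⊗[k] polyDeg k r m :=
  (polyMul ((add_comm p n).trans h) s).baseChange Λ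

@[simp]
lemma mulPoly_tmul {p n m : ℤ} (h : n + p = m) (s : polyDeg k r p) (a : Λ) (t : polyDeg k r n) :
    mulPoly h s (a ⊗ₜ[k] t) = a ⊗ₜ polyMul ((add_comm p n).trans h) s t := rfl

/-- The map `Λ ⊗ S^n ⟶ Λ ⊗ S^m`, for `n + 1 = m`, given by multiplication by
`δ = ∑ z_i ⊗ x_i`. -/
def mulδ {n m : ℤ} (h : n + 1 = m) : Λ ⊗[k] polyDeg k r n →ₗ[Λ] Λ ⊗[k] polyDeg k r m :=
  ∑ i, z i • mulPoly h (polyVar k r i)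

lemma mulδ_tmul {n m : ℤ} (h : n + 1 = m) (a : Λ) (t : polyDeg k r n) :
    mulδ z h (a ⊗ₜ[k] t) =
      ∑ i, (z i * a) ⊗ₜ[k] polyMul ((add_comm 1 n).trans h) (polyVar k r i) t := by
  simp [mulδ, LinearMap.sum_apply, TensorProduct.smul_tmul']

lemma mulPoly_mulPoly {p q n m l : ℤ} (h : n + p = m) (h' : m + q = l) (s : polyDeg k r p)
    (t : polyDeg k r q) {pq : ℤ} (hpq : p + q = pq) (hl : n + pq = l) :
    mulPoly (Λ := Λ) h' t ∘ₗ mulPoly h s = mulPoly hl (polyMul hpq s t) := by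
  unfold mulPoly
  rw [← LinearMap.baseChange_comp]
  congr 1
  refine LinearMap.ext fun x => Subtype.ext ?_
  simp only [LinearMap.comp_apply, polyMul_coe]
  ring

lemma lin_sum_comp {ι M N P : Type*} [AddCommGroup M] [AddCommGroup N] [AddCommGroup P]
    [Module Λ M] [Module Λ N] [Module Λ P] (t : Finset ι) (f : ι → N →ₗ[Λ] P) (g : M →ₗ[Λ] N) :
    (∑ i ∈ t, f i) ∘ₗ g = ∑ i ∈ t, f i ∘ₗ g := by
  ext x
  simp [LinearMap.sum_apply]

lemma lin_comp_sum {ι M N P : Type*} [AddCommGroup M] [AddCommGroup N] [AddCommGroup P]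
    [Module Λ M] [Module Λ N] [Module Λ P] (t : Finset ι) (f : ι → M →ₗ[Λ] N) (g : N →ₗ[Λ] P) :
    g ∘ₗ (∑ i ∈ t, f i) = ∑ i ∈ t, g ∘ₗ f i := by
  ext x
  simp [LinearMap.sum_apply]

lemma mulδ_mulδ [CharP k 2] (hz : ∀ i, z i * z i = 0) {n m l : ℤ} (h : n + 1 = m) (h' : m + 1 = l) :
    mulδ z h' ∘ₗ mulδ (k := k) z h = 0 := by
  have hl : n + 2 = l := by omega
  have e : ∀ i j, (z j • mulPoly h' (polyVar k r j)) ∘ₗ (z i • mulPoly h (polyVar k r i)) =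
      (z j * z i) • mulPoly (Λ := Λ) hl (polyMul (by norm_num) (polyVar k r i) (polyVar k r j)) := by
    intro i j
    rw [LinearMap.smul_comp, LinearMap.comp_smul, smul_smul,
      mulPoly_mulPoly h h' _ _ (by norm_num) hl]
  have h2 : (2 : Λ) = 0 := by
    rw [← map_ofNat (algebraMap k Λ) 2, show (OfNat.ofNat 2 : k) = 0 from CharTwo.two_eq_zero,
      map_zero]
  unfold mulδ
  simp only [lin_sum_comp, lin_comp_sum, e]
  rw [← Finset.sum_product']
  refine Finset.sum_involution (fun p _ => p.swap) ?_ ?_ (by simp) (by simp)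
  · rintro ⟨i, j⟩ _
    have hs : polyMul (n := 2) (by norm_num) (polyVar k r j) (polyVar k r i) =
        polyMul (by norm_num) (polyVar k r i) (polyVar k r j) := Subtype.ext (mul_comm _ _)
    simp only [Prod.swap, hs, mul_comm (z j) (z i)]
    rw [← two_smul Λ, h2, zero_smul]
  · rintro ⟨i, j⟩ _ hne heq
    obtain rfl : j = i := congrArg Prod.fst heq
    exact hne (by simp [hz])

lemma mulδ_mulPoly {p n m n' m' : ℤ} (h : n + p = m) (hn : n + 1 = n') (hm : m + 1 = m')
    (h' : n' + p = m') (s : polyDeg k r p) :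
    mulδ z hm ∘ₗ mulPoly h s = mulPoly h' s ∘ₗ mulδ z hn := by
  unfold mulδ
  rw [lin_sum_comp, lin_comp_sum]
  refine Finset.sum_congr rfl fun i _ => ?_
  rw [LinearMap.smul_comp, LinearMap.comp_smul, mulPoly_mulPoly h hm _ _ rfl (by omega),
    mulPoly_mulPoly hn h' _ _ (add_comm 1 p) (by omega)]
  congr 2
  exact Subtype.ext (mul_comm _ _)

/-- The complex `J = Λ ⊗ S` of `Λ`-modules, with `J^n = Λ ⊗ S^n` and differential given by
multiplication by `δ = ∑ z_i ⊗ x_i`. -/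
abbrev bggJ [CharP k 2] (hz : ∀ i, z i * z i = 0) : CochainComplex (ModuleCat.{u} Λ) ℤ where
  X n := ModuleCat.of Λ (Λ ⊗[k] polyDeg k r n)
  d n m := if h : n + 1 = m then ModuleCat.ofHom (mulδ z h) else 0
  shape n m h := dif_neg h
  d_comp_d' n m l h h' := by
    have h : n + 1 = m := h
    have h' : m + 1 = l := h'
    rw [dif_pos h, dif_pos h', ← ModuleCat.ofHom_comp, mulδ_mulδ z hz h h']
    rfl

section Zeta

variable [CharP k 2] (hz : ∀ i, z i * z i = 0)

/-- For `s ∈ S^p`, the map `J ⟶ J` of degree `p` given by multiplication by `1 ⊗ s`. -/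
def zetaFun {p : ℤ} (s : polyDeg k r p) : Cochain (bggJ (k := k) z hz) (bggJ (k := k) z hz) p :=
  Cochain.mk fun _ _ h => ModuleCat.ofHom (mulPoly h s)

@[simp]
lemma zetaFun_v {p n m : ℤ} (s : polyDeg k r p) (h : n + p = m) :
    (zetaFun z hz s).v n m h = ModuleCat.ofHom (mulPoly h s) := rfl

lemma zetaFun_mul {p q n : ℤ} (h : p + q = n) (s : polyDeg k r p) (t : polyDeg k r q) :
    zetaFun z hz (polyMul h s t) = (zetaFun z hz t).comp (zetaFun z hz s) ((add_comm q p).trans h) := by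
  refine Cochain.ext _ _ fun i j hij => ?_
  rw [Cochain.comp_v _ _ ((add_comm q p).trans h) i (i + q) j rfl (by omega), zetaFun_v, zetaFun_v,
    zetaFun_v, ← ModuleCat.ofHom_comp,
    mulPoly_mulPoly _ _ _ _ ((add_comm q p).trans h) hij]
  congr 2
  exact Subtype.ext (mul_comm _ _)

lemma zetaFun_one : zetaFun z hz (polyOne k r) = Cochain.ofHom (𝟙 _) := by
  refine Cochain.ext₀ _ _ fun i => ?_
  rw [zetaFun_v, Cochain.ofHom_v]
  refine ModuleCat.hom_ext ?_
  have e : polyMul ((add_comm 0 i).trans (add_zero i)) (polyOne k r) = LinearMap.id :=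
    LinearMap.ext fun x => Subtype.ext (one_mul _)
  exact (congrArg (LinearMap.baseChange Λ) e).trans LinearMap.baseChange_id

lemma add_self_hom {C : Type*} [Category C] [Preadditive C] [Linear k C] {X Y : C} (f : X ⟶ Y) :
    f + f = 0 := by
  rw [← two_smul k, CharTwo.two_eq_zero, zero_smul]

lemma units_smul_hom' {C : Type*} [Category C] [Preadditive C] [Linear k C] {X Y : C} (c : ℤˣ)
    (f : X ⟶ Y) : c • f = f := by
  obtain rfl | rfl := Int.units_eq_one_or c
  · rw [one_smul]
  · rw [Units.neg_smul, one_smul, neg_eq_iff_add_eq_zero, add_self_hom (k := k)]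

lemma units_smul_cochain {C : Type*} [Category C] [Preadditive C] [Linear k C]
    {F G : CochainComplex C ℤ} {n : ℤ} (c : ℤˣ) (f : Cochain F G n) : c • f = f := by
  refine Cochain.ext _ _ fun i j hij => ?_
  rw [Cochain.units_smul_v, units_smul_hom' (k := k)]

lemma δ_zetaFun {p : ℤ} (s : polyDeg k r p) : δ p (p + 1) (zetaFun z hz s) = 0 := by
  refine Cochain.ext _ _ fun i j hij => ?_
  have hj : i + p + 1 = j := by omega
  rw [δ_v p (p + 1) rfl _ i j hij (i + p) (i + 1) (by omega) rfl, units_smul_hom' (k := k),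
    zetaFun_v, zetaFun_v]
  have h1 : (bggJ (k := k) z hz).d (i + p) j = ModuleCat.ofHom (mulδ z hj) := dif_pos hj
  have h2 : (bggJ (k := k) z hz).d i (i + 1) = ModuleCat.ofHom (mulδ z rfl) := dif_pos rfl
  rw [h1, h2, ← ModuleCat.ofHom_comp, ← ModuleCat.ofHom_comp,
    mulδ_mulPoly z rfl rfl hj (by omega) s, add_self_hom (k := k)]
  rfl

/-- The map `S^p ⟶ Hom(J, J)^p` given by multiplication. -/
def zetaLin (p : ℤ) : polyDeg k r p →ₗ[k] Cochain (bggJ (k := k) z hz) (bggJ (k := k) z hz) p where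
  toFun s := zetaFun z hz s
  map_add' s t := by
    refine Cochain.ext _ _ fun i j hij => ?_
    rw [Cochain.add_v, zetaFun_v, zetaFun_v, zetaFun_v, ← ModuleCat.ofHom_add]
    congr 1
    unfold mulPoly
    rw [map_add, LinearMap.baseChange_add]
  map_smul' c s := by
    refine Cochain.ext _ _ fun i j hij => ?_
    rw [RingHom.id_apply, Cochain.smul_v, zetaFun_v, zetaFun_v]
    refine ModuleCat.hom_ext (LinearMap.ext fun x => ?_)
    have e : mulPoly (Λ := Λ) hij (c • s) = c • mulPoly hij s := by
      unfold mulPoly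
      rw [map_smul, LinearMap.baseChange_smul]
    refine (LinearMap.congr_fun e x).trans ?_
    exact (algebraMap_smul Λ c _).symm

/-- The morphism `ζ : S ⟶ End(J)` of differential graded algebras, given by multiplication. -/
def zeta : DGAlgebra.Hom (polyDG k r) (endDGAlgebra k (bggJ (k := k) z hz)) where
  hom :=
    { f := fun p => ModuleCat.ofHom (zetaLin z hz p)
      comm' := fun p q hpq => by
        obtain rfl : p + 1 = q := hpq
        refine ModuleCat.hom_ext (LinearMap.ext fun s => ?_)
        exact (δ_zetaFun z hz s).trans (map_zero (zetaLin z hz (p + 1))).symm }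
  map_one := zetaFun_one z hz
  map_mul h a b := zetaFun_mul z hz h a b

end Zeta

section Comp

variable {C : Type*} [Category.{u} C] [Preadditive C] [Linear k C]

/-- The map `Hom(G, M) ⟶ Hom(F, M)` of degree `p` given by composition with a map
`F ⟶ G` of degree `p`. -/
def precomp {F G : CochainComplex C ℤ} {p : ℤ} (c : Cochain F G p) (M : CochainComplex C ℤ) :
    Cochain (homComplex k G M) (homComplex k F M) p :=
  Cochain.mk fun q n h => ModuleCat.ofHom
    { toFun := fun f : Cochain G M q => (c.comp f ((add_comm p q).trans h) : Cochain F M n)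
      map_add' := fun _ _ => Cochain.comp_add _ _ _ _
      map_smul' := fun _ _ => Cochain.comp_smul _ _ _ _ }

/-- The map `Hom(F, M) ⟶ Hom(F, N)` of degree `p` given by composition with a map
`M ⟶ N` of degree `p`. -/
def postcomp {M N : CochainComplex C ℤ} {p : ℤ} (F : CochainComplex C ℤ) (c : Cochain M N p) :
    Cochain (homComplex k F M) (homComplex k F N) p :=
  Cochain.mk fun q n h => ModuleCat.ofHom
    { toFun := fun f : Cochain F M q => (f.comp c h : Cochain F N n)
      map_add' := fun _ _ => Cochain.add_comp _ _ _ _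
      map_smul' := fun _ _ => Cochain.smul_comp _ _ _ _ }

/-- A map of degree `p` between complexes of vector spaces is determined by its values. -/
lemma cochain_ext_apply {X Y : CochainComplex (ModuleCat.{u} k) ℤ} {p : ℤ} {c d : Cochain X Y p}
    (h : ∀ (q n : ℤ) (hq : q + p = n) (x : X.X q), (c.v q n hq).hom x = (d.v q n hq).hom x) :
    c = d :=
  Cochain.ext _ _ fun q n hq => ModuleCat.hom_ext (LinearMap.ext (h q n hq))

variable (k) in
lemma precomp_v_apply {F G : CochainComplex C ℤ} {p : ℤ} (c : Cochain F G p)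
    (M : CochainComplex C ℤ) {q n : ℤ} (h : q + p = n) (f : Cochain G M q) :
    ((precomp (k := k) c M).v q n h).hom f = c.comp f ((add_comm p q).trans h) := rfl

variable (k) in
lemma postcomp_v_apply {M N : CochainComplex C ℤ} {p : ℤ} (F : CochainComplex C ℤ)
    (c : Cochain M N p) {q n : ℤ} (h : q + p = n) (f : Cochain F M q) :
    ((postcomp (k := k) F c).v q n h).hom f = f.comp c h := rfl

lemma homComplex_d_apply {F G : CochainComplex C ℤ} (n m : ℤ) (f : Cochain F G n) :
    ((homComplex k F G).d n m).hom f = δ n m f := rfl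

variable {F G H M N : CochainComplex C ℤ}

lemma precomp_comp {p q n : ℤ} (c : Cochain F G p) (d : Cochain G H q) (h : p + q = n) :
    precomp (k := k) (c.comp d h) M =
      (precomp (k := k) d M).comp (precomp c M) ((add_comm q p).trans h) := by
  refine cochain_ext_apply fun i j hij f => ?_
  rw [Cochain.comp_v _ _ ((add_comm q p).trans h) i (i + q) j rfl (by omega), ModuleCat.comp_apply]
  exact Cochain.comp_assoc c d (show Cochain H M i from f) h (add_comm q i) (by omega)

lemma postcomp_comp {p q n : ℤ} (c : Cochain M N p) (d : Cochain N H q) (h : p + q = n) :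
    postcomp (k := k) F (c.comp d h) = (postcomp (k := k) F c).comp (postcomp F d) h := by
  refine cochain_ext_apply fun i j hij f => ?_
  rw [Cochain.comp_v _ _ h i (i + p) j rfl (by omega), ModuleCat.comp_apply]
  exact (Cochain.comp_assoc (show Cochain F M i from f) c d rfl h (by omega)).symm

lemma precomp_postcomp {p q n : ℤ} (c : Cochain F G p) (d : Cochain M N q) (h : p + q = n) :
    (precomp (k := k) c M).comp (postcomp F d) h =
      (postcomp (k := k) G d).comp (precomp c N) ((add_comm q p).trans h) := by
  refine cochain_ext_apply fun i j hij f => ?_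
  rw [Cochain.comp_v _ _ h i (i + p) j rfl (by omega),
    Cochain.comp_v _ _ ((add_comm q p).trans h) i (i + q) j rfl (by omega), ModuleCat.comp_apply,
    ModuleCat.comp_apply]
  exact Cochain.comp_assoc c (show Cochain G M i from f) d (add_comm p i) rfl (by omega)

lemma precomp_add {p : ℤ} (c d : Cochain F G p) :
    precomp (k := k) (c + d) M = precomp c M + precomp d M :=
  cochain_ext_apply fun i _ h f =>
    Cochain.add_comp c d (show Cochain G M i from f) ((add_comm p i).trans h)

lemma precomp_zero {p : ℤ} : precomp (k := k) (0 : Cochain F G p) M = 0 :=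
  cochain_ext_apply fun i _ h f =>
    Cochain.zero_comp (show Cochain G M i from f) ((add_comm p i).trans h)

lemma precomp_smul {p : ℤ} (a : k) (c : Cochain F G p) :
    precomp (k := k) (a • c) M = a • precomp c M :=
  cochain_ext_apply fun i _ h f =>
    Cochain.smul_comp a c (show Cochain G M i from f) ((add_comm p i).trans h)

lemma postcomp_add {p : ℤ} (c d : Cochain M N p) :
    postcomp (k := k) F (c + d) = postcomp F c + postcomp F d :=
  cochain_ext_apply fun i _ h f => Cochain.comp_add (show Cochain F M i from f) c d h

lemma precomp_id : precomp (k := k) (Cochain.ofHom (𝟙 F)) M = Cochain.ofHom (𝟙 _) :=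
  cochain_ext_apply fun i j h f => by
    obtain rfl : i = j := by omega
    rw [Cochain.ofHom_v]
    exact Cochain.id_comp _

lemma δ_precomp [CharP k 2] {p : ℤ} (c : Cochain F G p) (hc : δ p (p + 1) c = 0) :
    δ p (p + 1) (precomp (k := k) c M) = 0 := by
  refine cochain_ext_apply fun i j hij f => ?_
  have hj : i + p + 1 = j := by omega
  rw [δ_v p (p + 1) rfl _ i j hij (i + p) (i + 1) (by omega) rfl, units_smul_hom' (k := k)]
  change δ (i + p) j (c.comp (show Cochain G M i from f) (add_comm p i)) +
    c.comp (δ i (i + 1) (show Cochain G M i from f)) (show p + (i + 1) = j by omega) = 0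
  rw [δ_comp c (show Cochain G M i from f) (add_comm p i) (p + 1) (i + 1) j hj rfl rfl, hc,
    Cochain.zero_comp, smul_zero, add_zero]
  exact LinearMap.congr_fun (congrArg ModuleCat.Hom.hom
    (add_self_hom (k := k) ((precomp (k := k) c M).v (i + 1) j (by omega))))
      (δ i (i + 1) (show Cochain G M i from f))

lemma postcomp_id : postcomp (k := k) F (Cochain.ofHom (𝟙 M)) = Cochain.ofHom (𝟙 _) :=
  cochain_ext_apply fun i j h f => by
    obtain rfl : i = j := by omega
    rw [Cochain.ofHom_v]
    exact Cochain.comp_id _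

lemma δ_postcomp {p p' : ℤ} (hp : p + 1 = p') (c : Cochain M N p) :
    δ p p' (postcomp (k := k) F c) = postcomp F (δ p p' c) := by
  obtain rfl := hp
  refine cochain_ext_apply fun i j hij f => ?_
  have hj : i + p + 1 = j := by omega
  rw [δ_v p (p + 1) rfl _ i j hij (i + p) (i + 1) (by omega) rfl]
  obtain ⟨f, rfl⟩ : ∃ g : Cochain F M i, g = f := ⟨f, rfl⟩
  change δ (i + p) j (f.comp c rfl) + (p + 1).negOnePow •
    (δ i (i + 1) f).comp c (show (i + 1) + p = j by omega) = f.comp (δ p (p + 1) c) hij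
  rw [δ_comp f c rfl (i + 1) (p + 1) j hj rfl rfl, Int.negOnePow_succ, Units.neg_smul]
  abel

/-- The morphism `Hom(F, M) ⟶ Hom(F, N)` induced by a morphism `M ⟶ N`. -/
def homComplexMap (F : CochainComplex C ℤ) (g : M ⟶ N) : homComplex k F M ⟶ homComplex k F N where
  f n := (postcomp (k := k) F (Cochain.ofHom g)).v n n (add_zero n)
  comm' n m h := by
    obtain rfl : n + 1 = m := h
    refine ModuleCat.hom_ext (LinearMap.ext fun f => ?_)
    obtain ⟨f, rfl⟩ : ∃ g : Cochain F M n, g = f := ⟨f, rfl⟩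
    exact δ_comp_ofHom f g (n + 1)

lemma ofHom_homComplexMap (g : M ⟶ N) :
    Cochain.ofHom (homComplexMap (k := k) F g) = postcomp F (Cochain.ofHom g) :=
  Cochain.ext₀ _ _ fun _ => Cochain.ofHom_v _ _

end Comp

section Functor

open DGModule

variable [CharP k 2] (hz : ∀ i, z i * z i = 0)

/-- The differential graded `S`-module `Hom(J, M)`, with `(s f)(x) = f(s x)`. -/
abbrev homJ (M : CochainComplex (ModuleCat.{u} Λ) ℤ) : DGModule (polyDG k r) where
  X := homComplex k (bggJ (k := k) z hz) M
  act p :=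
    { toFun := fun s => precomp (zetaLin z hz p s) M
      map_add' := fun s t => by rw [map_add, precomp_add]
      map_smul' := fun c s => by rw [map_smul, precomp_smul, RingHom.id_apply] }
  act_one := (congrArg (fun c => precomp c M) (zetaFun_one z hz)).trans precomp_id
  act_mul {p q n} h s t :=
    (congrArg (fun c => precomp c M) ((congrArg (zetaFun z hz) (Subtype.ext (mul_comm _ _))).trans
      (zetaFun_mul z hz ((add_comm q p).trans h) t s))).trans (precomp_comp _ _ _)
  leibniz {p} s := (δ_precomp _ (δ_zetaFun z hz s)).trans
    ((congrArg (fun c => precomp c M) (map_zero (zetaLin z hz (p + 1)))).trans precomp_zero).symm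

lemma homJ_postcomp_linear {M N : CochainComplex (ModuleCat.{u} Λ) ℤ} {n : ℤ} (c : Cochain M N n) :
    IsLinear (homJ (k := k) z hz M) (homJ (k := k) z hz N) (postcomp _ c) := by
  intro p m h s
  rw [units_smul_cochain (k := k)]
  exact precomp_postcomp _ _ _

/-- The functor `Hom(J, -)` from complexes of `Λ`-modules to differential graded `S`-modules. -/
abbrev homJFunctor : CochainComplex (ModuleCat.{u} Λ) ℤ ⥤ DGModule (polyDG k r) where
  obj M := homJ z hz M
  map {M N} g := ⟨homComplexMap _ g, by
    rw [ofHom_homComplexMap]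
    exact homJ_postcomp_linear z hz (Cochain.ofHom g)⟩
  map_id M := hom_ext (HomologicalComplex.hom_ext _ _ fun n =>
    ModuleCat.hom_ext (LinearMap.ext fun f => Cochain.comp_id (show Cochain _ M n from f)))
  map_comp {M N P} g h := hom_ext (HomologicalComplex.hom_ext _ _ fun n =>
    ModuleCat.hom_ext (LinearMap.ext fun f => by
      obtain ⟨f, rfl⟩ : ∃ g : Cochain _ M n, g = f := ⟨f, rfl⟩
      change f.comp (Cochain.ofHom (g ≫ h)) (add_zero n) =
        (f.comp (Cochain.ofHom g) (add_zero n)).comp (Cochain.ofHom h) (add_zero n)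
      rw [Cochain.ofHom_comp, Cochain.comp_assoc_of_third_is_zero_cochain]))

lemma homJFunctor_homotopic {M N : CochainComplex (ModuleCat.{u} Λ) ℤ} {f g : M ⟶ N}
    (h : Homotopy f g) : homotopic _ ((homJFunctor (k := k) z hz).map f)
      ((homJFunctor (k := k) z hz).map g) := by
  obtain ⟨c, hc⟩ := Cochain.equivHomotopy _ _ h
  refine ⟨postcomp _ c, homJ_postcomp_linear z hz c, ?_⟩
  change Cochain.ofHom (homComplexMap _ f) = _ + Cochain.ofHom (homComplexMap _ g)
  rw [ofHom_homComplexMap, ofHom_homComplexMap, hc, postcomp_add, δ_postcomp (neg_add_cancel 1)]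

/-- The functor `Hom(J, -)` from the homotopy category of complexes of `Λ`-modules to the homotopy
category of differential graded `S`-modules. -/
abbrev homJHtpy : HomotopyCategory (ModuleCat.{u} Λ) (ComplexShape.up ℤ) ⥤ HtpyCat (polyDG k r) :=
  CategoryTheory.Quotient.lift _ (homJFunctor z hz ⋙ htpyQuotient _) (by
    rintro M N f g ⟨h⟩
    exact htpy_map_eq (homJFunctor_homotopic z hz h))

/-- The functor `Hom(J, -)` from the homotopy category of complexes of injective `Λ`-modules to
the derived category of differential graded `S`-modules. -/
abbrev homJInj : HomotopyCategory (InjectiveObject (ModuleCat.{u} Λ)) (ComplexShape.up ℤ) ⥤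
    DerCat (polyDG k r) :=
  (InjectiveObject.ι (ModuleCat.{u} Λ)).mapHomotopyCategory (ComplexShape.up ℤ) ⋙
    homJHtpy z hz ⋙ derQ (polyDG k r)

end Functor

end BGG

section HomJShift

open DGModule

section

variable {k : Type u} [Field k] {C : Type*} [Category.{u} C] [Preadditive C] [Linear k C]
  (F M : CochainComplex C ℤ)

variable (k) in
/-- The isomorphism `Hom(F, M⟦a⟧) ≅ Hom(F, M)⟦a⟧`, which is the identity on underlying maps. -/
def homComplexShiftIso (a : ℤ) : homComplex k F (M⟦a⟧) ≅ (homComplex k F M)⟦a⟧ :=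
  HomologicalComplex.Hom.isoOfComponents (fun n =>
    ((Cochain.rightShiftLinearEquiv k F M (n + a) a n rfl).symm.toModuleIso :
      ModuleCat.of k (Cochain F (M⟦a⟧) n) ≅ ModuleCat.of k (Cochain F M (n + a))))
    (fun n m h => by
      refine ModuleCat.hom_ext (LinearMap.ext fun f => ?_)
      obtain ⟨f, rfl⟩ : ∃ g : Cochain F (M⟦a⟧) n, g = f := ⟨f, rfl⟩
      change a.negOnePow • δ (n + a) (m + a) (f.rightUnshift (n + a) rfl) =
        (δ n m f).rightUnshift (m + a) rfl
      rw [Cochain.δ_rightUnshift f (n + a) rfl (m + a) m rfl, smul_smul, Int.units_mul_self,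
        one_smul])

lemma homComplexShiftIso_hom_apply (a n : ℤ) (f : Cochain F (M⟦a⟧) n) :
    ((homComplexShiftIso k F M a).hom.f n).hom f = f.rightUnshift (n + a) rfl := rfl

variable {F M}

lemma homComplex_XIsoOfEq_v {n m : ℤ} (h : n = m) (f : Cochain F M n) (p q : ℤ) (hp : p + m = q) :
    Cochain.v (show Cochain F M m from ((homComplex k F M).XIsoOfEq h).hom.hom f) p q hp =
      f.v p q (by omega) := by
  subst h
  simp
  rfl

lemma rightUnshift_v_self (a n : ℤ) (f : Cochain F (M⟦a⟧) n) (p q : ℤ) (h : p + (n + a) = q)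
    (q' : ℤ) (h' : p + n = q') :
    (f.rightUnshift (n + a) rfl).v p q h = f.v p q' h' ≫
      (M.XIsoOfEq (show q' + a = q by omega)).hom :=
  Cochain.rightUnshift_v _ _ _ _ _ _ _ h'

lemma homComplexShiftIso_naturality {M N : CochainComplex C ℤ} (g : M ⟶ N) (a : ℤ) :
    homComplexMap (k := k) F (g⟦a⟧') ≫ (homComplexShiftIso k F N a).hom =
      (homComplexShiftIso k F M a).hom ≫ (homComplexMap (k := k) F g)⟦a⟧' := by
  refine HomologicalComplex.hom_ext _ _ fun n => ModuleCat.hom_ext (LinearMap.ext fun f => ?_)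
  obtain ⟨f, rfl⟩ : ∃ g : Cochain F (M⟦a⟧) n, g = f := ⟨f, rfl⟩
  change (f.comp (Cochain.ofHom (g⟦a⟧')) (add_zero n)).rightUnshift (n + a) rfl =
    (f.rightUnshift (n + a) rfl).comp (Cochain.ofHom g) (add_zero _)
  refine Cochain.ext _ _ fun p q h => ?_
  rw [Cochain.comp_zero_cochain_v, rightUnshift_v_self _ _ _ p q h (p + n) rfl,
    rightUnshift_v_self _ _ _ p q h (p + n) rfl, Cochain.comp_zero_cochain_v]
  have e : ∀ {i j : ℤ} (hij : i = j), (g.f i) ≫ (N.XIsoOfEq hij).hom =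
      (M.XIsoOfEq hij).hom ≫ g.f j := by
    rintro i _ rfl
    simp
  rw [Cochain.ofHom_v, Cochain.ofHom_v]
  exact (Category.assoc _ _ _).trans ((congrArg (fun t => f.v p (p + n) rfl ≫ t)
    (e (show p + n + a = q by omega))).trans (Category.assoc _ _ _).symm)

lemma homComplexShiftIso_zero (M : CochainComplex C ℤ) :
    (homComplexShiftIso k F M 0).hom =
      homComplexMap F ((shiftFunctorZero (CochainComplex C ℤ) ℤ).hom.app M) ≫
        (shiftFunctorZero (CochainComplex (ModuleCat.{u} k) ℤ) ℤ).inv.app (homComplex k F M) := by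
  refine HomologicalComplex.hom_ext _ _ fun n => ModuleCat.hom_ext (LinearMap.ext fun f => ?_)
  obtain ⟨f, rfl⟩ : ∃ g : Cochain F (M⟦(0 : ℤ)⟧) n, g = f := ⟨f, rfl⟩
  refine Cochain.ext _ _ fun p q h => ?_
  have hq : p + (n + 0) = q := h
  refine (rightUnshift_v_self _ _ _ p q h (p + n) rfl).trans ?_
  refine Eq.trans ?_ (homComplex_XIsoOfEq_v (k := k) (show n = n + 0 by omega)
    (f.comp (Cochain.ofHom ((shiftFunctorZero (CochainComplex C ℤ) ℤ).hom.app M)) (add_zero n))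
      p q h).symm
  obtain rfl : p + n = q := by omega
  rw [Cochain.comp_zero_cochain_v, Cochain.ofHom_v, CochainComplex.shiftFunctorZero_hom_app_f]

lemma comp_aux₃ {C : Type*} [Category C] {X Y Y₁ Y₂ Z : C} {u : X ⟶ Y} {w : Y ⟶ Z} {a : Y ⟶ Y₁} {b : Y₁ ⟶ Y₂} {c : Y₂ ⟶ Z}
    (h : w = a ≫ b ≫ c) : u ≫ w = ((u ≫ a) ≫ b) ≫ c := by
  simp [h]

lemma XIsoOfEq_comp₃ (M : CochainComplex C ℤ) {i₁ i₂ i₃ i₄ : ℤ} (h : i₁ = i₄) (h₁ : i₁ = i₂)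
    (h₂ : i₂ = i₃) (h₃ : i₃ = i₄) : (M.XIsoOfEq h).hom =
      (M.XIsoOfEq h₁).hom ≫ (M.XIsoOfEq h₂).hom ≫ (M.XIsoOfEq h₃).hom := by
  subst h₁ h₂ h₃
  simp

lemma homComplexShiftIso_add (M : CochainComplex C ℤ) (a b : ℤ) :
    (homComplexShiftIso k F M (a + b)).hom =
      homComplexMap F ((shiftFunctorAdd (CochainComplex C ℤ) a b).hom.app M) ≫
        (homComplexShiftIso k F (M⟦a⟧) b).hom ≫ (homComplexShiftIso k F M a).hom⟦b⟧' ≫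
        (shiftFunctorAdd (CochainComplex (ModuleCat.{u} k) ℤ) a b).inv.app (homComplex k F M) := by
  refine HomologicalComplex.hom_ext _ _ fun n => ModuleCat.hom_ext (LinearMap.ext fun f => ?_)
  obtain ⟨f, rfl⟩ : ∃ g : Cochain F (M⟦a + b⟧) n, g = f := ⟨f, rfl⟩
  refine Cochain.ext _ _ fun p q h => ?_
  have hq : p + (n + (a + b)) = q := h
  refine (rightUnshift_v_self _ _ _ p q h (p + n) rfl).trans ?_
  refine Eq.trans ?_ (homComplex_XIsoOfEq_v (k := k) (show n + b + a = n + (a + b) by omega)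
    (Cochain.rightUnshift (Cochain.rightUnshift (f.comp (Cochain.ofHom
      ((shiftFunctorAdd (CochainComplex C ℤ) a b).hom.app M)) (add_zero n)) (n + b) rfl)
        (n + b + a) rfl) p q h).symm
  rw [rightUnshift_v_self _ _ _ p q (by omega) (p + n + b) (by omega),
    rightUnshift_v_self _ _ _ p (p + n + b) (by omega) (p + n) rfl, Cochain.comp_zero_cochain_v,
    Cochain.ofHom_v, CochainComplex.shiftFunctorAdd_hom_app_f]
  exact comp_aux₃ (XIsoOfEq_comp₃ M (i₁ := p + n + (a + b)) (i₂ := p + n + b + a)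
    (i₃ := p + n + b + a) (i₄ := q) (by omega) (by omega) rfl (by omega))

end

variable {k : Type u} [Field k] {r : ℕ} {Λ : Type u} [CommRing Λ] [Algebra k Λ] (z : Fin r → Λ)
  [CharP k 2] (hz : ∀ i, z i * z i = 0)

lemma homJShiftIso_linear (M : CochainComplex (ModuleCat.{u} Λ) ℤ) (a : ℤ) :
    IsLinear (homJ (k := k) z hz (M⟦a⟧)) ((homJ (k := k) z hz M).shiftObj a)
      (Cochain.ofHom (homComplexShiftIso k _ M a).hom) := by
  intro p m h s
  rw [units_smul_cochain (k := k), shiftObj_act, units_smul_cochain (k := k)]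
  obtain rfl : m = p := by omega
  refine cochain_ext_apply fun i j hij f => ?_
  obtain ⟨f, rfl⟩ : ∃ g : Cochain _ (M⟦a⟧) i, g = f := ⟨f, rfl⟩
  rw [Cochain.comp_zero_cochain_v, Cochain.zero_cochain_comp_v, Cochain.ofHom_v, Cochain.ofHom_v,
    Cochain.shift_v']
  exact Cochain.rightUnshift_comp (zetaLin z hz m s) f ((add_comm m i).trans hij) (j + a) rfl (i + a) rfl

/-- The isomorphism `Hom(J, M⟦a⟧) ≅ Hom(J, M)⟦a⟧` of differential graded `S`-modules. -/
def homJShiftIso (M : CochainComplex (ModuleCat.{u} Λ) ℤ) (a : ℤ) :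
    (homJFunctor (k := k) z hz).obj (M⟦a⟧) ≅ ((homJFunctor (k := k) z hz).obj M)⟦a⟧ :=
  isoMk (homComplexShiftIso k _ M a) (homJShiftIso_linear z hz M a)

instance : (homJFunctor (k := k) z hz).CommShift ℤ where
  commShiftIso a := NatIso.ofComponents (fun M => homJShiftIso z hz M a)
    (fun g => hom_ext (homComplexShiftIso_naturality g a))
  commShiftIso_zero := by
    ext1
    ext1
    ext1 M
    rw [Functor.CommShift.isoZero_hom_app]
    exact hom_ext (homComplexShiftIso_zero M)
  commShiftIso_add a b := by
    ext1
    ext1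
    ext1 M
    rw [Functor.CommShift.isoAdd_hom_app]
    exact hom_ext (homComplexShiftIso_add M a b)

instance : (homJHtpy (k := k) z hz).CommShift ℤ :=
  CategoryTheory.Quotient.liftCommShift (homJFunctor (k := k) z hz ⋙ htpyQuotient _) _ ℤ _

end HomJShift

section GroupAlgebra

variable (k : Type u) [Field k] {E : Type u} [CommGroup E] {r : ℕ}

/-- The elements `z_i = g_i - 1` of the group algebra `kE`. -/
def groupZ (g : Fin r → E) (i : Fin r) : MonoidAlgebra k E := MonoidAlgebra.of k E (g i) - 1

lemma groupZ_mul_self [CharP k 2] (hE : ∀ a : E, a ^ 2 = 1) (g : Fin r → E) (i : Fin r) :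
    groupZ k g i * groupZ k g i = 0 := by
  have h2 : (2 : MonoidAlgebra k E) = 0 := by
    rw [← map_ofNat (algebraMap k (MonoidAlgebra k E)) 2,
      show (OfNat.ofNat 2 : k) = 0 from CharTwo.two_eq_zero, map_zero]
  have h : MonoidAlgebra.of k E (g i) * MonoidAlgebra.of k E (g i) = 1 := by
    rw [← map_mul, ← pow_two, hE, map_one]
  calc groupZ k g i * groupZ k g i
      = MonoidAlgebra.of k E (g i) * MonoidAlgebra.of k E (g i) + 1
        - 2 * MonoidAlgebra.of k E (g i) := by unfold groupZ; ring
    _ = 1 + 1 - 2 * MonoidAlgebra.of k E (g i) := by rw [h]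
    _ = 0 := by rw [one_add_one_eq_two, h2]; simp

end GroupAlgebra

end

/-! Everything is read off from the socle. The square-free monomials in the z_i form a basis of Λ =
kE, and the product σ of all z_i spans the socle of Λ. The complex J is of Koszul type: its terms
are injective, and its only cohomology is the line spanned by σ ⊗ 1 in degree 0 (`koszul_exact`,
`koszul_ker_zero`). So J is an injective resolution of the trivial module k, embedded by 1 ↦ σ ⊗ 1.

For a complex M of injectives, bounded or not, evaluation at σ ⊗ 1 maps Hom(J, M)
quasi-isomorphically onto the socle complex Hom(k, M) of M. Since J is bounded below and exact off
degree 0, a cocycle vanishing at σ ⊗ 1 can be killed one degree at a time (`exists_δ_eq_of_vanish`).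
Thus a map into Hom(J, M) whose composite with this evaluation is a bijection onto the socle is a
quasi-isomorphism (`quasiIso_of_bijective_socle`).

The socle of Λ ⊗ V is σ ⊗ V. With V = S this shows that ζ is a quasi-isomorphism. With V = N, a DG
S-module, it shows that the unit N → Hom(J, J ⊗_S N) is one, where J ⊗_S N is Λ ⊗ N with a twisted
differential; this tensor product is left adjoint to Hom(J, -), already at the level of Hom
complexes.

If Hom(J, M) is acyclic, then so is the socle complex of M. Every Λ-module has a finite filtration
whose layers are killed by all z_i, so maps from any module into the cycles of M lift along the
differential (`liftsCycles_of_socle_exact`), and M is contractible. Applied to cones, this shows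
that Hom(J, -) reflects isomorphisms from quasi-isomorphisms.

A right adjoint whose unit consists of quasi-isomorphisms and which reflects in this sense becomes
an equivalence after localization (`isEquivalence_comp_localization_of_universal`). Exactness holds
because Hom(J, -) commutes with shifts and mapping cones. -/

noncomputable section

open CategoryTheory CategoryTheory.Limits CategoryTheory.Pretriangulated
open CochainComplex.HomComplex
open scoped TensorProduct

/-! ### Square-free monomials: coordinates, socle and derivations. -/

section SquareFreeBasis

variable {k : Type u} [Field k] {r : ℕ} {Λ : Type u} [CommRing Λ] [Algebra k Λ] {z : Fin r → Λ}
  (b : Module.Basis (Finset (Fin r)) k Λ) (hb : ∀ I, b I = ∏ i ∈ I, z i)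

/-- The coordinates in `V` of an element of `Λ ⊗ V` with respect to a basis of `Λ`. -/
def tensorCoord (V : Type*) [AddCommGroup V] [Module k V] (I : Finset (Fin r)) :
    Λ ⊗[k] V →ₗ[k] V :=
  (TensorProduct.lid k V).toLinearMap ∘ₗ (b.coord I).rTensor V

@[simp]
lemma tensorCoord_tmul {V : Type*} [AddCommGroup V] [Module k V] (I : Finset (Fin r)) (a : Λ)
    (v : V) : tensorCoord b V I (a ⊗ₜ v) = b.coord I a • v := rfl

lemma sum_tensorCoord {V : Type*} [AddCommGroup V] [Module k V] (x : Λ ⊗[k] V) :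
    ∑ I, b I ⊗ₜ[k] tensorCoord b V I x = x := by
  induction x with
  | zero => simp
  | add x y hx hy => simp only [map_add, TensorProduct.tmul_add, Finset.sum_add_distrib, hx, hy]
  | tmul a v =>
    simp only [tensorCoord_tmul, TensorProduct.tmul_smul, TensorProduct.smul_tmul']
    rw [← TensorProduct.sum_tmul]
    congr 1
    exact b.sum_repr a

lemma eq_zero_of_tensorCoord {V : Type*} [AddCommGroup V] [Module k V] {x : Λ ⊗[k] V}
    (h : ∀ I, tensorCoord b V I x = 0) : x = 0 := by
  rw [← sum_tensorCoord b x]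
  simp [h]

lemma tensorCoord_lTensor {V W : Type*} [AddCommGroup V] [Module k V] [AddCommGroup W] [Module k W]
    (f : V →ₗ[k] W) (I : Finset (Fin r)) (x : Λ ⊗[k] V) :
    tensorCoord b W I (f.lTensor Λ x) = f (tensorCoord b V I x) := by
  induction x with
  | zero => simp
  | add x y hx hy => simp only [map_add, hx, hy]
  | tmul a v => simp

include hb

lemma z_mul_basis (hz : ∀ i, z i * z i = 0) (i : Fin r) (I : Finset (Fin r)) :
    z i * b I = if i ∈ I then 0 else b (insert i I) := by
  split_ifs with h
  · rw [hb, ← Finset.mul_prod_erase I z h, ← mul_assoc, hz, zero_mul]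
  · rw [hb, hb, Finset.prod_insert h]

lemma z_mul_socle (hz : ∀ i, z i * z i = 0) (i : Fin r) : z i * b Finset.univ = 0 := by
  rw [z_mul_basis b hb hz, if_pos (Finset.mem_univ i)]

/-- Multiplication by z_i sends the monomials without z_i injectively to those with z_i and kills
the rest, so no other monomial contributes to this coefficient. This is how elements outside the
socle are detected. -/
lemma coord_insert_z_mul (hz : ∀ i, z i * z i = 0) {i : Fin r} {I : Finset (Fin r)} (hi : i ∉ I)
    (a : Λ) : b.coord (insert i I) (z i * a) = b.coord I a := by
  have e : b.coord (insert i I) ∘ₗ LinearMap.mulLeft k (z i) = b.coord I := by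
    refine b.ext fun K => ?_
    simp only [LinearMap.comp_apply, LinearMap.mulLeft_apply, z_mul_basis b hb hz]
    split_ifs with h
    · have : K ≠ I := by rintro rfl; exact hi h
      simp [this]
    · have : insert i K = insert i I ↔ K = I := by
        constructor
        · intro e
          rw [← Finset.erase_insert h, e, Finset.erase_insert hi]
        · rintro rfl; rfl
      simp [Finsupp.single_apply, this]
  exact LinearMap.congr_fun e a

lemma tensorCoord_z_smul (hz : ∀ i, z i * z i = 0) {V : Type*} [AddCommGroup V] [Module k V]
    {i : Fin r} {I : Finset (Fin r)} (hi : i ∉ I) (x : Λ ⊗[k] V) :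
    tensorCoord b V (insert i I) (z i • x) = tensorCoord b V I x := by
  induction x with
  | zero => simp
  | add x y hx hy => simp only [smul_add, map_add, hx, hy]
  | tmul a v =>
    rw [TensorProduct.smul_tmul', tensorCoord_tmul, tensorCoord_tmul, smul_eq_mul,
      coord_insert_z_mul b hb hz hi]

/-- An element of `Λ ⊗ V` which is annihilated by all `z_i` is of the form `σ ⊗ v`. -/
lemma eq_socle_tmul (hz : ∀ i, z i * z i = 0) {V : Type*} [AddCommGroup V] [Module k V]
    {x : Λ ⊗[k] V} (hx : ∀ i, z i • x = 0) :
    x = b Finset.univ ⊗ₜ tensorCoord b V Finset.univ x := by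
  conv_lhs => rw [← sum_tensorCoord b x]
  refine Finset.sum_eq_single _ (fun I _ hI => ?_) (fun h => (h (Finset.mem_univ _)).elim)
  obtain ⟨i, hi⟩ : ∃ i, i ∉ I := by
    by_contra! h
    exact hI (Finset.eq_univ_of_forall h)
  -- A proper subset I misses some i, so the coordinate of x at I is a coordinate of z_i x = 0.
  rw [← tensorCoord_z_smul b hb hz hi, hx, map_zero, TensorProduct.tmul_zero]

omit hb

/-- The linear operator on `Λ` which removes `z_j` from the monomials containing it and kills
the other square-free monomials. -/
def zDeriv (j : Fin r) : Λ →ₗ[k] Λ :=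
  b.constr k fun I => if j ∈ I then b (I.erase j) else 0

lemma zDeriv_basis (j : Fin r) (I : Finset (Fin r)) :
    zDeriv b j (b I) = if j ∈ I then b (I.erase j) else 0 := b.constr_basis _ _ _

include hb

/-- `zDeriv` is ∂/∂z_j without signs, so it commutes with the other variables instead of
anticommuting. -/
lemma zDeriv_z_mul_of_ne (hz : ∀ i, z i * z i = 0) {i j : Fin r} (hij : i ≠ j) (a : Λ) :
    zDeriv b j (z i * a) = z i * zDeriv b j a := by
  have e : zDeriv b j ∘ₗ LinearMap.mulLeft k (z i) =
      LinearMap.mulLeft k (z i) ∘ₗ zDeriv b j := by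
    refine b.ext fun I => ?_
    simp only [LinearMap.comp_apply, LinearMap.mulLeft_apply, z_mul_basis b hb hz, zDeriv_basis]
    by_cases hi : i ∈ I <;> by_cases hj : j ∈ I <;>
      simp [hi, hj, zDeriv_basis, z_mul_basis b hb hz, hij, hij.symm,
        Finset.erase_insert_of_ne]
  exact LinearMap.congr_fun e a

/-- On each monomial exactly one of the two terms survives, according to whether z_j divides it.
This identity drives the contraction of J. -/
lemma zDeriv_z_mul_self (hz : ∀ i, z i * z i = 0) (j : Fin r) (a : Λ) :
    zDeriv b j (z j * a) + z j * zDeriv b j a = a := by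
  have e : zDeriv b j ∘ₗ LinearMap.mulLeft k (z j) +
      LinearMap.mulLeft k (z j) ∘ₗ zDeriv b j = LinearMap.id := by
    refine b.ext fun I => ?_
    simp only [LinearMap.add_apply, LinearMap.comp_apply, LinearMap.mulLeft_apply,
      z_mul_basis b hb hz, zDeriv_basis]
    by_cases hj : j ∈ I <;>
      simp [hj, zDeriv_basis, z_mul_basis b hb hz]
  exact LinearMap.congr_fun e a

end SquareFreeBasis

/-! ### The group algebra: monomial basis and injectivity of kE ⊗ V. -/

section GroupAlgebra

variable (k : Type u) [Field k] {E : Type u} [CommGroup E] {r : ℕ}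

/-- The span contains 1, the empty monomial. It is stable under z_i because z_i² = 0, hence under
g_i = 1 + z_i, hence under every element of E. -/
lemma span_groupZ_eq_top [CharP k 2] (hE : ∀ a : E, a ^ 2 = 1) (g : Fin r → E)
    (hg : Subgroup.closure (Set.range g) = ⊤) :
    ⊤ ≤ Submodule.span k (Set.range fun I : Finset (Fin r) => ∏ i ∈ I, groupZ k g i) := by
  set S := Submodule.span k (Set.range fun I : Finset (Fin r) => ∏ i ∈ I, groupZ k g i) with hS
  have hmul : ∀ i, ∀ x ∈ S, groupZ k g i * x ∈ S := by
    intro i x hx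
    induction hx using Submodule.span_induction with
    | zero => rw [mul_zero]; exact S.zero_mem
    | add x y _ _ hx hy => rw [mul_add]; exact S.add_mem hx hy
    | smul c x _ hx => rw [mul_smul_comm]; exact S.smul_mem c hx
    | mem x hx =>
      obtain ⟨I, rfl⟩ := hx
      by_cases hi : i ∈ I
      · dsimp only
        rw [← Finset.mul_prod_erase I _ hi, ← mul_assoc, groupZ_mul_self k hE, zero_mul]
        exact S.zero_mem
      · dsimp only
        rw [← Finset.prod_insert hi]
        exact Submodule.subset_span ⟨_, rfl⟩
  have hmul' : ∀ i, ∀ x ∈ S, MonoidAlgebra.of k E (g i) * x ∈ S := by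
    intro i x hx
    have : MonoidAlgebra.of k E (g i) * x = groupZ k g i * x + x := by unfold groupZ; ring
    rw [this]
    exact S.add_mem (hmul i x hx) hx
  -- Exponent two makes every element its own inverse, which disposes of the inverse case of the
  -- closure induction.
  have hinv : ∀ a : E, a⁻¹ = a := fun a => inv_eq_of_mul_eq_one_left (by rw [← pow_two, hE])
  have hof : ∀ a : E, ∀ x ∈ S, MonoidAlgebra.of k E a * x ∈ S := by
    intro a
    have ha : a ∈ Subgroup.closure (Set.range g) := by rw [hg]; trivial
    induction ha using Subgroup.closure_induction with
    | mem a ha => obtain ⟨i, rfl⟩ := ha; exact hmul' i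
    | one => intro x hx; rwa [map_one, one_mul]
    | mul a b _ _ ha hb => intro x hx; rw [map_mul, mul_assoc]; exact ha _ (hb _ hx)
    | inv a _ ha => rwa [hinv]
  have h1 : (1 : MonoidAlgebra k E) ∈ S := Submodule.subset_span ⟨∅, by simp⟩
  intro a _
  induction a using MonoidAlgebra.induction_on with
  | of a => simpa using hof a 1 h1
  | add a b ha hb => exact S.add_mem (ha trivial) (hb trivial)
  | smul c a ha => exact S.smul_mem c (ha trivial)

/-- The 2^r monomials span a space of dimension |E| = 2^r, so they are independent; here the rank
has to be exactly r. -/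
lemma exists_groupZ_basis [CharP k 2] (hE : ∀ a : E, a ^ 2 = 1) (hcard : Nat.card E = 2 ^ r)
    (g : Fin r → E) (hg : Subgroup.closure (Set.range g) = ⊤) :
    ∃ b : Module.Basis (Finset (Fin r)) k (MonoidAlgebra k E),
      ∀ I, b I = ∏ i ∈ I, groupZ k g i := by
  have : Finite E := Nat.finite_of_card_ne_zero (by rw [hcard]; positivity)
  have := Fintype.ofFinite E
  have hs := span_groupZ_eq_top k hE g hg
  have hc : Fintype.card (Finset (Fin r)) = Module.finrank k (MonoidAlgebra k E) := by
    rw [Module.finrank_eq_card_basis (MonoidAlgebra.basis E k), Fintype.card_finset,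
      Fintype.card_fin, ← hcard, Nat.card_eq_fintype_card]
  refine ⟨basisOfTopLeSpanOfCardEqFinrank _ hs hc, fun I => ?_⟩
  rw [coe_basisOfTopLeSpanOfCardEqFinrank]

variable (E) in
/-- The module `kE ⊗ V` is injective: a `kE`-linear map to `kE ⊗ V` corresponds to a
`k`-linear map to `V`, via the coefficient of `1 ∈ E`. -/
lemma injective_monoidAlgebra_tensor [Finite E] (V : Type u) [AddCommGroup V] [Module k V] :
    Injective (ModuleCat.of (MonoidAlgebra k E) (MonoidAlgebra k E ⊗[k] V)) := by
  have := Fintype.ofFinite E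
  let A := MonoidAlgebra k E
  let τ : A ⊗[k] V →ₗ[k] V :=
    (TensorProduct.lid k V).toLinearMap ∘ₗ ((MonoidAlgebra.basis E k).coord 1).rTensor V
  -- Inversion formula: the coefficient of h in x is the coefficient of 1 in h⁻¹x.
  have hτ : ∀ x : A ⊗[k] V, ∑ h : E, MonoidAlgebra.of k E h ⊗ₜ[k]
      τ (MonoidAlgebra.of k E h⁻¹ • x) = x := by
    intro x
    induction x with
    | zero => simp
    | add x y hx hy =>
      simp only [smul_add, map_add, TensorProduct.tmul_add, Finset.sum_add_distrib, hx, hy]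
    | tmul a v =>
      have e : ∀ h : E, τ (MonoidAlgebra.of k E h⁻¹ • (a ⊗ₜ[k] v)) = a.coeff h • v := by
        intro h
        change ((MonoidAlgebra.basis E k).coord 1 (MonoidAlgebra.of k E h⁻¹ * a)) • v = _
        congr 1
        refine (MonoidAlgebra.coeff_single_mul_apply a 1 h⁻¹ 1).trans ?_
        rw [inv_inv, mul_one, one_mul]
      refine (Finset.sum_congr rfl fun h _ => congrArg _ (e h)).trans ?_
      simp only [TensorProduct.tmul_smul, TensorProduct.smul_tmul']
      rw [← TensorProduct.sum_tmul]
      congr 1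
      exact (MonoidAlgebra.basis E k).sum_repr a
  rw [← Module.injective_iff_injective_object]
  constructor
  intro X Y _ _ _ _ f hf φ
  let _ : Module k X := Module.compHom X (algebraMap k A)
  let _ : Module k Y := Module.compHom Y (algebraMap k A)
  have : IsScalarTower k A X := ⟨fun c a x => by
    rw [Algebra.smul_def, mul_smul]; rfl⟩
  have : IsScalarTower k A Y := ⟨fun c a x => by
    rw [Algebra.smul_def, mul_smul]; rfl⟩
  -- Over the field k the injection f splits; the splitting need not be kE-linear.
  obtain ⟨s, hs⟩ := (f.restrictScalars k).exists_leftInverse_of_injective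
    (LinearMap.ker_eq_bot.2 hf)
  let t : Y →ₗ[k] V := τ ∘ₗ φ.restrictScalars k ∘ₗ s
  -- The kE-linear map coinduced from t, obtained by putting t in place of τ in the inversion
  -- formula. There is no division by |E|, which may be zero in k.
  let F : Y →ₗ[k] A ⊗[k] V := ∑ h : E, TensorProduct.mk k A V (MonoidAlgebra.of k E h) ∘ₗ t ∘ₗ
    (LinearMap.lsmul A Y (MonoidAlgebra.of k E h⁻¹)).restrictScalars k
  have hF : ∀ y, F y = ∑ h : E, MonoidAlgebra.of k E h ⊗ₜ t (MonoidAlgebra.of k E h⁻¹ • y) := by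
    intro y
    simp [F, LinearMap.sum_apply]
  have hFg : ∀ (g : E) (y : Y), F (MonoidAlgebra.of k E g • y) = MonoidAlgebra.of k E g • F y := by
    intro g y
    rw [hF, hF, Finset.smul_sum]
    -- Equivariance is the substitution h ↦ gh in the sum.
    refine (Fintype.sum_equiv (Equiv.mulLeft g) _ _ fun h => ?_).symm
    rw [TensorProduct.smul_tmul', smul_eq_mul, ← map_mul, smul_smul, ← map_mul]
    simp
  have hFl : ∀ (a : A) (y : Y), F (a • y) = a • F y := by
    intro a y
    induction a using MonoidAlgebra.induction_on with
    | of g => exact hFg g y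
    | add a b ha hb => rw [add_smul, add_smul, map_add, ha, hb]
    | smul c a ha => rw [smul_assoc, smul_assoc, map_smul, ha]
  refine ⟨⟨⟨F, F.map_add⟩, hFl⟩, fun x => ?_⟩
  change F (f x) = φ x
  rw [hF, ← hτ (φ x)]
  refine Finset.sum_congr rfl fun h _ => ?_
  congr 1
  change τ (φ (s _)) = _
  rw [← map_smul f, show s (f (MonoidAlgebra.of k E h⁻¹ • x)) = _ from LinearMap.congr_fun hs _,
    ← map_smul φ]
  rfl

end GroupAlgebra

/-! ### Division with remainder by a variable on the graded pieces of S. -/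

section PolyOperators

variable {k : Type u} [Field k] {r : ℕ}

/-- Division by `x_j`, which kills the monomials not divisible by `x_j`. -/
def polyDiv (j : Fin r) {n m : ℤ} (h : n + 1 = m) : polyDeg k r m →ₗ[k] polyDeg k r n where
  toFun s := ⟨s.1.divMonomial (Finsupp.single j 1), fun d hd => by
    rw [MvPolynomial.coeff_divMonomial] at hd
    have := s.2 hd
    rw [map_add, Finsupp.weight_single, one_smul] at this
    omega⟩
  map_add' s t := Subtype.ext (MvPolynomial.add_divMonomial _ _ _)
  map_smul' c s := Subtype.ext (by
    ext d
    simp [MvPolynomial.coeff_divMonomial])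

/-- The projection onto the span of the monomials not divisible by `x_j`. -/
def polyMod (j : Fin r) (n : ℤ) : polyDeg k r n →ₗ[k] polyDeg k r n where
  toFun s := ⟨s.1.modMonomial (Finsupp.single j 1), fun d hd => s.2 fun h => hd (by
    by_cases hj : Finsupp.single j 1 ≤ d
    · exact MvPolynomial.coeff_modMonomial_of_le _ hj
    · rw [MvPolynomial.coeff_modMonomial_of_not_le _ hj, h])⟩
  map_add' s t := Subtype.ext (by
    ext d
    by_cases hj : Finsupp.single j 1 ≤ d <;>
      simp [MvPolynomial.coeff_modMonomial_of_le, MvPolynomial.coeff_modMonomial_of_not_le, hj])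
  map_smul' c s := Subtype.ext (by
    ext d
    by_cases hj : Finsupp.single j 1 ≤ d <;>
      simp [MvPolynomial.coeff_modMonomial_of_le, MvPolynomial.coeff_modMonomial_of_not_le, hj])

lemma polyDiv_var_mul (j : Fin r) {n m : ℤ} (h : n + 1 = m) (h' : 1 + n = m) (t : polyDeg k r n) :
    polyDiv j h (polyMul h' (polyVar k r j) t) = t :=
  Subtype.ext (MvPolynomial.X_mul_divMonomial j t.1)

lemma var_mul_polyDiv (j : Fin r) {n m : ℤ} (h : n + 1 = m) (h' : 1 + n = m) (t : polyDeg k r m) :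
    polyMul h' (polyVar k r j) (polyDiv j h t) + polyMod j m t = t :=
  Subtype.ext (MvPolynomial.divMonomial_add_modMonomial_single t.1 j)

lemma polyDiv_var_mul_of_ne {i j : Fin r} (hij : i ≠ j) {l n m : ℤ} (h : l + 1 = n)
    (h' : n + 1 = m) (h₁ : 1 + n = m) (h₂ : 1 + l = n) (t : polyDeg k r n) :
    polyDiv j h' (polyMul h₁ (polyVar k r i) t) = polyMul h₂ (polyVar k r i) (polyDiv j h t) := by
  refine Subtype.ext (MvPolynomial.ext _ _ fun d => ?_)
  change MvPolynomial.coeff d ((MvPolynomial.X i * t.1).divMonomial _) =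
    MvPolynomial.coeff d (MvPolynomial.X i * t.1.divMonomial _)
  rw [MvPolynomial.coeff_divMonomial, MvPolynomial.coeff_X_mul', MvPolynomial.coeff_X_mul']
  have e : i ∈ (Finsupp.single j 1 + d).support ↔ i ∈ d.support := by
    simp [hij.symm]
  simp only [e]
  split_ifs with hi
  · rw [MvPolynomial.coeff_divMonomial]
    congr 1
    ext a
    by_cases ha : a = i
    · subst ha
      simp [hij.symm]
    · simp [Finsupp.single_apply, Ne.symm ha]
  · rfl

lemma coeff_polyMod (j : Fin r) {n : ℤ} (t : polyDeg k r n) (d : Fin r →₀ ℕ) :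
    (polyMod j n t).1.coeff d = if Finsupp.single j 1 ≤ d then 0 else t.1.coeff d := by
  split_ifs with h
  · exact MvPolynomial.coeff_modMonomial_of_le _ h
  · exact MvPolynomial.coeff_modMonomial_of_not_le _ h

lemma polyMod_comm (i j : Fin r) {n : ℤ} : polyMod (k := k) i n ∘ₗ polyMod j n =
    polyMod j n ∘ₗ polyMod i n := by
  refine LinearMap.ext fun t => Subtype.ext (MvPolynomial.ext _ _ fun d => ?_)
  simp only [LinearMap.comp_apply, coeff_polyMod]
  split_ifs <;> rfl

lemma polyMod_idem (j : Fin r) {n : ℤ} :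
    polyMod (k := k) j n ∘ₗ polyMod j n = polyMod j n := by
  refine LinearMap.ext fun t => Subtype.ext (MvPolynomial.ext _ _ fun d => ?_)
  simp only [LinearMap.comp_apply, coeff_polyMod]
  split_ifs <;> rfl

/-- A monomial of nonzero degree contains some x_j and is then killed by `polyMod j`. -/
lemma eq_zero_of_polyMod {n : ℤ} (hn : n ≠ 0) {t : polyDeg k r n}
    (ht : ∀ j, polyMod j n t = t) : t = 0 := by
  refine Subtype.ext (MvPolynomial.ext _ _ fun d => ?_)
  by_contra hd
  have hd' : d ≠ 0 := by
    rintro rfl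
    have := t.2 hd
    rw [map_zero] at this
    exact hn this.symm
  obtain ⟨j, hj⟩ := Finsupp.ne_iff.1 hd'
  refine hd ?_
  rw [← ht j, coeff_polyMod, if_pos]
  · rfl
  · rw [Finsupp.single_le_iff]
    exact Nat.one_le_iff_ne_zero.2 hj

lemma polyDeg_eq_zero_of_neg {n : ℤ} (hn : n < 0) (t : polyDeg k r n) : t = 0 := by
  refine Subtype.ext (MvPolynomial.ext _ _ fun d => ?_)
  by_contra hd
  have := t.2 hd
  rw [Finsupp.weight_apply, Finsupp.sum] at this
  have : (0 : ℤ) ≤ n := by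
    rw [← this]
    exact Finset.sum_nonneg fun i _ => by simp
  omega

lemma polyDeg_zero_eq_smul (t : polyDeg k r 0) : ∃ c : k, t = c • polyOne k r := by
  refine ⟨t.1.coeff 0, Subtype.ext (MvPolynomial.ext _ _ fun d => ?_)⟩
  change _ = MvPolynomial.coeff d (t.1.coeff 0 • (1 : MvPolynomial (Fin r) k))
  by_cases hd : d = 0
  · subst hd
    simp
  · rw [MvPolynomial.coeff_smul, MvPolynomial.coeff_one, if_neg (Ne.symm hd), smul_zero]
    by_contra h
    have := t.2 h
    rw [Finsupp.weight_apply, Finsupp.sum] at this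
    refine hd (Finsupp.ext fun i => ?_)
    by_contra hi
    have h1 := (Finset.sum_eq_zero_iff_of_nonneg (fun i _ => by simp)).1 this i
      (Finsupp.mem_support_iff.2 hi)
    simp at h1
    exact hi h1

lemma tensor_polyDeg_eq_zero_of_neg {Λ : Type*} [CommRing Λ] [Algebra k Λ] {n : ℤ} (hn : n < 0)
    (x : Λ ⊗[k] polyDeg k r n) : x = 0 := by
  induction x with
  | zero => rfl
  | add x y hx hy => rw [hx, hy, add_zero]
  | tmul a t => rw [polyDeg_eq_zero_of_neg hn t, TensorProduct.tmul_zero]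

end PolyOperators

/-! ### Cohomology of J. -/

section KoszulExact

variable {k : Type u} [Field k] {r : ℕ} {Λ : Type u} [CommRing Λ] [Algebra k Λ] {z : Fin r → Λ}
  (b : Module.Basis (Finset (Fin r)) k Λ)

/-- The contraction of the complex `Λ ⊗ S` in the direction `j`. -/
def koszulHomotopy (j : Fin r) {n m : ℤ} (h : n + 1 = m) :
    Λ ⊗[k] polyDeg k r m →ₗ[k] Λ ⊗[k] polyDeg k r n :=
  TensorProduct.map (zDeriv b j) (polyDiv j h)

variable (z) in
/-- The projection which remains after the contraction in the direction `j`. -/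
def koszulProj (j : Fin r) (n : ℤ) : Λ ⊗[k] polyDeg k r n →ₗ[k] Λ ⊗[k] polyDeg k r n :=
  TensorProduct.map (LinearMap.mulLeft k (z j) ∘ₗ zDeriv b j) (polyMod j n)

variable (k) in
lemma add_self_eq_zero_of_charTwo [CharP k 2] {V : Type*} [AddCommGroup V] [Module k V] (v : V) :
    v + v = 0 := by
  rw [← two_smul k, CharTwo.two_eq_zero, zero_smul]

variable (hb : ∀ I, b I = ∏ i ∈ I, z i) (hz : ∀ i, z i * z i = 0) [CharP k 2]
include hb hz

/-- Let h_j be ∂_j ⊗ (division by x_j). For i ≠ j it commutes with z_i ⊗ x_i, and the two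
compositions cancel in characteristic 2. For i = j, the remainder term completes z_j∂_j ⊗ x_j(·/x_j)
to z_j∂_j ⊗ 1, and z_j∂_j + ∂_jz_j = 1. So h_j is a homotopy from the identity to `koszulProj`, not
to zero. -/
lemma koszulHomotopy_comm (j : Fin r) {l n m : ℤ} (h : l + 1 = n) (h' : n + 1 = m)
    (x : Λ ⊗[k] polyDeg k r n) :
    mulδ z h (koszulHomotopy b j h x) + koszulHomotopy b j h' (mulδ z h' x) +
      koszulProj z b j n x = x := by
  induction x with
  | zero => simp
  | add x y hx hy =>
    refine Eq.trans ?_ (congrArg₂ (· + ·) hx hy)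
    simp only [map_add]
    abel
  | tmul a t =>
    simp only [koszulHomotopy, koszulProj, TensorProduct.map_tmul, mulδ_tmul, map_sum,
      LinearMap.comp_apply, LinearMap.mulLeft_apply]
    rw [← Finset.sum_add_distrib, Finset.sum_eq_single j]
    · rw [polyDiv_var_mul]
      conv_rhs => rw [← zDeriv_z_mul_self b hb hz j a, TensorProduct.add_tmul,
        ← var_mul_polyDiv j h ((add_comm 1 l).trans h) t, TensorProduct.tmul_add,
        TensorProduct.tmul_add, ← TensorProduct.tmul_add, var_mul_polyDiv]
      abel
    · intro i _ hij
      rw [zDeriv_z_mul_of_ne b hb hz hij, polyDiv_var_mul_of_ne hij h h' _ ((add_comm 1 l).trans h)]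
      exact add_self_eq_zero_of_charTwo k _
    · simp

/-- The complex `Λ ⊗ S` is exact in nonzero degrees. -/
lemma koszul_exact {l n m : ℤ} (h : l + 1 = n) (h' : n + 1 = m) (hn : n ≠ 0)
    (x : Λ ⊗[k] polyDeg k r n) (hx : mulδ z h' x = 0) : ∃ y, mulδ z h y = x := by
  -- The directions are contracted one at a time: modulo boundaries, x is replaced by a cycle
  -- without the variables x_j, j ∈ s.
  have key : ∀ s : Finset (Fin r), ∃ x' : Λ ⊗[k] polyDeg k r n, ∃ y, mulδ z h' x' = 0 ∧
      mulδ z h y + x' = x ∧ ∀ j ∈ s, (polyMod j n).lTensor Λ x' = x' := by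
    intro s
    induction s using Finset.induction_on with
    | empty => exact ⟨x, 0, hx, by simp, by simp⟩
    | insert j s hj ih =>
      obtain ⟨x', y, h₁, h₂, h₃⟩ := ih
      have e := koszulHomotopy_comm b hb hz j h h' x'
      rw [h₁, map_zero, add_zero] at e
      refine ⟨koszulProj z b j n x', y + koszulHomotopy b j h x', ?_, ?_, ?_⟩
      · have := congrArg (mulδ z h') e
        rw [map_add, ← LinearMap.comp_apply, mulδ_mulδ z hz, LinearMap.zero_apply, zero_add,
          h₁] at this
        exact this
      · rw [map_add, add_assoc, e, h₂]
      · intro i hi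
        have hc : (polyMod i n).lTensor Λ (koszulProj z b j n x') = TensorProduct.map
            (LinearMap.mulLeft k (z j) ∘ₗ zDeriv b j) (polyMod i n ∘ₗ polyMod j n) x' := by
          rw [koszulProj, LinearMap.lTensor, ← LinearMap.comp_apply, ← TensorProduct.map_comp,
            LinearMap.id_comp]
        rw [hc]
        -- The projection for j removes x_j, and because remainders commute it does not reintroduce
        -- variables already removed.
        obtain rfl | hi := Finset.mem_insert.1 hi
        · rw [polyMod_idem]
          rfl
        · rw [polyMod_comm]
          conv_rhs => rw [← h₃ i hi]
          rw [koszulProj, LinearMap.lTensor, ← LinearMap.comp_apply, ← TensorProduct.map_comp,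
            LinearMap.comp_id]
  obtain ⟨x', y, -, h₂, h₃⟩ := key Finset.univ
  refine ⟨y, ?_⟩
  -- No variable is left, and the degree is not zero.
  have : x' = 0 := eq_zero_of_tensorCoord b fun I => eq_zero_of_polyMod hn fun j => by
    rw [← tensorCoord_lTensor, h₃ j (Finset.mem_univ _)]
  rw [← h₂, this, add_zero]

/-- The kernel of the differential `Λ ⊗ S^0 ⟶ Λ ⊗ S^1` is spanned by `σ ⊗ 1`. -/
lemma koszul_ker_zero {m : ℤ} (h : 0 + 1 = m) (x : Λ ⊗[k] polyDeg k r 0) (hx : mulδ z h x = 0) :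
    ∃ c : k, x = c • (b Finset.univ ⊗ₜ polyOne k r) := by
  have hzx : ∀ j, z j • x = 0 := by
    intro j
    -- The homotopy lands in degree −1, where J vanishes, so x equals its projection for j. That
    -- projection is a multiple of z_j, hence is killed by z_j; so x lies in the socle.
    have e := koszulHomotopy_comm b hb hz j (neg_add_cancel 1) h x
    rw [hx, map_zero, add_zero, tensor_polyDeg_eq_zero_of_neg (by norm_num)
      (koszulHomotopy b j (neg_add_cancel 1) x), map_zero, zero_add] at e
    have hp : ∀ y, z j • koszulProj z b j 0 y = 0 := by
      intro y
      induction y with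
      | zero => simp
      | add x y hx hy => rw [map_add, smul_add, hx, hy, add_zero]
      | tmul a t =>
        rw [koszulProj, TensorProduct.map_tmul, TensorProduct.smul_tmul', LinearMap.comp_apply,
          LinearMap.mulLeft_apply, smul_eq_mul, ← mul_assoc, hz, zero_mul, TensorProduct.zero_tmul]
    rw [← e, hp]
  obtain ⟨c, hc⟩ := polyDeg_zero_eq_smul (tensorCoord b _ Finset.univ x)
  refine ⟨c, ?_⟩
  rw [eq_socle_tmul b hb hz hzx, hc, TensorProduct.tmul_smul]

end KoszulExact

/-! ### An elementwise criterion for quasi-isomorphisms over a field. -/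

section QuasiIsoCriterion

variable {k : Type u} [Field k]

/-- Vector spaces are projective. This turns elementwise choices into linear ones, so the
refinements in the homology criteria below can be taken along identities. -/
lemma exists_lift_of_range_le {X Y Z : Type*} [AddCommGroup X] [Module k X] [AddCommGroup Y]
    [Module k Y] [AddCommGroup Z] [Module k Z] (f : X →ₗ[k] Z) (g : Y →ₗ[k] Z)
    (h : ∀ x, ∃ y, g y = f x) : ∃ l : X →ₗ[k] Y, g ∘ₗ l = f := by
  obtain ⟨l, hl⟩ := Module.projective_lifting_property g.rangeRestrict
    (f.codRestrict (LinearMap.range g) h) g.surjective_rangeRestrict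
  exact ⟨l, LinearMap.ext fun x => congrArg Subtype.val (LinearMap.congr_fun hl x)⟩

/-- A morphism of complexes of vector spaces is a quasi-isomorphism if it is bijective on
cohomology classes, expressed in terms of elements. -/
lemma quasiIso_of_elements {X Y : CochainComplex (ModuleCat.{u} k) ℤ} (φ : X ⟶ Y)
    (hinj : ∀ (l n m : ℤ), l + 1 = n → n + 1 = m → ∀ (x : X.X n) (y : Y.X l),
      (X.d n m).hom x = 0 → (φ.f n).hom x = (Y.d l n).hom y → ∃ x', (X.d l n).hom x' = x)
    (hsurj : ∀ (l n m : ℤ), l + 1 = n → n + 1 = m → ∀ (y : Y.X n), (Y.d n m).hom y = 0 →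
      ∃ (x : X.X n) (y' : Y.X l), (X.d n m).hom x = 0 ∧
        (φ.f n).hom x + (Y.d l n).hom y' = y) : QuasiIso φ := by
  rw [quasiIso_iff]
  intro n
  rw [quasiIsoAt_iff_isIso_homologyMap]
  have hn : n - 1 + 1 = n := sub_add_cancel n 1
  have : Mono (HomologicalComplex.homologyMap φ n) := by
    rw [HomologicalComplex.mono_homologyMap_iff_up_to_refinements φ (n - 1) n (n + 1)
      (by simp) (by simp)]
    intro A x₂ hx₂ y₁ hy₁
    obtain ⟨l, hl⟩ := exists_lift_of_range_le x₂.hom (X.d (n - 1) n).hom fun a =>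
      hinj _ n _ hn rfl (x₂.hom a) (y₁.hom a) (LinearMap.congr_fun (congrArg ModuleCat.Hom.hom hx₂) a)
        (LinearMap.congr_fun (congrArg ModuleCat.Hom.hom hy₁) a)
    exact ⟨A, 𝟙 A, inferInstance, ModuleCat.ofHom l, by
      rw [Category.id_comp]
      exact ModuleCat.hom_ext hl.symm⟩
  have : Epi (HomologicalComplex.homologyMap φ n) := by
    rw [HomologicalComplex.epi_homologyMap_iff_up_to_refinements φ (n - 1) n (n + 1)
      (by simp) (by simp)]
    intro A y₂ hy₂
    let K := LinearMap.ker (X.d n (n + 1)).hom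
    -- The cycle and the correcting boundary must be chosen together, so the lift is taken along a
    -- map out of their product.
    obtain ⟨l, hl⟩ := exists_lift_of_range_le y₂.hom
      (LinearMap.coprod ((φ.f n).hom ∘ₗ K.subtype) (Y.d (n - 1) n).hom) fun a => by
        obtain ⟨x, y', hx, e⟩ := hsurj _ n _ hn rfl (y₂.hom a)
          (LinearMap.congr_fun (congrArg ModuleCat.Hom.hom hy₂) a)
        exact ⟨(⟨x, hx⟩, y'), e⟩
    refine ⟨A, 𝟙 A, inferInstance,
      ModuleCat.ofHom (K.subtype ∘ₗ LinearMap.fst k K (Y.X (n - 1)) ∘ₗ l), ?_,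
      ModuleCat.ofHom (LinearMap.snd k K (Y.X (n - 1)) ∘ₗ l), ?_⟩
    · exact ModuleCat.hom_ext (LinearMap.ext fun a => (l a).1.2)
    · rw [Category.id_comp]
      exact ModuleCat.hom_ext hl.symm
  exact isIso_of_mono_of_epi _

end QuasiIsoCriterion

/-! ### Cocycles in Hom(J, M) that vanish at σ ⊗ 1 are coboundaries. -/

section Extension

variable {Λ : Type u} [CommRing Λ]

/-- The map f factors through A / ker d, which embeds in B; injectivity extends it from there. -/
lemma exists_extension_of_ker_le {A B I : ModuleCat.{u} Λ} [Injective I] (d : A ⟶ B) (f : A ⟶ I)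
    (h : ∀ x, d.hom x = 0 → f.hom x = 0) : ∃ g : B ⟶ I, d ≫ g = f := by
  let K := LinearMap.ker d.hom
  let d' : ModuleCat.of Λ (A ⧸ K) ⟶ B := ModuleCat.ofHom (K.liftQ d.hom le_rfl)
  let f' : ModuleCat.of Λ (A ⧸ K) ⟶ I := ModuleCat.ofHom (K.liftQ f.hom h)
  have : Mono d' := by
    rw [ModuleCat.mono_iff_injective]
    exact LinearMap.ker_eq_bot.1 (K.ker_liftQ_eq_bot _ _ le_rfl)
  refine ⟨Injective.factorThru f' d', ModuleCat.hom_ext (LinearMap.ext fun x => ?_)⟩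
  exact LinearMap.congr_fun (congrArg ModuleCat.Hom.hom (Injective.comp_factorThru f' d'))
    (K.mkQ x)

lemma δ_v_of_charTwo (k : Type u) [Field k] [CharP k 2] {C : Type*} [Category* C] [Preadditive C]
    [Linear k C] {F G : CochainComplex C ℤ} {n m : ℤ} (h : n + 1 = m)
    (c : Cochain F G n) (p q : ℤ) (hpq : p + m = q) (q₁ p₁ : ℤ) (hq₁ : p + n = q₁)
    (hp₁ : p + 1 = p₁) : (δ n m c).v p q hpq =
      c.v p q₁ hq₁ ≫ G.d q₁ q + F.d p p₁ ≫ c.v p₁ q (by omega) := by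
  rw [δ_v n m h c p q hpq q₁ p₁ (by omega) hp₁, units_smul_hom' (k := k)]

variable {k : Type u} [Field k] [CharP k 2] [Algebra k Λ] {r : ℕ} {z : Fin r → Λ} (b : Module.Basis (Finset (Fin r)) k Λ)
  (hb : ∀ I, b I = ∏ i ∈ I, z i) (hz : ∀ i, z i * z i = 0)

/-- The element `σ ⊗ 1` of `J^0`, where `σ` is the product of the `z_i`. -/
def socleElt : Λ ⊗[k] polyDeg k r 0 := b Finset.univ ⊗ₜ polyOne k r

lemma bggJ_d_apply {n m : ℤ} (h : n + 1 = m) (x : Λ ⊗[k] polyDeg k r n) :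
    ((bggJ (k := k) z hz).d n m).hom x = mulδ z h x := by
  have : (bggJ (k := k) z hz).d n m = ModuleCat.ofHom (mulδ z h) := dif_pos h
  rw [this]
  rfl

include hb hz in
omit [CharP k 2] in
lemma mulδ_socleElt {m : ℤ} (h : 0 + 1 = m) : mulδ z h (socleElt b) = 0 := by
  rw [socleElt, mulδ_tmul]
  refine Finset.sum_eq_zero fun i _ => ?_
  rw [z_mul_socle b hb hz, TensorProduct.zero_tmul]

variable {M : CochainComplex (ModuleCat.{u} Λ) ℤ} [∀ n, Injective (M.X n)]

include hb in
-- One step of the obstruction argument. A cocycle w vanishing below degree m kills the boundaries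
-- in J^m, hence the cycles: by exactness if m > 0, and by `hw₀` if m = 0. So w factors through d in
-- degree m as d ≫ g, and subtracting the coboundary of g, placed in degree m + 1, moves the
-- vanishing one degree up.
lemma cocycle_extension_step {n n' : ℤ} (hn : n' + 1 = n) (m : ℕ)
    (w : Cochain (bggJ (k := k) z hz) M n) (hw : δ n (n + 1) w = 0)
    (hw₀ : m = 0 → ∀ (q : ℤ) (hq : 0 + n = q), (w.v 0 q hq).hom (socleElt b) = 0)
    (hwm : ∀ (p q : ℤ) (hpq : p + n = q), p < m → w.v p q hpq = 0) :
    ∃ g : (bggJ (k := k) z hz).X (m + 1) ⟶ M.X (m + n),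
      ∀ (p q : ℤ) (hpq : p + n = q), p < (m + 1 : ℕ) →
        (w - δ n' n (Cochain.single g n')).v p q hpq = 0 := by
  have hker : ∀ x : Λ ⊗[k] polyDeg k r m, mulδ z rfl x = 0 →
      (w.v m (m + n) rfl).hom x = 0 := by
    intro x hx
    obtain rfl | hm := eq_or_ne m 0
    · obtain ⟨c, rfl⟩ := koszul_ker_zero b hb hz rfl x hx
      have e := hw₀ rfl
      have hc : c • (b Finset.univ ⊗ₜ[k] polyOne k r) = algebraMap k Λ c • socleElt b :=
        (algebraMap_smul Λ c _).symm
      rw [hc]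
      refine (map_smul (w.v ((0 : ℕ) : ℤ) _ rfl).hom _ _).trans ?_
      have e' : (w.v ((0 : ℕ) : ℤ) (((0 : ℕ) : ℤ) + n) rfl).hom (socleElt b) = 0 := by
        exact e (((0 : ℕ) : ℤ) + n) rfl
      rw [e', smul_zero]
    · obtain ⟨y, rfl⟩ := koszul_exact b hb hz (sub_add_cancel (m : ℤ) 1) rfl (by exact_mod_cast hm) x hx
      -- The cocycle condition in degree m − 1, where w vanishes, says that w kills the image of d
      -- in J^m.
      have e := Cochain.congr_v hw ((m : ℤ) - 1) (m + n) (by ring)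
      rw [δ_v_of_charTwo k rfl w _ _ _ ((m : ℤ) - 1 + n) m rfl (by ring),
        hwm _ _ _ (by omega), zero_comp, zero_add, Cochain.zero_v] at e
      rw [← bggJ_d_apply hz]
      exact LinearMap.congr_fun (congrArg ModuleCat.Hom.hom e) y
  obtain ⟨g, hg⟩ := exists_extension_of_ker_le ((bggJ (k := k) z hz).d m (m + 1))
    (w.v m (m + n) rfl) fun x hx => hker x (by rwa [bggJ_d_apply hz rfl] at hx)
  refine ⟨g, fun p q hpq hp => ?_⟩
  rw [Cochain.sub_v, δ_v_of_charTwo k hn _ p q hpq (p + n') (p + 1) rfl rfl,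
    Cochain.single_v_eq_zero _ _ p _ _ (by push_cast at hp; omega), zero_comp, zero_add]
  obtain hp | rfl := lt_or_eq_of_le (show p ≤ m by push_cast at hp; omega)
  · rw [hwm _ _ _ hp, Cochain.single_v_eq_zero _ _ _ _ _ (by omega), comp_zero, sub_zero]
  · obtain rfl := hpq
    rw [Cochain.single_v, hg, sub_self]

include hb in
/-- A cocycle in `Hom(J, M)` which vanishes at `σ ⊗ 1` is the coboundary of a cochain which
vanishes on `J^0`. -/
lemma exists_δ_eq_of_vanish {n n' : ℤ} (hn : n' + 1 = n)
    (u : Cochain (bggJ (k := k) z hz) M n) (hu : δ n (n + 1) u = 0)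
    (hu₀ : (u.v 0 n (zero_add n)).hom (socleElt b) = 0) :
    ∃ c : Cochain (bggJ (k := k) z hz) M n', δ n' n c = u ∧ c.v 0 n' (zero_add n') = 0 := by
  -- Approximate solutions of stage m: the error u − δc vanishes below degree m.
  let X : ℕ → Set (Cochain (bggJ (k := k) z hz) M n') := fun m =>
    {c | c.v 0 n' (zero_add n') = 0 ∧
      ∀ (p q : ℤ) (hpq : p + n = q), p < m → (u - δ n' n c).v p q hpq = 0}
  -- The correction lives only in degree m + 1, so c is unchanged up to degree m and the corrections
  -- converge.
  have step : ∀ (m : ℕ) (c : X m), ∃ c' : X (m + 1), c'.1.EqUpTo c.1 (0 + m) := by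
    rintro m ⟨c, hc₀, hc⟩
    obtain ⟨g, hg⟩ := cocycle_extension_step b hb hz hn m (u - δ n' n c)
      (by rw [δ_sub, hu, δ_δ, sub_zero])
      -- The error still vanishes at σ ⊗ 1: c is zero on J^0 and d(σ ⊗ 1) = 0, so δc vanishes there.
      (fun _ q hq => by
        obtain rfl : n = q := (zero_add n).symm.trans hq
        rw [Cochain.sub_v, δ_v_of_charTwo k hn _ 0 n (zero_add n) n' 1 (zero_add n') rfl,
          hc₀, zero_comp, zero_add]
        change (u.v 0 n _).hom (socleElt b) -
          (c.v 1 n _).hom (((bggJ (k := k) z hz).d 0 1).hom (socleElt b)) = 0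
        rw [hu₀, bggJ_d_apply hz (zero_add 1), mulδ_socleElt b hb hz, map_zero, sub_zero]) hc
    refine ⟨⟨c + Cochain.single g n', ?_, fun p q hpq hp => ?_⟩, fun p q hpq hp => ?_⟩
    · rw [Cochain.add_v, hc₀, Cochain.single_v_eq_zero _ _ _ _ _ (by omega), zero_add]
    · rw [δ_add, ← sub_sub]
      exact hg p q hpq hp
    · rw [Cochain.add_v, Cochain.single_v_eq_zero _ _ _ _ _ (by omega), add_zero]
  choose φ hφ using step
  -- The zero cochain is of stage 0 because J has no terms in negative degrees. This is where
  -- boundedness of J replaces any boundedness of M.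
  let x₀ : X 0 := ⟨0, by rw [Cochain.zero_v], fun p q hpq hp => by
    refine ModuleCat.hom_ext (LinearMap.ext fun x => ?_)
    rw [show x = 0 from tensor_polyDeg_eq_zero_of_neg hp x, map_zero, map_zero]⟩
  let c := Cochain.InductionUp.limitSequence φ hφ x₀
  have hc : ∀ m : ℕ, c.EqUpTo (Cochain.InductionUp.sequence φ x₀ m).1 (0 + m) :=
    Cochain.InductionUp.limitSequence_eqUpTo φ hφ x₀
  refine ⟨c, Cochain.ext _ _ fun p q hpq => ?_, ?_⟩
  -- In degree p, δc involves c in degrees p and p + 1. Stage `p.toNat + 1` already agrees with the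
  -- limit in both and has zero error at p, also when p is negative.
  · have h := (Cochain.InductionUp.sequence φ x₀ (p.toNat + 1)).2.2 p q hpq (by push_cast; omega)
    rw [Cochain.sub_v, sub_eq_zero] at h
    rw [h, δ_v_of_charTwo k hn _ p q hpq (p + n') (p + 1) rfl rfl,
      δ_v_of_charTwo k hn _ p q hpq (p + n') (p + 1) rfl rfl,
      hc (p.toNat + 1) p _ _ (by push_cast; omega), hc (p.toNat + 1) (p + 1) _ _ (by push_cast; omega)]
  · rw [hc 0 0 _ _ (by simp)]
    exact (Cochain.InductionUp.sequence φ x₀ 0).2.1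

end Extension

/-! ### Comparison of Hom(J, M) with the socle complex of M. -/

section Socle

variable {Λ : Type u} [CommRing Λ] {k : Type u} [Field k] [Algebra k Λ] {r : ℕ} {z : Fin r → Λ}
  (b : Module.Basis (Finset (Fin r)) k Λ) (hb : ∀ I, b I = ∏ i ∈ I, z i)
  (hz : ∀ i, z i * z i = 0)

include hb

/-- On elements annihilated by all `z_i`, the algebra `Λ` acts through the augmentation. -/
lemma smul_eq_of_annihilated {V : Type*} [AddCommGroup V] [Module Λ V] {v : V}
    (hv : ∀ i, z i • v = 0) (a : Λ) : a • v = algebraMap k Λ (b.coord ∅ a) • v := by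
  conv_lhs => rw [← b.sum_repr a]
  rw [Finset.sum_smul, Finset.sum_eq_single ∅]
  · rw [hb, Finset.prod_empty, Algebra.smul_def, mul_one]
    rfl
  · intro I _ hI
    obtain ⟨i, hi⟩ := Finset.nonempty_iff_ne_empty.2 hI
    rw [hb, ← Finset.prod_erase_mul I z hi, Algebra.smul_def, mul_smul, mul_smul, hv, smul_zero,
      smul_zero]
  · simp

include hz in
lemma z_smul_socleElt (i : Fin r) : z i • socleElt b = 0 := by
  rw [socleElt, TensorProduct.smul_tmul', smul_eq_mul, z_mul_socle b hb hz,
    TensorProduct.zero_tmul]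

omit hb in
lemma eq_zero_of_smul_socleElt {c : k} (h : algebraMap k Λ c • socleElt b = 0) : c = 0 := by
  rw [algebraMap_smul] at h
  have e := congrArg (tensorCoord b _ Finset.univ) h
  rw [map_smul, map_zero, socleElt, tensorCoord_tmul] at e
  have e' := congrArg (fun t : polyDeg k r 0 => t.1.coeff 0) e
  simpa [polyOne] using e'

variable [CharP k 2] {M : CochainComplex (ModuleCat.{u} Λ) ℤ}

/-- The value at `σ ⊗ 1` of an element of `Hom(J, M)`. -/
def evSocle {n : ℤ} (f : Cochain (bggJ (k := k) z hz) M n) : M.X n :=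
  (f.v 0 n (zero_add n)).hom (socleElt b)

omit hb in
lemma evSocle_sub {n : ℤ} (f g : Cochain (bggJ (k := k) z hz) M n) :
    evSocle b hz (f - g) = evSocle b hz f - evSocle b hz g := by
  rw [evSocle, Cochain.sub_v]
  rfl

lemma z_smul_evSocle {n : ℤ} (f : Cochain (bggJ (k := k) z hz) M n) (i : Fin r) :
    z i • evSocle b hz f = 0 := by
  rw [evSocle, ← map_smul]
  exact (congrArg _ (z_smul_socleElt b hb hz i)).trans (map_zero _)

/-- The term of δf involving f in degree 1 is evaluated at d(σ ⊗ 1) = 0. So evaluation is a chain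
map, with values in the socle by `z_smul_evSocle`. -/
lemma evSocle_δ {n m : ℤ} (h : n + 1 = m) (f : Cochain (bggJ (k := k) z hz) M n) :
    evSocle b hz (δ n m f) = (M.d n m).hom (evSocle b hz f) := by
  rw [evSocle, δ_v_of_charTwo k h f 0 m (zero_add m) n 1 (zero_add n) rfl]
  change _ + (f.v 1 m _).hom (((bggJ (k := k) z hz).d 0 1).hom (socleElt b)) = _
  rw [bggJ_d_apply hz (zero_add 1), mulδ_socleElt b hb hz, map_zero, add_zero]
  rfl

variable [∀ n, Injective (M.X n)]

/-- Extend σ ⊗ 1 ↦ m to a map on J^0 and view it as a cochain F concentrated there. Then δF is a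
cocycle whose value at σ ⊗ 1 is dm = 0, so δF = δc with c zero on J^0, and F − c is a cocycle that
still takes the value m. -/
lemma exists_cocycle_of_socle {n : ℤ} (m : M.X n) (hm : ∀ i, z i • m = 0)
    (hd : (M.d n (n + 1)).hom m = 0) :
    ∃ f : Cochain (bggJ (k := k) z hz) M n, δ n (n + 1) f = 0 ∧ evSocle b hz f = m := by
  obtain ⟨f₀, hf₀⟩ := exists_extension_of_ker_le (A := ModuleCat.of Λ Λ)
    (B := (bggJ (k := k) z hz).X 0) (ModuleCat.ofHom (LinearMap.toSpanSingleton Λ _ (socleElt b)))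
    -- The map is well defined: an element annihilating σ ⊗ 1 has augmentation zero, so it
    -- annihilates the socle element m.
    (ModuleCat.ofHom (LinearMap.toSpanSingleton Λ (M.X n) m)) (fun a ha => by
      change a • socleElt b = 0 at ha
      change a • m = 0
      have e := smul_eq_of_annihilated (V := Λ ⊗[k] polyDeg k r 0) b hb (z_smul_socleElt b hb hz) a
      rw [smul_eq_of_annihilated b hb hm, eq_zero_of_smul_socleElt b (e.symm.trans ha), map_zero,
        zero_smul])
  let F : Cochain (bggJ (k := k) z hz) M n := Cochain.single f₀ n
  have hF : evSocle b hz F = m := by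
    rw [evSocle, Cochain.single_v]
    have := LinearMap.congr_fun (congrArg ModuleCat.Hom.hom hf₀) (1 : Λ)
    change f₀.hom ((1 : Λ) • socleElt b) = (1 : Λ) • m at this
    rwa [one_smul, one_smul] at this
  obtain ⟨c, hc, hc₀⟩ := exists_δ_eq_of_vanish b hb hz rfl (δ n (n + 1) F) (δ_δ _ _ _ _)
    ((evSocle_δ b hb hz rfl F).trans (by rw [hF, hd]))
  refine ⟨F - c, by rw [δ_sub, hc, sub_self], ?_⟩
  rw [evSocle_sub, hF, evSocle, hc₀]
  exact sub_zero m

omit hb [∀ n, Injective (M.X n)] [CharP k 2] in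
/-- The cochains in the image of a morphism to a complex `Hom(F, M)`. -/
def homComplexValue {F : CochainComplex (ModuleCat.{u} Λ) ℤ} {X : CochainComplex (ModuleCat.{u} k) ℤ}
    (φ : X ⟶ homComplex k F M) (n : ℤ) : X.X n →+ Cochain F M n :=
  (φ.f n).hom.toAddMonoidHom

omit hb [∀ n, Injective (M.X n)] [CharP k 2] in
lemma δ_homComplexValue {F : CochainComplex (ModuleCat.{u} Λ) ℤ}
    {X : CochainComplex (ModuleCat.{u} k) ℤ} (φ : X ⟶ homComplex k F M) (n m : ℤ) (x : X.X n) :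
    δ n m (homComplexValue φ n x) = homComplexValue φ m ((X.d n m).hom x) :=
  LinearMap.congr_fun (congrArg ModuleCat.Hom.hom (φ.comm n m)) x

/-- A morphism `φ : X ⟶ Hom(J, M)` is a quasi-isomorphism if evaluation at `σ ⊗ 1` identifies
`X` with the socle of `M`. -/
lemma quasiIso_of_bijective_socle {X : CochainComplex (ModuleCat.{u} k) ℤ}
    (φ : X ⟶ homComplex k (bggJ (k := k) z hz) M)
    (hinj : ∀ (n : ℤ) (x y : X.X n),
      evSocle b hz (homComplexValue φ n x) = evSocle b hz (homComplexValue φ n y) → x = y)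
    (hsurj : ∀ (n : ℤ) (m : M.X n), (∀ i, z i • m = 0) →
      ∃ x, evSocle b hz (homComplexValue φ n x) = m) : QuasiIso φ := by
  have hev : ∀ (n m : ℤ) (_ : n + 1 = m) (x : X.X n),
      evSocle b hz (homComplexValue φ m ((X.d n m).hom x)) =
        (M.d n m).hom (evSocle b hz (homComplexValue φ n x)) := by
    intro n m h x
    rw [← evSocle_δ b hb hz h, δ_homComplexValue]
  have hev₀ : ∀ n, evSocle b hz (0 : Cochain (bggJ (k := k) z hz) M n) = 0 := fun n => rfl
  refine quasiIso_of_elements φ ?_ ?_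
  · intro l n m hl hn x y _ hxy
    obtain ⟨y, rfl⟩ : ∃ g : Cochain (bggJ (k := k) z hz) M l, g = y := ⟨y, rfl⟩
    have hxy : homComplexValue φ n x = δ l n y := hxy
    -- The cochain y need not lie in the image of φ, but its socle value is that of some x', and dx'
    -- = x can be tested on socle values.
    obtain ⟨x', hx'⟩ := hsurj l _ (z_smul_evSocle b hb hz y)
    refine ⟨x', hinj _ _ _ ?_⟩
    rw [hev _ _ hl, hx', hxy, evSocle_δ b hb hz hl y]
  · intro l n m hl hn f hf
    obtain rfl := hn
    obtain ⟨f, rfl⟩ : ∃ g : Cochain (bggJ (k := k) z hz) M n, g = f := ⟨f, rfl⟩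
    have hf : δ n (n + 1) f = 0 := hf
    obtain ⟨x, hx⟩ := hsurj n _ (z_smul_evSocle b hb hz f)
    have hdx : (X.d n (n + 1)).hom x = 0 := by
      refine hinj _ _ _ ?_
      rw [hev _ _ rfl, hx, map_zero, hev₀, ← evSocle_δ b hb hz rfl, hf, hev₀]
    -- The cocycle f and its candidate φ(x) agree at σ ⊗ 1, so they differ by a coboundary.
    obtain ⟨c, hc, -⟩ := exists_δ_eq_of_vanish b hb hz hl (f - homComplexValue φ n x)
      (by rw [δ_sub, hf, δ_homComplexValue, hdx, map_zero, sub_zero])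
      ((evSocle_sub b hz _ _).trans (by rw [hx, sub_self]))
    refine ⟨x, c, hdx, ?_⟩
    change homComplexValue φ n x + δ l n c = f
    rw [hc]
    exact add_sub_cancel _ _

/-- Realise the socle cycle as the value of a cocycle; a cochain bounding that cocycle has as its
value the required preimage. -/
lemma socle_exact_of_hom_exact {l n : ℤ} (hl : l + 1 = n)
    (h : ∀ f : Cochain (bggJ (k := k) z hz) M n, δ n (n + 1) f = 0 → ∃ c, δ l n c = f)
    (m : M.X n) (hm : ∀ i, z i • m = 0) (hd : (M.d n (n + 1)).hom m = 0) :
    ∃ m' : M.X l, (∀ i, z i • m' = 0) ∧ (M.d l n).hom m' = m := by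
  obtain ⟨f, hf, rfl⟩ := exists_cocycle_of_socle b hb hz m hm hd
  obtain ⟨c, rfl⟩ := h f hf
  exact ⟨evSocle b hz c, z_smul_evSocle b hb hz c, (evSocle_δ b hb hz hl c).symm⟩

end Socle

/-! ### Exactness on socles forces contractibility. -/

section Contractible

variable {Λ : Type u} [CommRing Λ]

/-- Every morphism from `T` to the cycles of `M` in degree `n` lifts along the differential. -/
def LiftsCycles (M : CochainComplex (ModuleCat.{u} Λ) ℤ) (l n : ℤ) (T : ModuleCat.{u} Λ) : Prop :=
  ∀ f : T ⟶ M.X n, f ≫ M.d n (n + 1) = 0 → ∃ g : T ⟶ M.X l, g ≫ M.d l n = f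

variable {M : CochainComplex (ModuleCat.{u} Λ) ℤ} [∀ n, Injective (M.X n)] {l n : ℤ}

/-- Lift on T', extend the lift to T by injectivity of M^l, and subtract. The remaining map to the
cycles vanishes on T', so it factors through T / T', where it can be lifted too. -/
lemma LiftsCycles.of_extension {T : ModuleCat.{u} Λ} (T' : Submodule Λ T)
    (h' : LiftsCycles M l n (ModuleCat.of Λ T'))
    (h'' : LiftsCycles M l n (ModuleCat.of Λ (T ⧸ T'))) : LiftsCycles M l n T := by
  intro f hf
  let i : ModuleCat.of Λ T' ⟶ T := ModuleCat.ofHom T'.subtype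
  let p : T ⟶ ModuleCat.of Λ (T ⧸ T') := ModuleCat.ofHom T'.mkQ
  have : Mono i := (ModuleCat.mono_iff_injective i).2 T'.injective_subtype
  have : Epi p := (ModuleCat.epi_iff_surjective p).2 T'.mkQ_surjective
  obtain ⟨g', hg'⟩ := h' (i ≫ f) (by rw [Category.assoc, hf, comp_zero])
  let g₁ : T ⟶ M.X l := Injective.factorThru g' i
  have hg₁ : i ≫ g₁ = g' := Injective.comp_factorThru g' i
  have hi : i ≫ (f - g₁ ≫ M.d l n) = 0 := by
    rw [Preadditive.comp_sub, reassoc_of% hg₁, hg', sub_self]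
  let f'' : ModuleCat.of Λ (T ⧸ T') ⟶ M.X n :=
    ModuleCat.ofHom (T'.liftQ (f - g₁ ≫ M.d l n).hom fun x hx =>
      LinearMap.congr_fun (congrArg ModuleCat.Hom.hom hi) (⟨x, hx⟩ : T'))
  have hf'' : p ≫ f'' = f - g₁ ≫ M.d l n := rfl
  obtain ⟨g'', hg''⟩ := h'' f'' (by
    rw [← cancel_epi p, reassoc_of% hf'', Preadditive.sub_comp, hf, Category.assoc,
      HomologicalComplex.d_comp_d, comp_zero, sub_zero, comp_zero])
  refine ⟨p ≫ g'' + g₁, ?_⟩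
  rw [Preadditive.add_comp, Category.assoc, hg'', hf'', sub_add_cancel]

variable {k : Type u} [Field k] [Algebra k Λ] {r : ℕ} {z : Fin r → Λ}
  (b : Module.Basis (Finset (Fin r)) k Λ) (hb : ∀ I, b I = ∏ i ∈ I, z i)

include hb

omit [∀ n, Injective (M.X n)] in
-- Such a T maps into the socle of M, and the lift can be chosen k-linear with values in the socle.
-- It is then Λ-linear, since on both sides Λ acts through the augmentation.
lemma LiftsCycles.of_annihilated
    (hM : ∀ m : M.X n, (∀ i, z i • m = 0) → (M.d n (n + 1)).hom m = 0 →
      ∃ m' : M.X l, (∀ i, z i • m' = 0) ∧ (M.d l n).hom m' = m)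
    {T : ModuleCat.{u} Λ} (hT : ∀ (i : Fin r) (t : T), z i • t = 0) : LiftsCycles M l n T := by
  intro f hf
  let _ : Module k T := Module.compHom T (algebraMap k Λ)
  let _ : Module k (M.X l) := Module.compHom (M.X l) (algebraMap k Λ)
  let _ : Module k (M.X n) := Module.compHom (M.X n) (algebraMap k Λ)
  have : IsScalarTower k Λ T := ⟨fun c a x => by rw [Algebra.smul_def, mul_smul]; rfl⟩
  have : IsScalarTower k Λ (M.X l) := ⟨fun c a x => by rw [Algebra.smul_def, mul_smul]; rfl⟩
  have : IsScalarTower k Λ (M.X n) := ⟨fun c a x => by rw [Algebra.smul_def, mul_smul]; rfl⟩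
  let S : Submodule k (M.X l) :=
    { carrier := {m | ∀ i, z i • m = 0}
      zero_mem' := fun i => smul_zero _
      add_mem' := fun {x y} hx hy i => by rw [smul_add, hx i, hy i, add_zero]
      smul_mem' := fun c x hx i => by
        change z i • (algebraMap k Λ c • x) = 0
        rw [smul_comm, hx i, smul_zero] }
  obtain ⟨g, hg⟩ := exists_lift_of_range_le (f.hom.restrictScalars k)
    ((M.d l n).hom.restrictScalars k ∘ₗ S.subtype) (fun t => by
      obtain ⟨m', h₁, h₂⟩ := hM (f.hom t) (fun i => by rw [← map_smul, hT, map_zero])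
        (LinearMap.congr_fun (congrArg ModuleCat.Hom.hom hf) t)
      exact ⟨⟨m', h₁⟩, h₂⟩)
  refine ⟨ModuleCat.ofHom ⟨⟨fun t => (g t).1, fun x y => by rw [map_add]; rfl⟩, fun a t => ?_⟩,
    ModuleCat.hom_ext (LinearMap.ext fun t => LinearMap.congr_fun hg t)⟩
  change (g (a • t)).1 = a • (g t).1
  rw [smul_eq_of_annihilated b hb (fun i => hT i t), smul_eq_of_annihilated b hb (g t).2]
  exact congrArg Subtype.val (map_smul g (b.coord ∅ a) t)

/-- Induction on the set of those z_i that may act nontrivially. Both z_jT and T / z_jT are killed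
by z_j, because z_j² = 0, and by every z_i that kills T. No finiteness of T is needed. -/
lemma liftsCycles_of_socle_exact (hz : ∀ i, z i * z i = 0)
    (hM : ∀ m : M.X n, (∀ i, z i • m = 0) → (M.d n (n + 1)).hom m = 0 →
      ∃ m' : M.X l, (∀ i, z i • m' = 0) ∧ (M.d l n).hom m' = m)
    (T : ModuleCat.{u} Λ) : LiftsCycles M l n T := by
  have key : ∀ (s : Finset (Fin r)) (T : ModuleCat.{u} Λ),
      (∀ i ∉ s, ∀ t : T, z i • t = 0) → LiftsCycles M l n T := by
    intro s
    induction s using Finset.induction_on with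
    | empty => exact fun T hT => .of_annihilated b hb hM fun i t => hT i (by simp) t
    | insert j s _ ih =>
      intro T hT
      refine .of_extension (LinearMap.range (LinearMap.lsmul Λ T (z j))) (ih _ ?_) (ih _ ?_)
      · rintro i hi ⟨_, t, rfl⟩
        refine Subtype.ext ?_
        change z i • (z j • t) = 0
        by_cases hij : i = j
        · rw [hij, smul_smul, hz, zero_smul]
        · rw [smul_comm, hT i (by simp [hij, hi]), smul_zero]
      · intro i hi t
        obtain ⟨t, rfl⟩ := Submodule.mkQ_surjective _ t
        rw [← map_smul]
        by_cases hij : i = j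
        · rw [hij]
          exact (Submodule.Quotient.mk_eq_zero _).2 ⟨t, rfl⟩
        · rw [hT i (by simp [hij, hi]), map_zero]
  exact key Finset.univ T fun i hi => (hi (Finset.mem_univ i)).elim

omit [∀ n, Injective (M.X n)] hb in
/-- A complex whose inclusions of cycles lift along the differential is contractible. -/
lemma nonempty_homotopy_id_zero
    (h : ∀ (l n : ℤ), l + 1 = n → LiftsCycles M l n (kernel (M.d n (n + 1)))) :
    Nonempty (Homotopy (𝟙 M) 0) := by
  -- The lifts s of the inclusions of the cycles split M: `p` is the resulting projection onto the
  -- cycles, and p followed by s is the contraction.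
  choose s hs using fun l n hl => h l n hl (kernel.ι _) (kernel.condition _)
  let e (n m : ℤ) : M.X n ⟶ kernel (M.d m (m + 1)) :=
    kernel.lift _ (M.d n m) (M.d_comp_d _ _ _)
  have he : ∀ n m, e n m ≫ kernel.ι _ = M.d n m := fun n m => kernel.lift_ι _ _ _
  let p (n : ℤ) : M.X n ⟶ kernel (M.d n (n + 1)) :=
    kernel.lift _ (𝟙 _ - e n (n + 1) ≫ s n (n + 1) rfl) (by
      rw [Preadditive.sub_comp, Category.assoc, hs, he, Category.id_comp, sub_self])
  have hp : ∀ n, p n ≫ kernel.ι _ = 𝟙 _ - e n (n + 1) ≫ s n (n + 1) rfl :=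
    fun n => kernel.lift_ι _ _ _
  have hdp : ∀ n, M.d n (n + 1) ≫ p (n + 1) = e n (n + 1) := by
    intro n
    rw [← cancel_mono (kernel.ι _), Category.assoc, hp, he, Preadditive.comp_sub, Category.comp_id]
    have : M.d n (n + 1) ≫ e (n + 1) (n + 1 + 1) = 0 := by
      rw [← cancel_mono (kernel.ι _), Category.assoc, he, M.d_comp_d, zero_comp]
    rw [reassoc_of% this, zero_comp, sub_zero]
  let c : Cochain M M (-1) := Cochain.mk fun n l hl => p n ≫ s l n (by omega)
  refine ⟨(Cochain.equivHomotopy _ _).symm ⟨c, Cochain.ext₀ _ _ fun n => ?_⟩⟩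
  rw [Cochain.add_v, Cochain.ofHom_v, Cochain.ofHom_v, δ_v (-1) 0 (neg_add_cancel 1) c n n
    (add_zero n) (n - 1) (n + 1) (by omega) rfl]
  -- Here c ≫ d contributes 1 − e ≫ s and d ≫ c contributes e ≫ s, with sum 1.
  simp only [c, Cochain.mk_v, Category.assoc, hs, hp, reassoc_of% (hdp n)]
  simp

end Contractible

/-! ### Hom(J, -) detects zero objects. -/

section Acyclic

variable {Λ : Type u} [CommRing Λ] {k : Type u} [Field k] [Algebra k Λ] {r : ℕ} {z : Fin r → Λ}
  (b : Module.Basis (Finset (Fin r)) k Λ) (hb : ∀ I, b I = ∏ i ∈ I, z i)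
  (hz : ∀ i, z i * z i = 0) [CharP k 2]

include b hb in
/-- A complex `M` of injective modules with `Hom(J, M)` acyclic is contractible. -/
lemma isZero_of_acyclic_homJ (M : HomotopyCategory (InjectiveObject (ModuleCat.{u} Λ)) (.up ℤ))
    (h : (HomotopyCategory.subcategoryAcyclic (ModuleCat.{u} k)).inverseImage
      (DGModule.htpyForget (polyDG k r))
      (((InjectiveObject.ι (ModuleCat.{u} Λ)).mapHomotopyCategory (ComplexShape.up ℤ) ⋙
        homJHtpy (k := k) z hz).obj M)) : IsZero M := by
  obtain ⟨M⟩ := M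
  let N := ((InjectiveObject.ι (ModuleCat.{u} Λ)).mapHomologicalComplex (ComplexShape.up ℤ)).obj M
  have hN : ∀ n, Injective (N.X n) := fun n => (M.X n).2
  have hex : (homComplex k (bggJ (k := k) z hz) N).Acyclic :=
    (HomotopyCategory.quotient_obj_mem_subcategoryAcyclic_iff_acyclic
      (homComplex k (bggJ (k := k) z hz) N)).1 h
  have hex' : ∀ (l n : ℤ) (_ : l + 1 = n) (f : Cochain (bggJ (k := k) z hz) N n),
      δ n (n + 1) f = 0 → ∃ c, δ l n c = f := by
    intro l n hl f hf
    have := hex n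
    rw [HomologicalComplex.exactAt_iff' _ l n (n + 1) (by simp; omega) (by simp),
      ShortComplex.moduleCat_exact_iff] at this
    exact this f hf
  obtain ⟨H⟩ := nonempty_homotopy_id_zero (M := N) fun l n hl =>
    liftsCycles_of_socle_exact b hb hz (fun m hm hd =>
      socle_exact_of_hom_exact b hb hz hl (hex' l n hl) m hm hd) _
  let F := (InjectiveObject.ι (ModuleCat.{u} Λ)).mapHomologicalComplex (ComplexShape.up ℤ)
  -- The contraction was found among complexes of all modules; it descends because injective modules
  -- form a full subcategory.
  exact (HomotopyCategory.isZero_quotient_obj_iff M).2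
    ⟨(InjectiveObject.ι (ModuleCat.{u} Λ)).preimageHomotopy
      ((Homotopy.ofEq (F.map_id M)).trans (H.trans (Homotopy.ofEq (F.map_zero M M).symm)))⟩

end Acyclic

/-! ### The functor Hom(F, -) commutes with mapping cones. -/

section HomCone

open DGModule CochainComplex.mappingCone

variable {k : Type u} [Field k] {C : Type*} [Category.{u} C] [Preadditive C] [Linear k C]
  [HasBinaryBiproducts C] (F : CochainComplex C ℤ) {M N : CochainComplex C ℤ} (f : M ⟶ N)

omit [HasBinaryBiproducts C] in
lemma postcomp_zero (K : CochainComplex C ℤ) {L : CochainComplex C ℤ} {n : ℤ} :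
    postcomp (k := k) F (0 : Cochain K L n) = 0 :=
  cochain_ext_apply fun i _ h x => Cochain.comp_zero (show Cochain F K i from x) h

/-- The canonical morphism from the cone of `Hom(F, f)` to `Hom(F, cone f)`. -/
def homConeDesc : CochainComplex.mappingCone (homComplexMap (k := k) F f) ⟶
    homComplex k F (CochainComplex.mappingCone f) :=
  desc (homComplexMap F f) (postcomp F (inl f)) (homComplexMap F (inr f)) (by
    rw [δ_postcomp (neg_add_cancel 1), δ_inl, Cochain.ofHom_comp, Cochain.ofHom_comp,
      postcomp_comp, ofHom_homComplexMap, ofHom_homComplexMap])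

/-- The canonical morphism from `Hom(F, cone f)` to the cone of `Hom(F, f)`. -/
def homConeLift : homComplex k F (CochainComplex.mappingCone f) ⟶
    CochainComplex.mappingCone (homComplexMap (k := k) F f) :=
  lift (homComplexMap F f)
    (Cocycle.mk (postcomp F (fst f).1) 2 (by norm_num) (by
      rw [δ_postcomp (by norm_num), (fst f).δ_eq_zero]
      exact postcomp_zero F _))
    (postcomp F (snd f)) (by
      rw [δ_postcomp (zero_add 1), δ_snd]
      change _ + (postcomp (k := k) F (fst f).1).comp _ _ = 0
      rw [ofHom_homComplexMap, ← postcomp_comp, ← postcomp_add, neg_add_cancel]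
      exact postcomp_zero F _)

lemma homConeLift_desc : homConeLift (k := k) F f ≫ homConeDesc F f = 𝟙 _ := by
  apply Cochain.ofHom_injective
  rw [Cochain.ofHom_comp, homConeLift, homConeDesc, ofHom_lift, ofHom_desc,
    liftCochain_descCochain _ _ _ _ _ _ _ _ (by norm_num)]
  change (postcomp (k := k) F (fst f).1).comp _ _ + _ = _
  rw [ofHom_homComplexMap, ← postcomp_comp, ← postcomp_comp, ← postcomp_add, CochainComplex.mappingCone.id, postcomp_id]

lemma homConeDesc_lift : homConeDesc (k := k) F f ≫ homConeLift F f = 𝟙 _ := by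
  apply Cochain.ofHom_injective
  rw [Cochain.ofHom_comp, homConeLift, homConeDesc, ofHom_lift, ofHom_desc,
    ext_cochain_from_iff _ (-1) 0 (by norm_num)]
  constructor
  · rw [← Cochain.comp_assoc_of_third_is_zero_cochain, inl_descCochain]
    change (postcomp (k := k) F (inl f)).comp ((postcomp (k := k) F (fst f).1).comp (inl _) _ +
      (postcomp (k := k) F (snd f)).comp _ _) _ = _
    rw [Cochain.comp_add, ← Cochain.comp_assoc _ _ _ (neg_add_cancel 1) (by norm_num) (by norm_num),
      ← postcomp_comp, inl_fst, postcomp_id, Cochain.id_comp,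
      ← Cochain.comp_assoc_of_second_is_zero_cochain, ← postcomp_comp, inl_snd, postcomp_zero,
      Cochain.zero_comp, add_zero, Cochain.comp_id]
  · rw [← Cochain.comp_assoc_of_third_is_zero_cochain, inr_descCochain, ofHom_homComplexMap]
    change (postcomp (k := k) F (Cochain.ofHom (inr f))).comp
      ((postcomp (k := k) F (fst f).1).comp (inl _) _ +
        (postcomp (k := k) F (snd f)).comp _ _) _ = _
    rw [Cochain.comp_add, ← Cochain.comp_assoc_of_first_is_zero_cochain,
      ← postcomp_comp, inr_fst, postcomp_zero, Cochain.zero_comp, zero_add,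
      ← Cochain.comp_assoc_of_second_is_zero_cochain, ← postcomp_comp, inr_snd, postcomp_id,
      Cochain.id_comp, Cochain.comp_id]

lemma inr_homConeDesc : inr (homComplexMap (k := k) F f) ≫ homConeDesc F f =
    homComplexMap F (inr f) := inr_desc _ _ _ _

/-- Both connecting maps are minus the first projection of a cone, and the shift isomorphism merely
undoes the shift of the target. -/
lemma homConeLift_mor₃ :
    homComplexMap (k := k) F (CochainComplex.mappingCone.triangle f).mor₃ ≫
      (homComplexShiftIso k F M 1).hom =
    homConeLift F f ≫ (CochainComplex.mappingCone.triangle (homComplexMap (k := k) F f)).mor₃ := by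
  refine HomologicalComplex.hom_ext _ _ fun n => ModuleCat.hom_ext (LinearMap.ext fun x => ?_)
  obtain ⟨x, rfl⟩ : ∃ g : Cochain F (CochainComplex.mappingCone f) n, g = x := ⟨x, rfl⟩
  have e₂ : (homConeLift (k := k) F f).f n ≫ (fst (homComplexMap (k := k) F f)).1.v n (n + 1) rfl =
      (postcomp F (fst f).1).v n (n + 1) rfl := lift_f_fst_v _ _ _ _ _ _ _
  have e₃ : (CochainComplex.mappingCone.triangle (homComplexMap (k := k) F f)).mor₃.f n =
      -(fst (homComplexMap (k := k) F f)).1.v n (n + 1) rfl := by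
    have := Cochain.congr_v (Cocycle.cochain_ofHom_homOf_eq_coe
      ((-fst (homComplexMap (k := k) F f)).rightShift 1 0 (zero_add 1))) n n (add_zero n)
    rw [Cochain.ofHom_v] at this
    refine this.trans ((Cochain.rightShift_v _ 1 0 (zero_add 1) n n (add_zero n) (n + 1) rfl).trans ?_)
    exact Category.comp_id _
  change (x.comp (Cochain.ofHom (Cocycle.homOf ((-fst f).rightShift 1 0 (zero_add 1))))
    (add_zero n)).rightUnshift (n + 1) rfl = _
  rw [Cocycle.cochain_ofHom_homOf_eq_coe, Cocycle.rightShift_coe, Cochain.rightUnshift_comp _ _ (add_zero n) (n + 1) rfl 1 (zero_add 1), Cochain.rightUnshift_rightShift]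
  refine Eq.trans ?_ (LinearMap.congr_fun (congrArg ModuleCat.Hom.hom
    (congrArg (fun t => (homConeLift (k := k) F f).f n ≫ t) e₃)) x).symm
  refine Eq.trans ?_ (LinearMap.congr_fun (congrArg ModuleCat.Hom.hom
    ((Preadditive.comp_neg _ _).trans (congrArg Neg.neg e₂))) x).symm
  exact Cochain.comp_neg _ _ _

end HomCone

/-! ### Exactness of Hom(J, -). -/

section HomJTriangle

open DGModule CochainComplex.mappingCone

variable {k : Type u} [Field k] {r : ℕ} {Λ : Type u} [CommRing Λ] [Algebra k Λ] (z : Fin r → Λ)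
  [CharP k 2] (hz : ∀ i, z i * z i = 0) {M N : CochainComplex (ModuleCat.{u} Λ) ℤ} (f : M ⟶ N)

/-- The isomorphism between `Hom(J, cone f)` and the cone of `Hom(J, f)`. -/
def homJConeIso : (homJFunctor (k := k) z hz).obj (CochainComplex.mappingCone f) ≅
    cone ((homJFunctor (k := k) z hz).map f) :=
  isoMk ⟨homConeLift _ f, homConeDesc _ f, homConeLift_desc _ f, homConeDesc_lift _ f⟩
    (lift_linear ((homJFunctor (k := k) z hz).map f) _ _ _
      (homJ_postcomp_linear z hz (fst f).1) (homJ_postcomp_linear z hz (snd f)))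

lemma homJConeIso_comm₂ : (homJFunctor (k := k) z hz).map (inr f) ≫ (homJConeIso z hz f).hom =
    coneInr ((homJFunctor (k := k) z hz).map f) := by
  rw [← Iso.eq_comp_inv]
  exact hom_ext (inr_homConeDesc _ f).symm

lemma homJConeIso_comm₃ :
    (homJFunctor (k := k) z hz).map (CochainComplex.mappingCone.triangle f).mor₃ ≫
      ((homJFunctor (k := k) z hz).commShiftIso (1 : ℤ)).hom.app M =
    (homJConeIso z hz f).hom ≫ coneδ ((homJFunctor (k := k) z hz).map f) :=
  hom_ext (homConeLift_mor₃ _ f)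

/-- The functor `Hom(J, -)` sends standard triangles to standard triangles. -/
def homJTriangleIso : (homJFunctor (k := k) z hz).mapTriangle.obj
    (CochainComplex.mappingCone.triangle f) ≅ coneTriangle ((homJFunctor (k := k) z hz).map f) :=
  Triangle.isoMk _ _ (Iso.refl _) (Iso.refl _) (homJConeIso z hz f)
    ((Category.comp_id _).trans (Category.id_comp _).symm)
    ((homJConeIso_comm₂ z hz f).trans (Category.id_comp _).symm)
    ((comp_id_aux _ ((shiftFunctor (DGModule (polyDG k r)) (1 : ℤ)).map_id _)).trans
      (homJConeIso_comm₃ z hz f))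

/-- The functor `Hom(J, -)` on homotopy categories is induced by the functor on complexes. -/
def homJHtpyFactors : HomotopyCategory.quotient (ModuleCat.{u} Λ) (ComplexShape.up ℤ) ⋙
    homJHtpy (k := k) z hz ≅ homJFunctor (k := k) z hz ⋙ htpyQuotient (polyDG k r) :=
  CategoryTheory.Quotient.lift.isLift _ _ _

-- The shift structure on homotopy categories was obtained by descent; this compatibility lets
-- triangles be compared through the quotient functors.
instance : NatTrans.CommShift (homJHtpyFactors (k := k) z hz).hom ℤ :=
  CategoryTheory.Quotient.liftCommShift_compatibility
    (homJFunctor (k := k) z hz ⋙ htpyQuotient (polyDG k r)) _ ℤ _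

/-- The functor `Hom(J, -)` on homotopy categories sends standard triangles to standard
triangles. -/
def homJTrianglehIso : (homJHtpy (k := k) z hz).mapTriangle.obj
    (CochainComplex.mappingCone.triangleh f) ≅
      coneTriangleh ((homJFunctor (k := k) z hz).map f) :=
  (Functor.mapTriangleCompIso (HomotopyCategory.quotient _ _) (homJHtpy (k := k) z hz)).symm.app
      (CochainComplex.mappingCone.triangle f) ≪≫
    (Functor.mapTriangleIso (homJHtpyFactors (k := k) z hz)).app
      (CochainComplex.mappingCone.triangle f) ≪≫
    (Functor.mapTriangleCompIso (homJFunctor (k := k) z hz) (htpyQuotient _)).app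
      (CochainComplex.mappingCone.triangle f) ≪≫
    (htpyQuotient _).mapTriangle.mapIso (homJTriangleIso z hz f)

instance : (homJHtpy (k := k) z hz).IsTriangulated where
  map_distinguished := by
    rintro T ⟨M, N, f, ⟨e⟩⟩
    exact ⟨_, _, _, ⟨(homJHtpy (k := k) z hz).mapTriangle.mapIso e ≪≫ homJTrianglehIso z hz f⟩⟩

/-- The inclusion of injective complexes, Hom(J, -) and the localization functor are each exact. -/
lemma homJInj_isTriangulated : (homJInj (k := k) z hz).IsTriangulated := by
  infer_instance

end HomJTriangle

/-! ### The left adjoint N ↦ J ⊗_S N = Λ ⊗ N. -/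

section LeftAdjoint

open DGModule
open scoped ModuleCat

variable {k : Type u} [Field k] {r : ℕ} {Λ : Type u} [CommRing Λ] [Algebra k Λ] (z : Fin r → Λ)
  (N : DGModule (polyDG k r))

namespace DGModule

variable {N} in
/-- The action of an element of the polynomial ring on a differential graded `S`-module. -/
def polyAct {p : ℤ} (s : polyDeg k r p) (q n : ℤ) (h : q + p = n) : N.X.X q →ₗ[k] N.X.X n :=
  ((N.act p s).v q n h).hom

variable {N}

lemma polyAct_mul {p q n : ℤ} (h : p + q = n) (s : polyDeg k r p) (t : polyDeg k r q)
    (i j l : ℤ) (hij : i + q = j) (hjl : j + p = l) (hil : i + n = l) (v : N.X.X i) :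
    polyAct (polyMul h s t) i l hil v = polyAct s j l hjl (polyAct t i j hij v) := by
  have e := Cochain.congr_v (N.act_mul h s t) i l hil
  rw [Cochain.comp_v _ _ ((add_comm q p).trans h) i j l hij hjl] at e
  exact LinearMap.congr_fun (congrArg ModuleCat.Hom.hom e) v

lemma polyAct_one (i : ℤ) (h : i + 0 = i) (v : N.X.X i) : polyAct (polyOne k r) i i h v = v := by
  have e := Cochain.congr_v N.act_one i i h
  rw [Cochain.ofHom_v] at e
  exact LinearMap.congr_fun (congrArg ModuleCat.Hom.hom e) v

/-- S has zero differential, so the Leibniz rule says that its action commutes with d up to a sign,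
and signs are trivial here. -/
lemma polyAct_d [CharP k 2] {p : ℤ} (s : polyDeg k r p) (i j i' j' : ℤ) (h : i + p = j)
    (h' : i' + p = j') (hi : i + 1 = i') (_ : j + 1 = j') (v : N.X.X i) :
    (N.X.d j j').hom (polyAct s i j h v) = polyAct s i' j' h' ((N.X.d i i').hom v) := by
  have e := Cochain.congr_v (N.leibniz s) i j' (by omega)
  rw [δ_v_of_charTwo k rfl _ i j' (by omega) j i' h hi] at e
  have e' := LinearMap.congr_fun (congrArg ModuleCat.Hom.hom e) v
  have e'' : ((N.act (p + 1) ((polyDG k r).X.d p (p + 1) s)).v i j' (by omega)).hom v = 0 := by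
    have : (polyDG k r).X.d p (p + 1) s = 0 := rfl
    rw [this, map_zero, Cochain.zero_v]
    rfl
  have e₃ := e'.trans e''
  have e₄ := add_self_eq_zero_of_charTwo k (polyAct s i' j' h' ((N.X.d i i').hom v))
  exact add_right_cancel (e₃.trans e₄.symm)

end DGModule

/-- The differential of `Λ ⊗ N`: the sum of the differential of `N` and multiplication by
`∑ z_i ⊗ x_i`. -/
def bggLd (n m : ℤ) (h : n + 1 = m) : Λ ⊗[k] N.X.X n →ₗ[Λ] Λ ⊗[k] N.X.X m :=
  (N.X.d n m).hom.baseChange Λ + ∑ i, z i • (polyAct (polyVar k r i) n m h).baseChange Λ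

lemma bggLd_tmul (n m : ℤ) (h : n + 1 = m) (a : Λ) (v : N.X.X n) :
    bggLd z N n m h (a ⊗ₜ[k] v) = a ⊗ₜ (N.X.d n m).hom v +
      ∑ i, (z i * a) ⊗ₜ polyAct (polyVar k r i) n m h v := by
  simp [bggLd, LinearMap.sum_apply, TensorProduct.smul_tmul']

variable [CharP k 2] (hz : ∀ i, z i * z i = 0)

include hz in
-- Expand (d + δ)². The mixed terms cancel in characteristic 2 because d commutes with each x_i. In
-- δ² the terms for (i, j) and (j, i) cancel, and the diagonal vanishes by z_i² = 0.
lemma bggLd_bggLd (n m l : ℤ) (h : n + 1 = m) (h' : m + 1 = l) (x : Λ ⊗[k] N.X.X n) :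
    bggLd z N m l h' (bggLd z N n m h x) = 0 := by
  induction x with
  | zero => simp
  | add x y hx hy => rw [map_add, map_add, hx, hy, add_zero]
  | tmul a v =>
    have hd : (N.X.d m l).hom ((N.X.d n m).hom v) = 0 :=
      LinearMap.congr_fun (congrArg ModuleCat.Hom.hom (N.X.d_comp_d n m l)) v
    have e : ∀ i j, polyAct (polyVar k r j) m l h' (polyAct (polyVar k r i) n m h v) =
        polyAct (polyMul (n := 2) (by norm_num) (polyVar k r j) (polyVar k r i)) n l (by omega) v :=
      fun i j => (polyAct_mul _ _ _ _ _ _ _ _ _ _).symm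
    rw [bggLd_tmul, map_add, bggLd_tmul, hd, TensorProduct.tmul_zero, zero_add, map_sum]
    simp only [bggLd_tmul, Finset.sum_add_distrib]
    rw [← add_assoc, ← Finset.sum_add_distrib]
    simp only [polyAct_d _ n m m l h h' h h', add_self_eq_zero_of_charTwo k,
      Finset.sum_const_zero, zero_add, e]
    rw [← Finset.sum_product']
    refine Finset.sum_involution (fun p _ => p.swap) ?_ ?_ (by simp) (by simp)
    · rintro ⟨i, j⟩ _
      have hs : polyMul (n := 2) (by norm_num) (polyVar k r i) (polyVar k r j) =
        polyMul (by norm_num) (polyVar k r j) (polyVar k r i) := Subtype.ext (mul_comm _ _)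
      simp only [Prod.swap, hs, ← mul_assoc, mul_comm (z j) (z i)]
      exact add_self_eq_zero_of_charTwo k _
    · rintro ⟨i, j⟩ _ hne heq
      obtain rfl : j = i := congrArg Prod.fst heq
      exact hne (by simp only [← mul_assoc, hz, zero_mul, TensorProduct.zero_tmul])

/-- The complex `J ⊗_S N = Λ ⊗ N`. -/
abbrev bggL : CochainComplex (ModuleCat.{u} Λ) ℤ where
  X n := ModuleCat.of Λ (Λ ⊗[k] N.X.X n)
  d n m := if h : n + 1 = m then ModuleCat.ofHom (bggLd z N n m h) else 0
  shape n m h := dif_neg h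
  d_comp_d' n m l h h' := by
    have h : n + 1 = m := h
    have h' : m + 1 = l := h'
    rw [dif_pos h, dif_pos h', ← ModuleCat.ofHom_comp]
    exact ModuleCat.hom_ext (LinearMap.ext fun x => bggLd_bggLd z N hz n m l h h' x)

lemma bggL_d (n m : ℤ) (h : n + 1 = m) :
    (bggL z N hz).d n m = ModuleCat.ofHom (bggLd z N n m h) := dif_pos h

variable {N} in
/-- For `v ∈ N^q`, the map `J ⟶ Λ ⊗ N` of degree `q` which sends `a ⊗ s` to `a ⊗ s v`. -/
def bggUnitFun {q : ℤ} (v : N.X.X q) : Cochain (bggJ (k := k) z hz) (bggL z N hz) q :=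
  Cochain.mk fun p n h => ModuleCat.ofHom (LinearMap.baseChange Λ
    { toFun := fun s : polyDeg k r p => polyAct s q n ((add_comm q p).trans h) v
      map_add' := fun s t => by
        simp only [polyAct, map_add, Cochain.add_v]
        rfl
      map_smul' := fun c s => by
        simp only [polyAct, map_smul, Cochain.smul_v]
        rfl })

variable {N} in
lemma bggUnitFun_v_tmul {q : ℤ} (v : N.X.X q) (p n : ℤ) (h : p + q = n) (a : Λ)
    (s : polyDeg k r p) : ((bggUnitFun z hz v).v p n h).hom (a ⊗ₜ[k] s) =
      a ⊗ₜ polyAct s q n ((add_comm q p).trans h) v := rfl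

omit [CharP k 2] in
/-- Two maps from `Λ ⊗ V` agree if they agree on pure tensors. -/
lemma moduleCat_hom_ext_tensor {V : Type u} [AddCommGroup V] [Module k V] {P : ModuleCat.{u} Λ}
    {f g : ModuleCat.of Λ (Λ ⊗[k] V) ⟶ P}
    (h : ∀ (a : Λ) (v : V), f.hom (a ⊗ₜ[k] v) = g.hom (a ⊗ₜ[k] v)) : f = g := by
  refine ModuleCat.hom_ext (LinearMap.ext fun x => ?_)
  induction x using TensorProduct.induction_on with
  | zero => rw [map_zero, map_zero]
  | add x y hx hy => exact (map_add _ _ _).trans ((congrArg₂ _ hx hy).trans (map_add _ _ _).symm)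
  | tmul a v => exact h a v

lemma bggUnitFun_add {q : ℤ} (v w : N.X.X q) :
    bggUnitFun z hz (v + w) = bggUnitFun z hz v + bggUnitFun z hz w :=
  Cochain.ext _ _ fun p n h => moduleCat_hom_ext_tensor fun a s => by
    rw [Cochain.add_v]
    change _ = a ⊗ₜ[k] _ + a ⊗ₜ[k] _
    rw [bggUnitFun_v_tmul, map_add, TensorProduct.tmul_add]
    rfl

lemma bggUnitFun_smul {q : ℤ} (c : k) (v : N.X.X q) :
    bggUnitFun z hz (c • v) = c • bggUnitFun z hz v :=
  Cochain.ext _ _ fun p n h => moduleCat_hom_ext_tensor fun a s => by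
    rw [Cochain.smul_v, bggUnitFun_v_tmul, map_smul, TensorProduct.tmul_smul]
    exact (algebraMap_smul Λ c _).symm

lemma δ_bggUnitFun {q q' : ℤ} (hq : q + 1 = q') (v : N.X.X q) :
    δ q q' (bggUnitFun z hz v) = bggUnitFun z hz ((N.X.d q q').hom v) :=
  Cochain.ext _ _ fun p n h => moduleCat_hom_ext_tensor fun a s => by
    have hn : p + q + 1 = n := by omega
    rw [δ_v_of_charTwo k hq _ p n h (p + q) (p + 1) rfl rfl, bggUnitFun_v_tmul, bggL_d z N hz _ _ hn,
      show (bggJ (k := k) z hz).d p (p + 1) = ModuleCat.ofHom (mulδ z rfl) from dif_pos rfl]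
    change bggLd z N (p + q) n hn (a ⊗ₜ polyAct s q (p + q) (add_comm q p) v) +
      ((bggUnitFun z hz v).v (p + 1) n (show p + 1 + q = n by omega)).hom (mulδ z rfl (a ⊗ₜ[k] s)) = _
    rw [bggLd_tmul, mulδ_tmul, map_sum, add_assoc, ← Finset.sum_add_distrib,
      Finset.sum_eq_zero, add_zero, polyAct_d s q (p + q) q' n _ _ hq hn]
    intro i _
    rw [bggUnitFun_v_tmul, polyAct_mul _ _ _ q (p + q) n (add_comm q p) hn]
    exact add_self_eq_zero_of_charTwo k _

/-- The unit `N ⟶ Hom(J, J ⊗_S N)`. -/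
def bggUnit : N ⟶ (homJFunctor (k := k) z hz).obj (bggL z N hz) where
  hom :=
    { f := fun q => ModuleCat.ofHom
        { toFun := fun v => bggUnitFun z hz v
          map_add' := bggUnitFun_add z N hz
          map_smul' := bggUnitFun_smul z N hz }
      comm' := fun q q' hq => ModuleCat.hom_ext (LinearMap.ext fun v => δ_bggUnitFun z N hz hq v) }
  linear := by
    intro p m h s
    obtain rfl : m = p := by omega
    rw [units_smul_cochain (k := k)]
    refine cochain_ext_apply fun q n hq v => ?_
    rw [Cochain.comp_zero_cochain_v, Cochain.zero_cochain_comp_v, Cochain.ofHom_v, Cochain.ofHom_v]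
    change bggUnitFun z hz (polyAct s q n hq v) =
      (zetaFun z hz s).comp (bggUnitFun z hz v) ((add_comm m q).trans hq)
    refine Cochain.ext _ _ fun i j hij => moduleCat_hom_ext_tensor fun a t => ?_
    rw [Cochain.comp_v _ _ ((add_comm m q).trans hq) i (i + m) j rfl (by omega), bggUnitFun_v_tmul]
    change _ = a ⊗ₜ polyAct (polyMul _ s t) q j _ v
    rw [show polyMul ((add_comm m i).trans rfl) s t = polyMul rfl t s from Subtype.ext (mul_comm _ _),
      polyAct_mul _ t s q n j hq (by omega)]

/-- The element `1 ⊗ 1` of `J^0`. -/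
def bggGen : Λ ⊗[k] polyDeg k r 0 := 1 ⊗ₜ polyOne k r

variable {N} {M : CochainComplex (ModuleCat.{u} Λ) ℤ}

/-- The value of a cochain at `1 ⊗ 1`. -/
def evGen (n : ℤ) : Cochain (bggJ (k := k) z hz) M n →ₗ[k] M.X n where
  toFun f := (f.v 0 n (zero_add n)).hom bggGen
  map_add' f g := by
    rw [Cochain.add_v]
    rfl
  map_smul' c f := by
    rw [Cochain.smul_v]
    rfl

/-- The map `Λ ⊗ N ⟶ M` corresponding to a map `N ⟶ Hom(J, M)`. -/
def bggDesc {n : ℤ} (c : Cochain N.X (homComplex k (bggJ (k := k) z hz) M) n) :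
    Cochain (bggL z N hz) M n :=
  Cochain.mk fun q m h => ModuleCat.ofHom
    (LinearMap.liftBaseChange Λ (evGen z hz m ∘ₗ (c.v q m h).hom))

lemma bggDesc_v_tmul {n : ℤ} (c : Cochain N.X (homComplex k (bggJ (k := k) z hz) M) n)
    (q m : ℤ) (h : q + n = m) (a : Λ) (v : N.X.X q) :
    ((bggDesc z hz c).v q m h).hom (a ⊗ₜ[k] v) = a • evGen z hz m ((c.v q m h).hom v) :=
  LinearMap.liftBaseChange_tmul Λ _ _ _

/-- The map `N ⟶ Hom(J, M)` corresponding to a map `Λ ⊗ N ⟶ M`. -/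
def bggTranspose {n : ℤ} (d : Cochain (bggL z N hz) M n) :
    Cochain N.X (homComplex k (bggJ (k := k) z hz) M) n :=
  (Cochain.ofHom (bggUnit z N hz).hom).comp (postcomp _ d) (zero_add n)

lemma bggTranspose_v_apply {n : ℤ} (d : Cochain (bggL z N hz) M n) (q m : ℤ) (h : q + n = m)
    (v : N.X.X q) : ((bggTranspose z hz d).v q m h).hom v = (bggUnitFun z hz v).comp d h := by
  rw [bggTranspose, Cochain.zero_cochain_comp_v, Cochain.ofHom_v]
  rfl

/-- With the next lemma this is tensor-hom adjunction for cochains of every degree. Here Λ-linearity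
of d suffices, as Λ ⊗ N is generated over Λ by the elements 1 ⊗ v. -/
lemma bggDesc_transpose {n : ℤ} (d : Cochain (bggL z N hz) M n) :
    bggDesc z hz (bggTranspose z hz d) = d :=
  Cochain.ext _ _ fun q m h => moduleCat_hom_ext_tensor fun a v => by
    rw [bggDesc_v_tmul, bggTranspose_v_apply]
    change a • (((bggUnitFun z hz v).comp d h).v 0 m (zero_add m)).hom bggGen = _
    rw [Cochain.comp_v _ _ h 0 q m (zero_add q) h]
    change a • (d.v q m h).hom ((1 : Λ) ⊗ₜ polyAct (polyOne k r) q q _ v) = _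
    rw [polyAct_one, ← map_smul]
    change (d.v q m h).hom (a • ((1 : Λ) ⊗ₜ[k] v)) = _
    rw [TensorProduct.smul_tmul', smul_eq_mul, mul_one]

/-- This direction needs S-linearity: it gives c(v)(a ⊗ s) = a · c(sv)(1 ⊗ 1), so c is determined by
its values at 1 ⊗ 1. -/
lemma bggTranspose_desc {n : ℤ} (c : Cochain N.X (homComplex k (bggJ (k := k) z hz) M) n)
    (hc : IsLinear N (homJ (k := k) z hz M) c) : bggTranspose z hz (bggDesc z hz c) = c := by
  refine cochain_ext_apply fun q m h v => ?_
  rw [bggTranspose_v_apply]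
  obtain ⟨f, hf⟩ : ∃ f : Cochain (bggJ (k := k) z hz) M m, f = (c.v q m h).hom v := ⟨_, rfl⟩
  rw [← hf]
  refine Cochain.ext _ _ fun i j hij => moduleCat_hom_ext_tensor fun a s => ?_
  rw [Cochain.comp_v _ _ h i (i + q) j rfl (by omega)]
  change ((bggDesc z hz c).v (i + q) j _).hom (a ⊗ₜ polyAct s q (i + q) _ v) = _
  rw [bggDesc_v_tmul]
  have e := Cochain.congr_v (hc i (i + n) rfl s) q j (by omega)
  rw [units_smul_cochain (k := k), Cochain.comp_v _ _ rfl q (i + q) j (add_comm q i) (by omega),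
    Cochain.comp_v _ _ (add_comm n i) q m j h (by omega)] at e
  have e' : (c.v (i + q) j (by omega)).hom (polyAct s q (i + q) (add_comm q i) v) =
    (zetaFun z hz s).comp f hij := (LinearMap.congr_fun (congrArg ModuleCat.Hom.hom e) v).trans
      (by rw [hf]; rfl)
  rw [e']
  change a • (((zetaFun z hz s).comp f hij).v 0 j (zero_add j)).hom bggGen = _
  rw [Cochain.comp_v _ _ hij 0 i j (zero_add i) hij]
  change a • (f.v i j hij).hom ((1 : Λ) ⊗ₜ polyMul _ s (polyOne k r)) = _
  rw [← map_smul]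
  change (f.v i j hij).hom (a • ((1 : Λ) ⊗ₜ[k] polyMul _ s (polyOne k r))) = _
  rw [TensorProduct.smul_tmul', smul_eq_mul, mul_one]
  congr 3
  exact Subtype.ext (mul_one _)

lemma bggTranspose_injective {n : ℤ} {d d' : Cochain (bggL z N hz) M n}
    (h : bggTranspose z hz d = bggTranspose z hz d') : d = d' := by
  rw [← bggDesc_transpose z hz d, h, bggDesc_transpose]

lemma bggTranspose_add {n : ℤ} (d d' : Cochain (bggL z N hz) M n) :
    bggTranspose z hz (d + d') = bggTranspose z hz d + bggTranspose z hz d' := by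
  rw [bggTranspose, postcomp_add, Cochain.comp_add]
  rfl

lemma δ_bggTranspose {n m : ℤ} (h : n + 1 = m) (d : Cochain (bggL z N hz) M n) :
    δ n m (bggTranspose z hz d) = bggTranspose z hz (δ n m d) := by
  rw [bggTranspose, δ_ofHom_comp, δ_postcomp h]
  rfl

lemma bggTranspose_ofHom (f : bggL z N hz ⟶ M) : bggTranspose z hz (Cochain.ofHom f) =
    Cochain.ofHom (DGModule.Hom.hom (bggUnit z N hz ≫ (homJFunctor (k := k) z hz).map f)) := by
  rw [bggTranspose, comp_hom, Cochain.ofHom_comp, ← ofHom_homComplexMap]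

/-- Transposition is injective and commutes with δ, so the cochain corresponding to a chain map is a
cocycle of degree 0. -/
lemma exists_bggUnit_comp_eq (g : N ⟶ (homJFunctor (k := k) z hz).obj M) :
    ∃ f : bggL z N hz ⟶ M, bggUnit z N hz ≫ (homJFunctor (k := k) z hz).map f = g := by
  have e := bggTranspose_desc z hz (Cochain.ofHom g.hom) g.linear
  have hd : δ 0 1 (bggDesc z hz (Cochain.ofHom g.hom)) = 0 := by
    refine bggTranspose_injective z hz ?_
    rw [← δ_bggTranspose z hz (zero_add 1), e, δ_ofHom, bggTranspose, postcomp_zero,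
      Cochain.comp_zero]
  refine ⟨Cocycle.homOf (Cocycle.mk _ 1 (zero_add 1) hd), hom_ext (Cochain.ofHom_injective ?_)⟩
  rw [← bggTranspose_ofHom, Cocycle.cochain_ofHom_homOf_eq_coe]
  exact e

/-- The same adjunction in degree −1: S-linear homotopies between transposes come from homotopies.
-/
lemma nonempty_homotopy_of_bggUnit_comp {f f' : bggL z N hz ⟶ M}
    (h : homotopic _ (bggUnit z N hz ≫ (homJFunctor (k := k) z hz).map f)
      (bggUnit z N hz ≫ (homJFunctor (k := k) z hz).map f')) : Nonempty (Homotopy f f') := by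
  obtain ⟨c, hc, e⟩ := h
  refine ⟨(Cochain.equivHomotopy _ _).symm ⟨bggDesc z hz c, bggTranspose_injective z hz ?_⟩⟩
  rw [bggTranspose_add, ← δ_bggTranspose z hz (neg_add_cancel 1), bggTranspose_desc z hz c hc,
    bggTranspose_ofHom, bggTranspose_ofHom, e]

end LeftAdjoint

/-! ### Adjunctions that become equivalences after localization. -/

section Localization

variable {C D : Type*} [Category C] [Category D]

/-- A right adjoint whose unit lies in `W` and which sends only isomorphisms to `W` induces an
equivalence with the localization at `W`. -/
lemma isEquivalence_comp_localization_of_adjunction {L : D ⥤ C} {H : C ⥤ D} (adj : L ⊣ H)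
    (W : MorphismProperty D) [W.HasTwoOutOfThreeProperty] [W.ContainsIdentities] [W.RespectsIso]
    (h₁ : ∀ N, W (adj.unit.app N)) (h₂ : ∀ {X Y : C} (f : X ⟶ Y), W (H.map f) → IsIso f) :
    (H ⋙ W.Q).IsEquivalence := by
  -- By the triangle identity, H(ε) is a one-sided inverse of a unit component in W, so it lies in W
  -- and ε is invertible.
  have hε : ∀ Y, IsIso (adj.counit.app Y) := fun Y => h₂ _ (by
    refine W.of_precomp _ _ (h₁ (H.obj Y)) ?_
    rw [adj.right_triangle_components]
    exact W.id_mem _)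
  have : IsIso adj.counit := NatIso.isIso_of_isIso_app _
  have : H.Full := adj.fullyFaithfulROfIsIsoCounit.full
  have : H.Faithful := adj.fullyFaithfulROfIsIsoCounit.faithful
  -- By naturality of the unit and two-out-of-three, f lies in W exactly when H(L f) does. So W
  -- consists of the maps inverted by L, which is therefore itself a localization at W, as H is
  -- fully faithful.
  have hW : W = (MorphismProperty.isomorphisms C).inverseImage L := by
    ext X Y f
    have e : f ≫ adj.unit.app Y = adj.unit.app X ≫ H.map (L.map f) := adj.unit.naturality f
    constructor
    · intro hf
      refine h₂ _ (W.of_precomp _ _ (h₁ X) ?_)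
      rw [← e]
      exact W.comp_mem _ _ hf (h₁ Y)
    · intro hf
      have : IsIso (L.map f) := hf
      refine W.of_postcomp _ _ (h₁ Y) ?_
      rw [e]
      exact W.comp_mem _ _ (h₁ X) (W.of_isIso _)
  have : L.IsLocalization W := hW ▸ adj.isLocalization
  -- Identifying the localization with C through L turns H ⋙ W.Q into H ⋙ L, which the counit
  -- identifies with the identity.
  let e : (H ⋙ W.Q) ⋙ (Localization.uniq W.Q L W).functor ≅ 𝟭 C :=
    Functor.associator _ _ _ ≪≫ Functor.isoWhiskerLeft H (Localization.compUniqFunctor W.Q L W) ≪≫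
      asIso adj.counit
  have : ((H ⋙ W.Q) ⋙ (Localization.uniq W.Q L W).functor).IsEquivalence :=
    Functor.isEquivalence_of_iso e.symm
  exact Functor.isEquivalence_of_comp_right _ (Localization.uniq W.Q L W).functor

/-- A variant of `isEquivalence_comp_localization_of_adjunction` for a functor with universal
arrows. -/
lemma isEquivalence_comp_localization_of_universal (H : C ⥤ D) (F : D → C)
    (η : ∀ N, N ⟶ H.obj (F N))
    (hη : ∀ (N : D) (Y : C), Function.Bijective fun f : F N ⟶ Y => η N ≫ H.map f)
    (W : MorphismProperty D) [W.HasTwoOutOfThreeProperty] [W.ContainsIdentities] [W.RespectsIso]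
    (h₁ : ∀ N, W (η N)) (h₂ : ∀ {X Y : C} (f : X ⟶ Y), W (H.map f) → IsIso f) :
    (H ⋙ W.Q).IsEquivalence := by
  refine isEquivalence_comp_localization_of_adjunction (Adjunction.adjunctionOfEquivLeft
    (fun N Y => Equiv.ofBijective _ (hη N Y)) (fun N Y Y' g h => by simp)) W (fun N => ?_) h₂
  simpa [Adjunction.adjunctionOfEquivLeft] using h₁ N

end Localization

/-! ### Quasi-isomorphisms from socles, and the equivalence. -/

section Equivalence

open DGModule
open scoped ModuleCat

variable {k : Type u} [Field k] {r : ℕ} {Λ : Type u} [CommRing Λ] [Algebra k Λ] {z : Fin r → Λ}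
  [CharP k 2] (b : Module.Basis (Finset (Fin r)) k Λ) (hb : ∀ I, b I = ∏ i ∈ I, z i)
  (hz : ∀ i, z i * z i = 0)
  (hΛ : ∀ (V : Type u) [AddCommGroup V] [Module k V], Injective (ModuleCat.of Λ (Λ ⊗[k] V)))

include b hb hΛ in
-- Followed by evaluation at σ ⊗ 1, the unit is v ↦ σ ⊗ v, a bijection onto the socle of Λ ⊗ N.
lemma quasiIso_bggUnit (N : DGModule (polyDG k r)) : QuasiIso (bggUnit z N hz).hom := by
  have : ∀ n, Injective ((bggL z N hz).X n) := fun n => hΛ _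
  have hev : ∀ (n : ℤ) (v : N.X.X n), evSocle b hz
      (homComplexValue (M := bggL z N hz) (bggUnit z N hz).hom n v) = b Finset.univ ⊗ₜ[k] v := by
    intro n v
    change b Finset.univ ⊗ₜ[k] polyAct (polyOne k r) n n _ v = _
    rw [polyAct_one]
  refine quasiIso_of_bijective_socle b hb hz (M := bggL z N hz) _ (fun n v w h => ?_)
    (fun n m hm => ?_)
  · rw [hev, hev] at h
    have e := congrArg (tensorCoord b _ Finset.univ) h
    rw [tensorCoord_tmul, tensorCoord_tmul] at e
    simpa using e
  · exact ⟨_, (hev n _).trans (eq_socle_tmul b hb hz hm).symm⟩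

include b hb hΛ in
-- The same computation for J: ζ followed by evaluation is s ↦ σ ⊗ s, a bijection onto the socle of
-- J.
lemma quasiIso_zeta : QuasiIso (zeta (k := k) z hz).hom := by
  have : ∀ n, Injective ((bggJ (k := k) z hz).X n) := fun n => hΛ _
  have hev : ∀ (n : ℤ) (s : polyDeg k r n), evSocle b hz
      (homComplexValue (M := bggJ (k := k) z hz) (zeta (k := k) z hz).hom n s) =
        b Finset.univ ⊗ₜ[k] s := by
    intro n s
    change b Finset.univ ⊗ₜ[k] polyMul _ s (polyOne k r) = _
    congr 1
    exact Subtype.ext (mul_one _)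
  refine quasiIso_of_bijective_socle b hb hz (M := bggJ (k := k) z hz) _ (fun n v w h => ?_)
    (fun n m hm => ?_)
  · rw [hev, hev] at h
    have e := congrArg (tensorCoord b _ Finset.univ) h
    rw [tensorCoord_tmul, tensorCoord_tmul] at e
    simpa using e
  · exact ⟨_, (hev n _).trans (eq_socle_tmul b hb hz hm).symm⟩

/-- The functor `Hom(J, -)` from the homotopy category of complexes of injective modules to the
homotopy category of differential graded `S`-modules. -/
abbrev homJInjHtpy (z : Fin r → Λ) (hz : ∀ i, z i * z i = 0) :
    HomotopyCategory (InjectiveObject (ModuleCat.{u} Λ)) (ComplexShape.up ℤ) ⥤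
      HtpyCat (polyDG k r) :=
  (InjectiveObject.ι (ModuleCat.{u} Λ)).mapHomotopyCategory (ComplexShape.up ℤ) ⋙
    homJHtpy (k := k) z hz

instance : (HomotopyCategory.quasiIso (ModuleCat.{u} k)
    (ComplexShape.up ℤ)).HasTwoOutOfThreeProperty where
  of_precomp f g hf hg n :=
    (MorphismProperty.isomorphisms (ModuleCat.{u} k)).of_precomp _ _ (hf n)
      ((HomotopyCategory.homologyFunctor _ _ n).map_comp f g ▸ hg n)
  of_postcomp f g hf hg n :=
    (MorphismProperty.isomorphisms (ModuleCat.{u} k)).of_postcomp _ _ (hf n)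
      ((HomotopyCategory.homologyFunctor _ _ n).map_comp f g ▸ hg n)

instance : (quasiIso (polyDG k r)).HasTwoOutOfThreeProperty := by
  unfold quasiIso; infer_instance

instance : (quasiIso (polyDG k r)).ContainsIdentities := by
  rw [quasiIso_eq]; infer_instance

instance : (quasiIso (polyDG k r)).RespectsIso := by
  rw [quasiIso_eq]; infer_instance

include b hb in
-- By exactness the cone of f has acyclic image under Hom(J, -), so it is zero in the homotopy
-- category and f is invertible.
lemma isIso_of_quasiIso_map
    {M N : HomotopyCategory (InjectiveObject (ModuleCat.{u} Λ)) (ComplexShape.up ℤ)} (f : M ⟶ N)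
    (hf : quasiIso (polyDG k r) ((homJInjHtpy (k := k) z hz).map f)) : IsIso f := by
  obtain ⟨P, g, h, hT⟩ := Pretriangulated.distinguished_cocone_triangle f
  rw [quasiIso_eq] at hf
  have hP := (ObjectProperty.trW_iff_of_distinguished _ _
    ((homJInjHtpy (k := k) z hz).map_distinguished _ hT)).1 hf
  exact (Triangle.isZero₃_iff_isIso₁ _ hT).1 (isZero_of_acyclic_homJ b hb hz P hP)

/-- The complex `J ⊗_S N` as a complex of injective modules. -/
abbrev bggLInj (N : DGModule (polyDG k r)) :
    CochainComplex (InjectiveObject (ModuleCat.{u} Λ)) ℤ where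
  X n := ⟨(bggL z N hz).X n, hΛ _⟩
  d n m := ObjectProperty.homMk ((bggL z N hz).d n m)
  shape n m h := ObjectProperty.hom_ext _ ((bggL z N hz).shape n m h)
  d_comp_d' n m l _ _ := ObjectProperty.hom_ext _ ((bggL z N hz).d_comp_d n m l)

/-- The cochain adjunction descends to homotopy categories. Since Λ ⊗ N has injective terms and
injectives form a full subcategory, J ⊗_S N represents the right functor on K(Inj). -/
lemma bijective_bggUnit_comp (N : DGModule (polyDG k r))
    (Y : HomotopyCategory (InjectiveObject (ModuleCat.{u} Λ)) (ComplexShape.up ℤ)) :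
    Function.Bijective fun f : (HomotopyCategory.quotient _ _).obj (bggLInj hz hΛ N) ⟶ Y =>
      ((htpyQuotient _).map (bggUnit z N hz) : (htpyQuotient _).obj N ⟶
        (homJInjHtpy (k := k) z hz).obj ((HomotopyCategory.quotient _ _).obj (bggLInj hz hΛ N))) ≫
        (homJInjHtpy (k := k) z hz).map f := by
  obtain ⟨M, rfl⟩ : ∃ M, (HomotopyCategory.quotient _ _).obj M = Y := ⟨Y.as, rfl⟩
  let ι := (InjectiveObject.ι (ModuleCat.{u} Λ)).mapHomologicalComplex (ComplexShape.up ℤ)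
  constructor
  · intro f f' h
    obtain ⟨f, rfl⟩ := (HomotopyCategory.quotient _ _).map_surjective f
    obtain ⟨f', rfl⟩ := (HomotopyCategory.quotient _ _).map_surjective f'
    obtain ⟨H⟩ := nonempty_homotopy_of_bggUnit_comp (M := ι.obj M) z hz (N := N)
      (f := ι.map f) (f' := ι.map f') (homotopic_of_map_eq
        (((htpyQuotient _).map_comp _ _).trans (h.trans ((htpyQuotient _).map_comp _ _).symm)))
    exact HomotopyCategory.eq_of_homotopy _ _
      ((InjectiveObject.ι (ModuleCat.{u} Λ)).preimageHomotopy H)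
  · intro g
    obtain ⟨g, rfl⟩ := (htpyQuotient _).map_surjective
      (Y := (homJFunctor (k := k) z hz).obj (ι.obj M)) g
    obtain ⟨f, hf⟩ := exists_bggUnit_comp_eq (M := ι.obj M) z hz g
    obtain ⟨f, rfl⟩ : ∃ f' : bggLInj hz hΛ N ⟶ M, ι.map f' = f :=
      ι.map_surjective (X := bggLInj hz hΛ N) (Y := M) f
    exact ⟨(HomotopyCategory.quotient _ _).map f,
      ((htpyQuotient _).map_comp _ _).symm.trans (congrArg _ hf)⟩

include b hb hΛ in
lemma homJInj_isEquivalence : (homJInj (k := k) z hz).IsEquivalence := by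
  refine isEquivalence_comp_localization_of_universal (homJInjHtpy (k := k) z hz)
    (fun N => (HomotopyCategory.quotient _ _).obj (bggLInj hz hΛ N.as))
    (fun N => (htpyQuotient _).map (bggUnit z N.as hz))
    (fun N Y => bijective_bggUnit_comp hz hΛ N.as Y) (quasiIso (polyDG k r)) (fun N => ?_)
    (isIso_of_quasiIso_map b hb hz)
  exact (HomotopyCategory.quotient_map_mem_quasiIso_iff _).2 (quasiIso_bggUnit b hb hz hΛ N.as)

end Equivalence

end

theorem mainTheorem4 (k : Type u) [Field k] [CharP k 2] (r : ℕ) (E : Type u) [CommGroup E]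
    (hE : ∀ a : E, a ^ 2 = 1) (hcard : Nat.card E = 2 ^ r) (g : Fin r → E)
    (hg : Subgroup.closure (Set.range g) = ⊤) :
    QuasiIso (zeta (k := k) (groupZ k g) (groupZ_mul_self k hE g)).hom ∧
    (homJInj (k := k) (groupZ k g) (groupZ_mul_self k hE g)).IsTriangulated ∧
    (homJInj (k := k) (groupZ k g) (groupZ_mul_self k hE g)).IsEquivalence := by
  obtain ⟨b, hb⟩ := exists_groupZ_basis k hE hcard g hg
  have : Finite E := Nat.finite_of_card_ne_zero (by rw [hcard]; positivity)
  have hΛ := injective_monoidAlgebra_tensor k E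
  exact ⟨quasiIso_zeta b hb _ hΛ, homJInj_isTriangulated _ _, homJInj_isEquivalence b hb _ hΛ⟩
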